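/- **Lumped-mass linear finite elements with the L1 scheme.** *Setting.* Let $d\in\{1,2,3\}$, let $\Omega\subset\mathbb R^d$ be a bounded open set that equals the interior of its closure (as every bounded Lipschitz domain does), and let $\alpha\in(0,1)$, $T>0$, $\lambda\ge 0$. Functions are taken pointwise, and $\|v\|_{L_\infty(\Omega)}:=\sup_{x\in\Omega}|v(x)|$ (for $v$ continuous on $\Omega$ this is the usual norm). Assume that **A1.** for all $x\in\Omega$, $t\in(0,T]$, the map $s\mapsto f(x,t,s)$ is continuous, $f(\cdot,t,s)\in L_\infty(\Omega)$ for all $s\in\mathbb R$, and $f(x,t,s_1)-f(x,t,s_2)\ge-\lambda(s_1-s_2)$ whenever $s_1\ge s_2$. Let $u$ solve $$D_t^\alpha u-\Delta u+f(x,t,u)=0\ \text{ in }\Omega\times(0,T],\qquad u=0\ \text{ on }\partial\Omega\times(0,T],\qquad u(\cdot,0)=u_0\in L_\infty(\Omega),$$ where $D_t^\alpha u(x,t)=\frac1{\Gamma(1-\alpha)}\int_0^t(t-s)^{-\alpha}\partial_su(x,s)\,ds$. Here $u(x,\cdot)$ is continuous on $[0,T]$ and twice differentiable on $(0,T)$ for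 each $x\in\Omega$; $u(\cdot,t)\in H_0^1(\Omega)$ for $t\in(0,T]$; for each $t\in[0,T]$ the function $-\Delta u(\cdot,t)$ is a locally integrable function on $\Omega$ with given point values that represents $-\Delta u(\cdot,t)$ weakly; and for $t>0$ the equation holds at every $x\in\Omega$. Suppose also that, for some constant $K$, $\|\partial_t^lu(\cdot,t)\|_{L_\infty(\Omega)}\le K(1+t^{\alpha-l})$ for $l=1,2$ and $t\in(0,T)$. *Discretization.* For a temporal mesh $0=t_0<t_1<\dots<t_M=T$ ($M\ge1$) with $\tau_j=t_j-t_{j-1}$, $\tau=t_1$, let $$\delta_t^\alpha U^m=\frac1{\Gamma(1-\alpha)}\sum_{j=1}^m\frac{U^j-U^{j-1}}{\tau_j}\int_{t_{j-1}}^{t_j}(t_m-s)^{-\alpha}\,ds .$$ Let $\mathcal T$ be a conforming simplicial triangulation that covers $\overline\Omega$ exactly, $S_h$ the space of continuous functions that are affine on each element and vanish on $\partial\Omega$ (extended by $0$), and $\phi_z$ the hat function of the node $z$. Let $\langle\nabla v,\nabla w\rangle$ be the exact $L_2(\Omega)$ product and $\langle v,w\rangle_h=\sum_{S\in\mathcal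 T}\int_S(vw)^I$, where $v^I$ is the linear Lagrange interpolant. The discrete solution is $u_h^0=u_0$, $u_h^m\in S_h$ with $$\langle\delta_t^\alpha u_h^m,v_h\rangle_h+\langle\nabla u_h^m,\nabla v_h\rangle+\langle f(\cdot,t_m,u_h^m),v_h\rangle_h=0\qquad\forall v_h\in S_h,\quad m=1,\dots,M .\tag{1}$$ The operator $\mathcal L_hU(z)=\langle\nabla U,\nabla\phi_z\rangle/\langle1,\phi_z\rangle_h$ (for interior nodes $z$) is said to be *associated with an M-matrix* if the square matrix, indexed by all mesh nodes (including those on $\partial\Omega$), whose row for an interior node $z$ has the entries $\langle\nabla\phi_y,\nabla\phi_z\rangle/\langle1,\phi_z\rangle_h$ and whose rows for boundary nodes are rows of the identity, has nonpositive off-diagonal entries and is invertible with an entrywise nonnegative inverse. The Ritz projection $\mathcal R_hu(t)\in S_h$ is defined by $\langle\nabla\mathcal R_hu,\nabla v_h\rangle=\langle-\Delta u,v_h\rangle_h$ for all $v_h\in S_h$, $t\in[0,T]$, and $\rho(\cdot,t):=\mathcal R_hu(t)-u(\cdot,t)$. *Theorem.* **(i)** If $\lambda\tau_j^\alpha<\{\Gamma(2-\alpha)\}^{-1}$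 for all $j\ge1$ and $\mathcal L_h$ is associated with an M-matrix, then (1) has a unique solution $\{u_h^j\}_{j=0}^M$. Moreover, for all $r\ge1$, $\kappa>0$, $\epsilon>0$ there is a constant $C$, which depends on $d,\Omega,T,\alpha,\lambda,f,u,K,r,\kappa,\epsilon$ but not on the temporal mesh, its number $M$ of steps, or the triangulation, such that the following holds. If in addition the temporal mesh is quasi-graded, $$\kappa^{-1}M^{-r}\le\tau\le\kappa M^{-r},\qquad\tau_j\le\kappa\,\tau^{1/r}t_j^{1-1/r}\quad(1\le j\le M),$$ and $\rho(x,\cdot)$ is absolutely continuous on $[0,T]$ for each $x\in\Omega$ (so that $\partial_t\rho$ makes sense), then for $m=1,\dots,M$ $$\|u(\cdot,t_m)-u_h^m\|_{L_\infty(\Omega)}\le C\Big(\mathcal E^m+\max_{t\in\{0,t_m\}}\|\rho(\cdot,t)\|_{L_\infty(\Omega)}+\int_0^{t_m}\|\partial_t\rho(\cdot,t)\|_{L_\infty(\Omega)}\,dt\Big),$$ $$\mathcal E^m=\begin{cases}M^{-r}\,t_m^{\alpha-1}&\text{if }1\le r<2-\alpha,\\ M^{-r(1-\epsilon)}\,t_m^{\alpha-(1-\epsilon)}&\text{if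 }r=2-\alpha,\\ M^{\alpha-2}\,t_m^{\alpha-(2-\alpha)/r}&\text{if }r>2-\alpha.\end{cases}$$ **(ii)** If, in addition to the assumptions made for existence and uniqueness in (i), **A2** holds, i.e. $\sigma_1\le0\le\sigma_2$ are constants with $f(x,t,\sigma_1)\le0\le f(x,t,\sigma_2)$ for all $x\in\Omega$, $t\in(0,T]$, and if $\sigma_1\le u_0\le\sigma_2$ in $\Omega$, then $\sigma_1\le u_h^m\le\sigma_2$ in $\Omega$ for all $0\le m\le M$. -/

import Mathlib

open scoped ENNReal ContDiff Gradient Laplacian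

noncomputable section

namespace LumpedFE

open MeasureTheory Set Filter Topology

/-- The ambient Euclidean space `ℝ^d`. -/
abbrev Sp (d : ℕ) : Type := EuclideanSpace ℝ (Fin d)

variable {d : ℕ}

/-! ### Norms, the space `H^1_0` and the weak Laplacian -/

/-- The maximum norm over `Ω`, with values in `[0, ∞]`. The scheme samples point values, so all
functions are honest functions on `Ω` and the supremum is the pointwise one; for functions that are
continuous on the open set `Ω` it is the norm of `L_∞(Ω)`, see `supNorm_eq_eLpNorm`. -/
def supNorm (Ω : Set (Sp d)) (v : Sp d → ℝ) : ℝ≥0∞ := ⨆ x ∈ Ω, ‖v x‖ₑ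

theorem supNorm_eq_eLpNorm {Ω : Set (Sp d)} (hΩ : IsOpen Ω) {v : Sp d → ℝ}
    (hv : ContinuousOn v Ω) : supNorm Ω v = eLpNorm v ⊤ (volume.restrict Ω) := by
  rw [eLpNorm_exponent_top]
  apply le_antisymm
  · refine iSup₂_le fun x hx => ?_
    by_contra hlt
    push Not at hlt
    have hae := ae_le_eLpNormEssSup (f := v) (μ := volume.restrict Ω)
    rw [ae_restrict_iff' hΩ.measurableSet] at hae
    have hc : ContinuousAt (fun y => ‖v y‖ₑ) x :=
      (hv.continuousAt (hΩ.mem_nhds hx)).enorm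
    have hnear : ∀ᶠ y in 𝓝 x, eLpNormEssSup v (volume.restrict Ω) < ‖v y‖ₑ ∧ y ∈ Ω :=
      (hc.eventually (lt_mem_nhds hlt)).and (hΩ.mem_nhds hx)
    obtain ⟨S, hS, hSo, hxS⟩ := eventually_nhds_iff.mp hnear
    have hzero : volume S = 0 := by
      refine measure_mono_null (fun y hy => ?_) (ae_iff.mp hae)
      exact fun h => absurd (h (hS y hy).2) (not_le.mpr (hS y hy).1)
    exact (hSo.measure_pos volume ⟨x, hxS⟩).ne' hzero
  · refine eLpNormEssSup_le_of_ae_enorm_bound ?_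
    rw [ae_restrict_iff' hΩ.measurableSet]
    exact Eventually.of_forall fun x hx => le_iSup₂ (f := fun x (_ : x ∈ Ω) => ‖v x‖ₑ) x hx

/-- Smooth functions with compact support in `Ω`. -/
def IsTest (Ω : Set (Sp d)) (φ : Sp d → ℝ) : Prop :=
  ContDiff ℝ ∞ φ ∧ HasCompactSupport φ ∧ tsupport φ ⊆ Ω

/-- `v ∈ H^1_0(Ω)`: the function `v` is an `L_2` limit of test functions whose gradients converge
in `L_2` as well (to the weak gradient `g` of `v`). -/
def MemH10 (Ω : Set (Sp d)) (v : Sp d → ℝ) : Prop :=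
  MemLp v 2 (volume.restrict Ω) ∧
  ∃ g : Sp d → Sp d, MemLp g 2 (volume.restrict Ω) ∧
  ∃ φ : ℕ → Sp d → ℝ, (∀ n, IsTest Ω (φ n)) ∧
    Tendsto (fun n => eLpNorm (fun x => φ n x - v x) 2 (volume.restrict Ω)) atTop (𝓝 0) ∧
    Tendsto (fun n => eLpNorm (fun x => ∇ (φ n) x - g x) 2 (volume.restrict Ω)) atTop (𝓝 0)

/-- `w = -Δ v` in `Ω` in the weak sense. -/
def IsWeakNegLaplacian (Ω : Set (Sp d)) (v w : Sp d → ℝ) : Prop :=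
  LocallyIntegrableOn w Ω ∧
  ∀ φ : Sp d → ℝ, IsTest Ω φ → ∫ x in Ω, v x * (-(Δ φ x)) = ∫ x in Ω, w x * φ x

/-! ### The continuous problem -/

/-- The Caputo derivative of order `α` at time `t`. -/
def caputo (α : ℝ) (y : ℝ → ℝ) (t : ℝ) : ℝ :=
  (Real.Gamma (1 - α))⁻¹ * ∫ s in (0 : ℝ)..t, (t - s) ^ (-α) * deriv y s

/-- Assumption A1: `f` is continuous in its last argument, bounded in `x`, and satisfies a one-sided
Lipschitz condition with the constant `lam`. -/
structure AssumptionA1 (Ω : Set (Sp d)) (T lam : ℝ) (f : Sp d → ℝ → ℝ → ℝ) : Prop where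
  continuous : ∀ x ∈ Ω, ∀ t ∈ Ioc 0 T, Continuous (f x t)
  memLp_top : ∀ t ∈ Ioc 0 T, ∀ s : ℝ, MemLp (fun x => f x t s) ⊤ (volume.restrict Ω)
  one_sided : ∀ x ∈ Ω, ∀ t ∈ Ioc 0 T, ∀ s₁ s₂ : ℝ, s₂ ≤ s₁ →
    -lam * (s₁ - s₂) ≤ f x t s₁ - f x t s₂

/-- Assumption A2: a sign condition on `f` at the constants `σ₁ ≤ 0 ≤ σ₂` (the operator `-Δ` has no
zero-order term). -/
structure AssumptionA2 (Ω : Set (Sp d)) (T σ₁ σ₂ : ℝ) (f : Sp d → ℝ → ℝ → ℝ) : Prop where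
  nonpos : σ₁ ≤ 0
  nonneg : 0 ≤ σ₂
  lower : ∀ x ∈ Ω, ∀ t ∈ Ioc 0 T, f x t σ₁ ≤ 0
  upper : ∀ x ∈ Ω, ∀ t ∈ Ioc 0 T, 0 ≤ f x t σ₂

/-- `u` solves `D_t^α u - Δ u + f(x, t, u) = 0` in `Ω × (0, T]` with `u = 0` on `∂Ω` and with the
initial value `u(·, 0)`, attained continuously. The function `w` is `-Δ u`, understood weakly; its
point values are those that the equation gives, and they enter the Ritz projection. -/
structure IsSolution (α T : ℝ) (Ω : Set (Sp d)) (f : Sp d → ℝ → ℝ → ℝ) (u w : Sp d → ℝ → ℝ) :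
    Prop where
  continuousOn_time : ∀ x ∈ Ω, ContinuousOn (u x) (Icc 0 T)
  memH10 : ∀ t ∈ Ioc 0 T, MemH10 Ω (fun x => u x t)
  negLaplacian : ∀ t ∈ Icc 0 T, IsWeakNegLaplacian Ω (fun x => u x t) (fun x => w x t)
  equation : ∀ x ∈ Ω, ∀ t ∈ Ioc 0 T, caputo α (u x) t + w x t + f x t (u x t) = 0

/-- `‖∂_t^l u(·, t)‖ ≤ K (1 + t^(α - l))` for `l = 1, 2`. -/
structure TimeRegular (α T K : ℝ) (Ω : Set (Sp d)) (u : Sp d → ℝ → ℝ) : Prop where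
  differentiable : ∀ x ∈ Ω, ∀ t ∈ Ioo 0 T,
    DifferentiableAt ℝ (u x) t ∧ DifferentiableAt ℝ (deriv (u x)) t
  bound : ∀ l ∈ ({1, 2} : Set ℕ), ∀ t ∈ Ioo 0 T,
    supNorm Ω (fun x => iteratedDeriv l (u x) t) ≤ ENNReal.ofReal (K * (1 + t ^ (α - (l : ℝ))))

/-! ### Temporal meshes and the L1 operator -/

/-- `0 = t_0 < t_1 < … < t_M = T`; the values `t j` with `j > M` are irrelevant. -/
structure IsTimeMesh (T : ℝ) (M : ℕ) (t : ℕ → ℝ) : Prop where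
  pos : 1 ≤ M
  zero : t 0 = 0
  final : t M = T
  lt_succ : ∀ j < M, t j < t (j + 1)

/-- The quasi-graded condition with exponent `r`, all its hidden constants being bounded by `κ`. -/
structure IsQuasiGraded (r κ : ℝ) (M : ℕ) (t : ℕ → ℝ) : Prop where
  first_ge : κ⁻¹ * (M : ℝ) ^ (-r) ≤ t 1
  first_le : t 1 ≤ κ * (M : ℝ) ^ (-r)
  step_le : ∀ j ∈ Finset.Icc 1 M,
    t j - t (j - 1) ≤ κ * (t 1) ^ (1 / r) * (t j) ^ (1 - 1 / r)

/-- `lam τ_j^α < 1 / Γ(2 - α)` for all time steps `τ_j`. -/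
def StepCondition (α lam : ℝ) (M : ℕ) (t : ℕ → ℝ) : Prop :=
  ∀ j ∈ Finset.Icc 1 M, lam * (t j - t (j - 1)) ^ α < (Real.Gamma (2 - α))⁻¹

/-- The L1 discrete fractional derivative `δ_t^α U^m`. -/
def deltaL1 (α : ℝ) (t : ℕ → ℝ) (U : ℕ → ℝ) (m : ℕ) : ℝ :=
  (Real.Gamma (1 - α))⁻¹ * ∑ j ∈ Finset.Icc 1 m,
    (U j - U (j - 1)) / (t j - t (j - 1)) * ∫ s in (t (j - 1))..(t j), (t m - s) ^ (-α)

/-- The temporal error term `ℰ^m` at the time `s = t_m`. -/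
def errorE (α r ε : ℝ) (M : ℕ) (s : ℝ) : ℝ :=
  if r < 2 - α then (M : ℝ) ^ (-r) * s ^ (α - 1)
  else if r = 2 - α then (M : ℝ) ^ (-r * (1 - ε)) * s ^ (α - (1 - ε))
  else (M : ℝ) ^ (α - 2) * s ^ (α - (2 - α) / r)

/-! ### Triangulations and linear finite elements -/

/-- A conforming simplicial triangulation that covers `closure Ω` exactly: a finite simplicial
complex, each face of which is a face of a `d`-dimensional simplex. -/
structure Triangulation (Ω : Set (Sp d)) extends Geometry.SimplicialComplex ℝ (Sp d) where
  finite_faces : faces.Finite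
  pure_dim : ∀ s ∈ faces, ∃ t ∈ faces, s ⊆ t ∧ t.card = d + 1
  space_eq : toSimplicialComplex.space = closure Ω

namespace Triangulation

variable {Ω : Set (Sp d)} (𝒯 : Triangulation Ω)

/-- The mesh elements, given by their sets of `d + 1` vertices. -/
def cells : Finset (Finset (Sp d)) := {s ∈ 𝒯.finite_faces.toFinset | s.card = d + 1}

open Classical in
/-- All mesh nodes, those on `∂Ω` included. -/
def nodes : Finset (Sp d) := 𝒯.cells.biUnion id

/-- `c` is the family of barycentric coordinates of `x` in a mesh element that contains `x`. -/
def IsBary (x : Sp d) (c : Sp d → ℝ) : Prop :=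
  ∃ s ∈ 𝒯.cells, (∀ z ∈ s, 0 ≤ c z) ∧ (∀ z ∉ s, c z = 0) ∧ ∑ z ∈ s, c z = 1 ∧
    ∑ z ∈ s, c z • z = x

open Classical in
/-- The hat function of the node `z`: its value at `x ∈ closure Ω` is the barycentric coordinate of
`x` that belongs to `z` (see `hat_eq`), and it is `0` off `closure Ω`. -/
def hat (z x : Sp d) : ℝ := if h : ∃ c, 𝒯.IsBary x c then h.choose z else 0

/-- The linear Lagrange interpolant `v^I`. -/
def interp (v : Sp d → ℝ) (x : Sp d) : ℝ := ∑ z ∈ 𝒯.nodes, v z * 𝒯.hat z x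

/-- The lumped-mass inner product, by the quadrature rule `Q_T[g] = ∫_T g^I` on each element. -/
def lumped (v w : Sp d → ℝ) : ℝ :=
  ∑ s ∈ 𝒯.cells, ∫ x in convexHull ℝ (s : Set (Sp d)), 𝒯.interp (fun y => v y * w y) x

/-- The space `S_h ⊆ H^1_0(Ω) ∩ C(closure Ω)` of continuous functions that are affine on each mesh
element and vanish on `∂Ω`; they are extended by `0` to `ℝ^d`. -/
def feSpace : Submodule ℝ (Sp d → ℝ) where
  carrier := {v | Continuous v ∧ (∀ x ∉ Ω, v x = 0) ∧
    ∀ s ∈ 𝒯.cells, ∃ g : Sp d →ᵃ[ℝ] ℝ, EqOn v g (convexHull ℝ (s : Set (Sp d)))}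
  zero_mem' := ⟨continuous_zero, fun _ _ => rfl, fun _ _ => ⟨0, fun _ _ => rfl⟩⟩
  add_mem' := by
    rintro v w ⟨hv, hv0, hva⟩ ⟨hw, hw0, hwa⟩
    refine ⟨hv.add hw, fun x hx => by simp [hv0 x hx, hw0 x hx], fun s hs => ?_⟩
    obtain ⟨g, hg⟩ := hva s hs
    obtain ⟨k, hk⟩ := hwa s hs
    exact ⟨g + k, fun x hx => by simp [hg hx, hk hx]⟩
  smul_mem' := by
    rintro a v ⟨hv, hv0, hva⟩
    refine ⟨hv.const_smul a, fun x hx => by simp [hv0 x hx], fun s hs => ?_⟩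
    obtain ⟨g, hg⟩ := hva s hs
    exact ⟨a • g, fun x hx => by simp [hg hx]⟩

/-- The barycentric coordinates of a point do not depend on the mesh element. -/
theorem IsBary.unique {x : Sp d} {c c' : Sp d → ℝ} (h : 𝒯.IsBary x c) (h' : 𝒯.IsBary x c') :
    c = c' := by
  classical
  obtain ⟨s, hs, hn, h0, h1, hx⟩ := h
  obtain ⟨s', hs', hn', h0', h1', hx'⟩ := h'
  have hsf : s ∈ 𝒯.faces := by simpa using (Finset.mem_filter.mp hs).1
  have hsf' : s' ∈ 𝒯.faces := by simpa using (Finset.mem_filter.mp hs').1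
  have mem : ∀ {a : Finset (Sp d)} {b : Sp d → ℝ}, (∀ z ∈ a, 0 ≤ b z) → ∑ z ∈ a, b z = 1 →
      ∑ z ∈ a, b z • z = x → x ∈ convexHull ℝ (a : Set (Sp d)) := by
    intro a b hb hb1 hbx
    exact Finset.mem_convexHull'.mpr ⟨b, hb, hb1, hbx⟩
  have hint := 𝒯.inter_subset_convexHull hsf hsf' ⟨mem hn h1 hx, mem hn' h1' hx'⟩
  rw [← Finset.coe_inter] at hint
  obtain ⟨b, -, hb1, hbx⟩ := Finset.mem_convexHull'.mp hint
  have key : ∀ {a : Finset (Sp d)} {e : Sp d → ℝ}, a ∈ 𝒯.faces → s ∩ s' ⊆ a →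
      (∀ z ∉ a, e z = 0) → ∑ z ∈ a, e z = 1 → ∑ z ∈ a, e z • z = x →
      e = fun z => if z ∈ s ∩ s' then b z else 0 := by
    intro a e ha hsub he0 he1 hex
    have hind := 𝒯.indep ha
    rw [affineIndependent_iff] at hind
    have hb1' : ∑ z ∈ a, (if z ∈ s ∩ s' then b z else 0) = 1 := by
      rw [← Finset.sum_filter, Finset.filter_mem_eq_inter, Finset.inter_eq_right.mpr hsub, hb1]
    have hbx' : ∑ z ∈ a, (if z ∈ s ∩ s' then b z else 0) • z = x := by
      simp only [ite_smul, zero_smul]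
      rw [← Finset.sum_filter, Finset.filter_mem_eq_inter, Finset.inter_eq_right.mpr hsub, hbx]
    have := hind Finset.univ (fun z : a => e z - if (z : Sp d) ∈ s ∩ s' then b z else 0)
      (by
        rw [Finset.sum_coe_sort a (fun z => e z - if z ∈ s ∩ s' then b z else 0),
          Finset.sum_sub_distrib, he1, hb1', sub_self])
      (by
        rw [Finset.sum_coe_sort a (fun z => (e z - if z ∈ s ∩ s' then b z else 0) • z)]
        simp only [sub_smul]
        rw [Finset.sum_sub_distrib, hex, hbx', sub_self])
    funext z
    by_cases hz : z ∈ a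
    · exact sub_eq_zero.mp (this ⟨z, hz⟩ (Finset.mem_univ _))
    · rw [he0 z hz, if_neg fun h => hz (hsub h)]
  rw [key hsf Finset.inter_subset_left h0 h1 hx, key hsf' Finset.inter_subset_right h0' h1' hx']

theorem hat_eq {x : Sp d} {c : Sp d → ℝ} (h : 𝒯.IsBary x c) (z : Sp d) : 𝒯.hat z x = c z := by
  have h' : ∃ c, 𝒯.IsBary x c := ⟨c, h⟩
  rw [hat, dif_pos h', h'.choose_spec.unique 𝒯 h]

end Triangulation

variable {Ω : Set (Sp d)} (𝒯 : Triangulation Ω)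

/-- `⟨∇v, ∇w⟩` in `L_2(Ω)`; the gradients of piecewise affine functions are the classical ones,
which exist off the null set formed by the boundaries of the mesh elements. -/
def stiffness (Ω : Set (Sp d)) (v w : Sp d → ℝ) : ℝ := ∫ x in Ω, inner ℝ (∇ v x) (∇ w x)

/-- A (nonsingular) M-matrix: nonpositive off-diagonal entries, and an inverse with nonnegative
entries. -/
def IsMMatrix {n : Type*} [Fintype n] [DecidableEq n] (A : Matrix n n ℝ) : Prop :=
  (∀ i j, i ≠ j → A i j ≤ 0) ∧ IsUnit A.det ∧ ∀ i j, 0 ≤ A⁻¹ i j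

open Classical in
/-- The matrix, on all nodal values, of the operator `ℒ_h` with Dirichlet boundary conditions: in
the row of an interior node `z` it is `ℒ_h U(z) = ⟨∇ U, ∇ φ_z⟩ / ⟨1, φ_z⟩_h`, and in the row of a
boundary node it is the identity. -/
def lumpedMatrix : Matrix 𝒯.nodes 𝒯.nodes ℝ := fun z y =>
  if (z : Sp d) ∈ Ω then
    stiffness Ω (𝒯.hat y) (𝒯.hat z) / 𝒯.lumped (fun _ => 1) (𝒯.hat z)
  else if z = y then 1 else 0

open Classical in
/-- The operator `ℒ_h` is associated with an M-matrix. -/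
def HasMMatrix : Prop := IsMMatrix (lumpedMatrix 𝒯)

/-- `U^0 = u_0`, and `U^1, …, U^M` solve the fully discrete problem; the terms `U^m` with `m > M`
are irrelevant. -/
structure IsDiscreteSolution (α : ℝ) (f : Sp d → ℝ → ℝ → ℝ) (u₀ : Sp d → ℝ) (M : ℕ) (t : ℕ → ℝ)
    (U : ℕ → Sp d → ℝ) : Prop where
  initial : U 0 = u₀
  mem : ∀ m ∈ Finset.Icc 1 M, U m ∈ 𝒯.feSpace
  equation : ∀ m ∈ Finset.Icc 1 M, ∀ v ∈ 𝒯.feSpace,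
    𝒯.lumped (fun x => deltaL1 α t (fun j => U j x) m) v + stiffness Ω (U m) v +
      𝒯.lumped (fun x => f x (t m) (U m x)) v = 0

/-- `R` is the Ritz projection of a function with negative Laplacian `w`. -/
def IsRitz (w R : Sp d → ℝ) : Prop :=
  R ∈ 𝒯.feSpace ∧ ∀ v ∈ 𝒯.feSpace, stiffness Ω R v = 𝒯.lumped w v

open Classical in
/-- The Ritz projection, as a function of `w = -Δ u`. -/
def ritz (w : Sp d → ℝ) : Sp d → ℝ := if h : ∃ R, IsRitz 𝒯 w R then h.choose else 0

/-- The error `ρ(x, t)` of the Ritz projection, with `w = -Δ u`. -/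
def ritzError (u w : Sp d → ℝ → ℝ) (x : Sp d) (t : ℝ) : ℝ :=
  ritz 𝒯 (fun y => w y t) x - u x t

end LumpedFE

end

open LumpedFE

open scoped ENNReal ContDiff Gradient Laplacian

noncomputable section

namespace LumpedFE

open MeasureTheory Set Filter Topology

variable {d : ℕ}

/-! ### Barycentric coordinates, hat functions and lumped masses -/

namespace Triangulation

variable {Ω : Set (Sp d)} (𝒯 : Triangulation Ω)

/-! Mass lumping makes all zero-order terms diagonal in the nodal values, so the scheme is
equivalent to the equations `δ_t^α U^m(z) + ℒ_h U^m(z) + f(z, t_m, U^m(z)) = 0` at the interior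
nodes `z` (`isDiscreteSolution_iff`). The hat functions sum to one, so the rows of `ℒ_h` sum to
zero; with nonpositive off-diagonal entries this gives `ℒ_h v(z) ≥ 0` at every interior node where
`v` is maximal (`OffDiagNonpos.opL_nonneg`). In time, the weights of the L1 increments grow towards
the present, so the past values enter `δ_t^α U^m` with nonpositive coefficients
(`deltaL1_le_of_nonneg`), and the step condition says that the coefficient of `U^m` exceeds `λ`.
Each time level is therefore a strongly monotone problem, solved by a contraction argument
(`exists_nonlinear`). Uniqueness and the bounds `σ₁ ≤ u_h ≤ σ₂` follow from the maximum principle.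

For the error put `η = R_h u - u_h` and `ρ = R_h u - u`, so that `η - ρ = u - u_h`. Subtracting the
equations gives `δ_t^α(η - ρ) + ℒ_h η + f(u) - f(u_h) =` truncation error. Where `η ≥ ρ` the
one-sided condition on `f` applies, and `η` is compared with `P + W` (`IsErrorPair.le_of_barrier`).
Here `P(t_m) = ‖ρ(0)‖ + ∫ ‖∂_t ρ‖` dominates `ρ` together with its increments, hence also `δ_t^α ρ`,
and `W` is a barrier for which `(δ_t^α - λ)W` dominates the truncation error plus `2λP`. The same
argument for `-η` gives the other sign.

The truncation error is read off from the Marchaud form, in which it is the integral of `(t_m -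
s)^{-α-1}` against an interpolation error. It is `O((τ/t_m)^p)` for `p < 1 + α`, `p ≤ (2 - α)/r`
(`exists_truncation_bound`).

The barriers come from powers `s^β` that are replaced by a linear function near `0`. For `α - 1 < β
< 0` the fractional derivative of `s^β` is a positive multiple of `s^{β-α}`, and the discretisation
error is absorbed once the cutoff sits at a large multiple of `τ` (`hasBarrier_zero_of_neg`). At `β
= α - 1`, which is needed for `r < 2 - α`, that multiple vanishes; the gain then comes from the
cutoff itself, and a geometric sum over dyadic cutoffs suffices (`hasBarrier_critical`). The term
`-λW` is compensated by further barriers with exponents `β + α`, `β + 2α`, ..., up to a nonnegative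
one, for which `e^{μt} t^β` works (`hasBarrier_of_nonneg`).

These barriers exist only for `M ≥ M₀`, as `μτ_j ≤ 1` is needed. Below that there are boundedly many
steps and `ℰ^m` is bounded below, so a crude stability estimate is enough. The step condition may,
however, be nearly sharp, and the constant must not blow up; control then comes from `ℒ_h`, through
the discrete torsion function `ℒ_h ψ = 1`. It is bounded uniformly in the triangulation by
Stampacchia's iteration, with a Sobolev inequality for finite element functions
(`exists_torsion_bound`). -/

variable {𝒯} in
theorem mem_cells {s : Finset (Sp d)} : s ∈ 𝒯.cells ↔ s ∈ 𝒯.faces ∧ s.card = d + 1 := by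
  simp [cells]

theorem exists_isBary {s : Finset (Sp d)} (hs : s ∈ 𝒯.cells) {x : Sp d}
    (hx : x ∈ convexHull ℝ (s : Set (Sp d))) :
    ∃ c : Sp d → ℝ, 𝒯.IsBary x c ∧ (∀ z ∈ s, 0 ≤ c z) ∧ (∀ z ∉ s, c z = 0) ∧ ∑ z ∈ s, c z = 1 ∧
      ∑ z ∈ s, c z • z = x := by
  classical
  obtain ⟨w, hw, hw1, hwx⟩ := Finset.mem_convexHull'.mp hx
  have key : (∀ z ∈ s, 0 ≤ (fun z => if z ∈ s then w z else 0) z) ∧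
      (∀ z ∉ s, (fun z => if z ∈ s then w z else 0) z = 0) ∧
      ∑ z ∈ s, (fun z => if z ∈ s then w z else 0) z = 1 ∧
      ∑ z ∈ s, (fun z => if z ∈ s then w z else 0) z • z = x := by
    refine ⟨fun z hz => by simp [hz, hw z hz], fun z hz => by simp [hz], ?_, ?_⟩
    · rw [← hw1]; exact Finset.sum_congr rfl fun z hz => by simp [hz]
    · rw [← hwx]; exact Finset.sum_congr rfl fun z hz => by simp [hz]
  exact ⟨_, ⟨s, hs, key⟩, key⟩

theorem exists_cell {x : Sp d} (hx : x ∈ closure Ω) :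
    ∃ s ∈ 𝒯.cells, x ∈ convexHull ℝ (s : Set (Sp d)) := by
  rw [← 𝒯.space_eq, Geometry.SimplicialComplex.mem_space_iff] at hx
  obtain ⟨s, hs, hx⟩ := hx
  obtain ⟨s', hs', hss, hc⟩ := 𝒯.pure_dim s hs
  exact ⟨s', mem_cells.mpr ⟨hs', hc⟩, convexHull_mono (by exact_mod_cast hss) hx⟩

theorem convexHull_subset_closure {s : Finset (Sp d)} (hs : s ∈ 𝒯.cells) :
    convexHull ℝ (s : Set (Sp d)) ⊆ closure Ω := by
  rw [← 𝒯.space_eq]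
  exact 𝒯.convexHull_subset_space (mem_cells.mp hs).1

theorem closure_eq : closure Ω = ⋃ s ∈ 𝒯.cells, convexHull ℝ (s : Set (Sp d)) := by
  ext x
  simp only [mem_iUnion, exists_prop]
  exact ⟨𝒯.exists_cell, fun ⟨s, hs, hx⟩ => 𝒯.convexHull_subset_closure hs hx⟩

variable {𝒯} in
theorem mem_nodes {z : Sp d} : z ∈ 𝒯.nodes ↔ ∃ s ∈ 𝒯.cells, z ∈ s := by
  simp [nodes]

theorem subset_nodes {s : Finset (Sp d)} (hs : s ∈ 𝒯.cells) : s ⊆ 𝒯.nodes :=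
  fun _ hz => mem_nodes.mpr ⟨s, hs, hz⟩

theorem hat_of_notMem {x : Sp d} (hx : x ∉ closure Ω) (z : Sp d) : 𝒯.hat z x = 0 := by
  rw [hat, dif_neg]
  rintro ⟨c, s, hs, hn, -, h1, hcx⟩
  exact hx (𝒯.convexHull_subset_closure hs (Finset.mem_convexHull'.mpr ⟨c, hn, h1, hcx⟩))

theorem hat_nonneg (z x : Sp d) : 0 ≤ 𝒯.hat z x := by
  by_cases hx : x ∈ closure Ω
  · obtain ⟨s, hs, hxs⟩ := 𝒯.exists_cell hx
    obtain ⟨c, hc, hn, h0, -⟩ := 𝒯.exists_isBary hs hxs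
    rw [𝒯.hat_eq hc]
    by_cases hz : z ∈ s
    · exact hn z hz
    · exact (h0 z hz).ge
  · exact (𝒯.hat_of_notMem hx z).ge

theorem hat_eq_zero {s : Finset (Sp d)} (hs : s ∈ 𝒯.cells) {x : Sp d}
    (hx : x ∈ convexHull ℝ (s : Set (Sp d))) {z : Sp d} (hz : z ∉ s) : 𝒯.hat z x = 0 := by
  obtain ⟨c, hc, -, h0, -⟩ := 𝒯.exists_isBary hs hx
  rw [𝒯.hat_eq hc, h0 z hz]

theorem sum_cell_hat {s : Finset (Sp d)} (hs : s ∈ 𝒯.cells) {x : Sp d}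
    (hx : x ∈ convexHull ℝ (s : Set (Sp d))) : ∑ z ∈ s, 𝒯.hat z x = 1 := by
  obtain ⟨c, hc, -, -, h1, -⟩ := 𝒯.exists_isBary hs hx
  rw [← h1]; exact Finset.sum_congr rfl fun z _ => 𝒯.hat_eq hc z

theorem sum_cell_hat_smul {s : Finset (Sp d)} (hs : s ∈ 𝒯.cells) {x : Sp d}
    (hx : x ∈ convexHull ℝ (s : Set (Sp d))) : ∑ z ∈ s, 𝒯.hat z x • z = x := by
  obtain ⟨c, hc, -, -, -, h1⟩ := 𝒯.exists_isBary hs hx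
  nth_rw 2 [← h1]; exact Finset.sum_congr rfl fun z _ => by rw [𝒯.hat_eq hc z]

theorem interp_eq_sum_cell {s : Finset (Sp d)} (hs : s ∈ 𝒯.cells) {x : Sp d}
    (hx : x ∈ convexHull ℝ (s : Set (Sp d))) (v : Sp d → ℝ) :
    𝒯.interp v x = ∑ z ∈ s, v z * 𝒯.hat z x :=
  (Finset.sum_subset (𝒯.subset_nodes hs) fun z _ hz => by rw [𝒯.hat_eq_zero hs hx hz, mul_zero]).symm

theorem interp_of_notMem {x : Sp d} (hx : x ∉ closure Ω) (v : Sp d → ℝ) : 𝒯.interp v x = 0 :=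
  Finset.sum_eq_zero fun z _ => by rw [𝒯.hat_of_notMem hx, mul_zero]

theorem interp_const {x : Sp d} (hx : x ∈ closure Ω) (a : ℝ) : 𝒯.interp (fun _ => a) x = a := by
  obtain ⟨s, hs, hxs⟩ := 𝒯.exists_cell hx
  rw [𝒯.interp_eq_sum_cell hs hxs, ← Finset.mul_sum, 𝒯.sum_cell_hat hs hxs, mul_one]

open Classical in
theorem hat_node (z : Sp d) {y : Sp d} (hy : y ∈ 𝒯.nodes) :
    𝒯.hat z y = if z = y then 1 else 0 := by
  obtain ⟨s, hs, hy⟩ := mem_nodes.mp hy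
  have : 𝒯.IsBary y (fun z => if z = y then 1 else 0) := by
    refine ⟨s, hs, fun z _ => by positivity, fun z hz => ?_, ?_, ?_⟩
    · change (if z = y then (1 : ℝ) else 0) = 0
      rw [if_neg]; rintro rfl; exact hz hy
    · simp [hy]
    · simp [ite_smul, hy]
  rw [𝒯.hat_eq this]

theorem interp_node (v : Sp d → ℝ) {y : Sp d} (hy : y ∈ 𝒯.nodes) : 𝒯.interp v y = v y := by
  classical
  simp [interp, 𝒯.hat_node _ hy, hy]

theorem affine_eq_sum {s : Finset (Sp d)} (hs : s ∈ 𝒯.cells) {x : Sp d}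
    (hx : x ∈ convexHull ℝ (s : Set (Sp d))) (g : Sp d →ᵃ[ℝ] ℝ) :
    g x = ∑ z ∈ s, g z * 𝒯.hat z x := by
  have h1 := 𝒯.sum_cell_hat hs hx
  have hx' := 𝒯.sum_cell_hat_smul hs hx
  have hg : ∀ y, g y = g.linear y + g 0 := fun y => congrFun g.decomp y
  have hr : ∑ z ∈ s, g z * 𝒯.hat z x = ∑ z ∈ s, (𝒯.hat z x * g.linear z + g 0 * 𝒯.hat z x) :=
    Finset.sum_congr rfl fun z _ => by rw [hg z]; ring
  rw [hr, Finset.sum_add_distrib, ← Finset.mul_sum, h1, hg x, mul_one]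
  conv_lhs => rw [← hx']
  simp [map_sum]

theorem interp_eq_affine {s : Finset (Sp d)} (hs : s ∈ 𝒯.cells) {v : Sp d → ℝ}
    {g : Sp d →ᵃ[ℝ] ℝ} (hg : EqOn v g (convexHull ℝ (s : Set (Sp d)))) {x : Sp d}
    (hx : x ∈ convexHull ℝ (s : Set (Sp d))) : 𝒯.interp v x = v x := by
  rw [𝒯.interp_eq_sum_cell hs hx, hg hx, 𝒯.affine_eq_sum hs hx]
  exact Finset.sum_congr rfl fun z hz => by rw [hg (subset_convexHull ℝ _ hz)]

theorem interp_eq_self {v : Sp d → ℝ} (hv : v ∈ 𝒯.feSpace) : 𝒯.interp v = v := by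
  obtain ⟨-, h0, ha⟩ := hv
  funext x
  by_cases hx : x ∈ closure Ω
  · obtain ⟨s, hs, hxs⟩ := 𝒯.exists_cell hx
    obtain ⟨g, hg⟩ := ha s hs
    exact 𝒯.interp_eq_affine hs hg hxs
  · rw [𝒯.interp_of_notMem hx, h0 x fun h => hx (subset_closure h)]

theorem affineIndependent_cell {s : Finset (Sp d)} (hs : s ∈ 𝒯.cells) :
    AffineIndependent ℝ ((↑) : s → Sp d) := 𝒯.indep (mem_cells.mp hs).1

theorem affineSpan_cell {s : Finset (Sp d)} (hs : s ∈ 𝒯.cells) :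
    affineSpan ℝ (s : Set (Sp d)) = ⊤ := by
  have := (𝒯.affineIndependent_cell hs).affineSpan_eq_top_iff_card_eq_finrank_add_one.mpr
    (by simp [(mem_cells.mp hs).2])
  simpa using this

/-- The `d + 1` vertices of an element are an affine basis of the whole space, and `φ_z` restricts
to the coordinate of the vertex `z`, or to `0` if `z` is not a vertex. -/
theorem exists_affine_hat {s : Finset (Sp d)} (hs : s ∈ 𝒯.cells) (z : Sp d) :
    ∃ g : Sp d →ᵃ[ℝ] ℝ, EqOn (𝒯.hat z) g (convexHull ℝ (s : Set (Sp d))) := by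
  classical
  by_cases hz : z ∈ s
  · let b : AffineBasis s ℝ (Sp d) := ⟨(↑), 𝒯.affineIndependent_cell hs, by
      simpa using 𝒯.affineSpan_cell hs⟩
    refine ⟨b.coord ⟨z, hz⟩, fun x hx => ?_⟩
    rw [𝒯.affine_eq_sum hs hx, Finset.sum_eq_single_of_mem z hz]
    · have : b.coord ⟨z, hz⟩ z = 1 := b.coord_apply_eq ⟨z, hz⟩
      rw [this, one_mul]
    · intro y hy hyz
      have : b.coord ⟨z, hz⟩ y = 0 := b.coord_apply_ne (j := ⟨y, hy⟩) (by simpa using hyz.symm)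
      rw [this, zero_mul]
  · exact ⟨0, fun x hx => by simp [𝒯.hat_eq_zero hs hx hz]⟩

/-- The affine function that agrees with the hat function of `z` on the mesh element `s`. -/
def hatAffine (s : Finset (Sp d)) (z : Sp d) : Sp d →ᵃ[ℝ] ℝ :=
  if h : s ∈ 𝒯.cells then (𝒯.exists_affine_hat h z).choose else 0

theorem hat_eq_hatAffine {s : Finset (Sp d)} (hs : s ∈ 𝒯.cells) (z : Sp d) :
    EqOn (𝒯.hat z) (𝒯.hatAffine s z) (convexHull ℝ (s : Set (Sp d))) := by
  rw [hatAffine, dif_pos hs]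
  exact (𝒯.exists_affine_hat hs z).choose_spec

theorem isCompact_cell (s : Finset (Sp d)) : IsCompact (convexHull ℝ (s : Set (Sp d))) :=
  s.finite_toSet.isCompact_convexHull ℝ

theorem continuousOn_hat_cell {s : Finset (Sp d)} (hs : s ∈ 𝒯.cells) (z : Sp d) :
    ContinuousOn (𝒯.hat z) (convexHull ℝ (s : Set (Sp d))) :=
  (𝒯.hatAffine s z).continuous_of_finiteDimensional.continuousOn.congr (𝒯.hat_eq_hatAffine hs z)

/-- Continuity on finitely many closed elements glues to continuity on their union. -/
theorem continuousOn_hat (z : Sp d) : ContinuousOn (𝒯.hat z) (closure Ω) := by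
  rw [𝒯.closure_eq]
  have : (⋃ s ∈ 𝒯.cells, convexHull ℝ (s : Set (Sp d))) =
      ⋃ s : 𝒯.cells, convexHull ℝ ((s : Finset (Sp d)) : Set (Sp d)) := by
    simp [iUnion_subtype]
  rw [this]
  exact (locallyFinite_of_finite _).continuousOn_iUnion
    (fun s => (isCompact_cell _).isClosed) fun s => 𝒯.continuousOn_hat_cell s.2 z

theorem volume_cell_ne_top (s : Finset (Sp d)) :
    volume (convexHull ℝ (s : Set (Sp d))) ≠ ⊤ := (isCompact_cell s).measure_lt_top.ne

theorem interior_cell_nonempty {s : Finset (Sp d)} (hs : s ∈ 𝒯.cells) :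
    (interior (convexHull ℝ (s : Set (Sp d)))).Nonempty :=
  interior_convexHull_nonempty_iff_affineSpan_eq_top.mpr (𝒯.affineSpan_cell hs)

theorem volume_cell_pos {s : Finset (Sp d)} (hs : s ∈ 𝒯.cells) :
    0 < volume (convexHull ℝ (s : Set (Sp d))) :=
  (isOpen_interior.measure_pos volume (𝒯.interior_cell_nonempty hs)).trans_le
    (measure_mono interior_subset)

theorem integrableOn_hat_cell {s : Finset (Sp d)} (hs : s ∈ 𝒯.cells) (z : Sp d) :
    IntegrableOn (𝒯.hat z) (convexHull ℝ (s : Set (Sp d))) :=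
  (𝒯.continuousOn_hat_cell hs z).integrableOn_compact (isCompact_cell s)

/-- The homothety with ratio `1/2` towards the vertex `z` gives
`∫_S φ_z ≥ 2^{-d-1} |S|`. -/
theorem le_integral_hat_cell {s : Finset (Sp d)} (hs : s ∈ 𝒯.cells) {z : Sp d} (hz : z ∈ s) :
    (1 / 2) ^ (d + 1) * volume.real (convexHull ℝ (s : Set (Sp d))) ≤
      ∫ x in convexHull ℝ (s : Set (Sp d)), 𝒯.hat z x := by
  set S := convexHull ℝ (s : Set (Sp d)) with hS
  set H := AffineMap.homothety z (1 / 2 : ℝ) '' S with hH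
  have hzS : z ∈ S := subset_convexHull ℝ _ hz
  have hHS : H ⊆ S := by
    rintro _ ⟨x, hx, rfl⟩
    have := (convex_convexHull ℝ (s : Set (Sp d))).lineMap_mem hzS hx
      (t := (1 / 2 : ℝ)) ⟨by norm_num, by norm_num⟩
    rwa [AffineMap.homothety_eq_lineMap]
  have hval : ∀ x ∈ H, (1 / 2 : ℝ) ≤ 𝒯.hat z x := by
    rintro _ ⟨x, hx, rfl⟩
    rw [𝒯.hat_eq_hatAffine hs z (hHS ⟨x, hx, rfl⟩), AffineMap.homothety_eq_lineMap,
      AffineMap.apply_lineMap, ← 𝒯.hat_eq_hatAffine hs z hx, ← 𝒯.hat_eq_hatAffine hs z hzS,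
      𝒯.hat_node z (𝒯.subset_nodes hs hz), if_pos rfl, AffineMap.lineMap_apply_ring']
    linarith [𝒯.hat_nonneg z x]
  have hHc : IsCompact H := (isCompact_cell s).image
    (AffineMap.continuous_of_finiteDimensional _)
  have hvol : volume.real H = (1 / 2) ^ d * volume.real S := by
    rw [Measure.real, hH, Measure.addHaar_image_homothety]
    simp [Measure.real, ENNReal.toReal_mul]
  calc (1 / 2) ^ (d + 1) * volume.real S = (1 / 2) * volume.real H := by rw [hvol]; ring
    _ = ∫ x in H, (1 / 2 : ℝ) := by simp [mul_comm]
    _ ≤ ∫ x in H, 𝒯.hat z x := by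
        refine setIntegral_mono_on (by simp [hHc.measure_lt_top]) ((𝒯.integrableOn_hat_cell hs z).mono_set hHS)
          hHc.isClosed.measurableSet hval
    _ ≤ ∫ x in S, 𝒯.hat z x := setIntegral_mono_set (𝒯.integrableOn_hat_cell hs z)
        (Eventually.of_forall fun x => 𝒯.hat_nonneg z x) hHS.eventuallyLE

/-- The lumped mass `⟨1, φ_z⟩_h` of the node `z`. -/
def mass (z : Sp d) : ℝ := ∑ s ∈ 𝒯.cells, ∫ x in convexHull ℝ (s : Set (Sp d)), 𝒯.hat z x

theorem mass_pos {z : Sp d} (hz : z ∈ 𝒯.nodes) : 0 < 𝒯.mass z := by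
  obtain ⟨s, hs, hzs⟩ := mem_nodes.mp hz
  refine Finset.sum_pos' (fun s _ => integral_nonneg fun x => 𝒯.hat_nonneg z x) ⟨s, hs, ?_⟩
  refine lt_of_lt_of_le ?_ (𝒯.le_integral_hat_cell hs hzs)
  have : 0 < volume.real (convexHull ℝ (s : Set (Sp d))) :=
    ENNReal.toReal_pos (𝒯.volume_cell_pos hs).ne' (volume_cell_ne_top s)
  positivity

/-- This is the point of mass lumping: the quadrature sees nodal values only, so the form is
diagonal and nonlinear terms act node by node. -/
theorem lumped_eq (v w : Sp d → ℝ) :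
    𝒯.lumped v w = ∑ z ∈ 𝒯.nodes, v z * w z * 𝒯.mass z := by
  simp only [lumped, interp, mass, Finset.mul_sum]
  rw [Finset.sum_comm]
  refine Finset.sum_congr rfl fun s hs => ?_
  rw [integral_finsetSum _ fun z _ => (𝒯.integrableOn_hat_cell hs z).const_mul _]
  exact Finset.sum_congr rfl fun z _ => integral_const_mul _ _

theorem lumped_hat (v : Sp d → ℝ) {z : Sp d} (hz : z ∈ 𝒯.nodes) :
    𝒯.lumped v (𝒯.hat z) = v z * 𝒯.mass z := by
  classical
  rw [lumped_eq, Finset.sum_eq_single_of_mem z hz]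
  · rw [𝒯.hat_node z hz, if_pos rfl, mul_one]
  · intro y hy hyz
    rw [𝒯.hat_node z hy, if_neg hyz.symm]; simp

end Triangulation

/-! ### Stars of interior nodes, the finite element space and the stiffness form -/

namespace Triangulation

variable {Ω : Set (Sp d)} (𝒯 : Triangulation Ω)

/-- The open star of an interior node lies in `Ω`. -/
theorem mem_of_hat_ne_zero (hΩ : IsOpen Ω) (hΩr : interior (closure Ω) = Ω) {z : Sp d}
    (hz : z ∈ Ω) {x : Sp d} (hx : 𝒯.hat z x ≠ 0) : x ∈ Ω := by
  classical
  have hxc : x ∈ closure Ω := by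
    by_contra h
    exact hx (𝒯.hat_of_notMem h z)
  have hpos : 0 < 𝒯.hat z x := (𝒯.hat_nonneg z x).lt_of_ne hx.symm
  obtain ⟨s, hs, hxs⟩ := 𝒯.exists_cell hxc
  have hzs : z ∈ s := by
    by_contra h
    exact hx (𝒯.hat_eq_zero hs hxs h)
  have hzn : z ∈ 𝒯.nodes := 𝒯.subset_nodes hs hzs
  -- The union of the elements that do not have `z` as a vertex. It is closed and misses `z`, so
  -- near `z` only elements with the vertex `z` occur.
  set K : Set (Sp d) := ⋃ s ∈ 𝒯.cells.filter (z ∉ ·), convexHull ℝ (s : Set (Sp d)) with hK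
  have hKc : IsClosed K := isClosed_biUnion_finset fun s _ => (isCompact_cell s).isClosed
  have hzK : z ∉ K := by
    simp only [hK, mem_iUnion, not_exists]
    intro s' hs' hmem
    rw [Finset.mem_filter] at hs'
    have := 𝒯.hat_eq_zero hs'.1 hmem hs'.2
    rw [𝒯.hat_node z hzn, if_pos rfl] at this
    exact one_ne_zero this
  have hO : IsOpen (Ω ∩ Kᶜ) := hΩ.inter hKc.isOpen_compl
  have hlim : Tendsto (fun δ : ℝ => AffineMap.homothety z δ x) (𝓝[>] 0) (𝓝 z) := by
    have h : Continuous (fun δ : ℝ => AffineMap.homothety z δ x) := by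
      simp only [AffineMap.homothety_eq_lineMap, AffineMap.lineMap_apply_module]
      fun_prop
    have h0 := (h.tendsto 0).mono_left (nhdsWithin_le_nhds (s := Ioi 0))
    simpa using h0
  obtain ⟨δ, hδO, hδ0, hδ1⟩ : ∃ δ : ℝ, AffineMap.homothety z δ x ∈ Ω ∩ Kᶜ ∧ 0 < δ ∧ δ < 1 := by
    have h1 := hlim.eventually (hO.mem_nhds ⟨hz, hzK⟩)
    have h2 : ∀ᶠ δ : ℝ in 𝓝[>] 0, δ ∈ Ioo (0 : ℝ) 1 := Ioo_mem_nhdsGT one_pos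
    obtain ⟨δ, h, h'⟩ := (h1.and h2).exists
    exact ⟨δ, h, h'.1, h'.2⟩
  -- The contraction of `x` towards `z` lies in `Ω` and away from `K`, and `φ_z(xδ) = 1 - δ(1 -
  -- φ_z(x)) > 1 - δ`. These open conditions persist near `xδ`; undoing the contraction carries a
  -- neighbourhood of `xδ` to a neighbourhood of `x` inside `closure Ω`, and `interior (closure Ω) =
  -- Ω` finishes the proof.
  set xδ := AffineMap.homothety z δ x with hxδ
  have hval : 1 - δ < 𝒯.hat z xδ := by
    have hmem : xδ ∈ convexHull ℝ (s : Set (Sp d)) := by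
      rw [hxδ, AffineMap.homothety_eq_lineMap]
      exact (convex_convexHull ℝ _).lineMap_mem (subset_convexHull ℝ _ hzs) hxs ⟨hδ0.le, hδ1.le⟩
    rw [𝒯.hat_eq_hatAffine hs z hmem, hxδ, AffineMap.homothety_eq_lineMap,
      AffineMap.apply_lineMap, ← 𝒯.hat_eq_hatAffine hs z hxs,
      ← 𝒯.hat_eq_hatAffine hs z (subset_convexHull ℝ _ hzs),
      𝒯.hat_node z hzn, if_pos rfl, AffineMap.lineMap_apply_ring']
    nlinarith
  have hnear : ∀ᶠ p in 𝓝 xδ, p ∈ Ω ∩ Kᶜ ∧ 1 - δ < 𝒯.hat z p := by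
    refine Filter.Eventually.and (hO.mem_nhds hδO) ?_
    have : ContinuousAt (𝒯.hat z) xδ := (𝒯.continuousOn_hat z).continuousAt
      (mem_of_superset (hΩ.mem_nhds hδO.1) subset_closure)
    exact this.eventually (lt_mem_nhds hval)
  have hcont : Continuous (AffineMap.homothety z δ : Sp d →ᵃ[ℝ] Sp d) :=
    AffineMap.continuous_of_finiteDimensional _
  have hpre := (hcont.tendsto x).eventually hnear
  rw [← hΩr, mem_interior_iff_mem_nhds]
  filter_upwards [hpre] with q hq
  obtain ⟨⟨hqO, hqK⟩, hqv⟩ := hq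
  set p := AffineMap.homothety z δ q with hp
  obtain ⟨s', hs', hps'⟩ := 𝒯.exists_cell (subset_closure hqO)
  have hzs' : z ∈ s' := by
    by_contra h
    refine hqK ?_
    simp only [hK, mem_iUnion]
    exact ⟨s', Finset.mem_filter.mpr ⟨hs', h⟩, hps'⟩
  -- Since `q = z + (p - z)/δ`, its coordinates in the element of `p` are those of `p` divided by
  -- `δ`, corrected at `z`. The one at `z` equals `(φ_z(p) - (1 - δ))/δ`, which is nonnegative by
  -- the choice of the neighbourhood.
  refine 𝒯.convexHull_subset_closure hs' (Finset.mem_convexHull'.mpr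
    ⟨fun y => 𝒯.hat y p / δ + if y = z then 1 - 1 / δ else 0, ?_, ?_, ?_⟩)
  · intro y _
    change 0 ≤ 𝒯.hat y p / δ + if y = z then 1 - 1 / δ else 0
    by_cases hyz : y = z
    · rw [if_pos hyz, hyz]
      have : 𝒯.hat z p / δ + (1 - 1 / δ) = (𝒯.hat z p - (1 - δ)) / δ := by field_simp; ring
      rw [this]
      exact div_nonneg (by linarith) hδ0.le
    · rw [if_neg hyz, add_zero]
      exact div_nonneg (𝒯.hat_nonneg _ _) hδ0.le
  · rw [Finset.sum_add_distrib, ← Finset.sum_div, 𝒯.sum_cell_hat hs' hps']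
    simp [hzs']
  · have h1 : ∑ y ∈ s', (𝒯.hat y p / δ) • y = (1 / δ) • p := by
      rw [← 𝒯.sum_cell_hat_smul hs' hps', Finset.smul_sum, 𝒯.sum_cell_hat_smul hs' hps']
      exact Finset.sum_congr rfl fun y _ => by rw [smul_smul]; congr 1; ring
    simp only [add_smul, Finset.sum_add_distrib, h1, ite_smul, zero_smul,
      Finset.sum_ite_eq', hzs', if_true]
    rw [hp, AffineMap.homothety_eq_lineMap, AffineMap.lineMap_apply_module, smul_add, smul_smul,
      smul_smul, add_right_comm, ← add_smul]
    have e1 : 1 / δ * (1 - δ) + (1 - 1 / δ) = 0 := by field_simp; ring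
    have e2 : 1 / δ * δ = 1 := by field_simp
    rw [e1, e2]; simp

/-- The open star of `z` lies in `Ω`, so the hat function vanishes on the frontier and its extension
by zero is continuous. -/
theorem hat_mem_feSpace (hΩ : IsOpen Ω) (hΩr : interior (closure Ω) = Ω) {z : Sp d}
    (hz : z ∈ Ω) : 𝒯.hat z ∈ 𝒯.feSpace := by
  have h0 : ∀ x ∉ Ω, 𝒯.hat z x = 0 := fun x hx => by
    by_contra h
    exact hx (𝒯.mem_of_hat_ne_zero hΩ hΩr hz h)
  refine ⟨?_, h0, fun s hs => 𝒯.exists_affine_hat hs z⟩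
  have h : indicator Ω (𝒯.hat z) = 𝒯.hat z := indicator_eq_self.mpr fun x hx => by
    by_contra h
    exact hx (h0 x h)
  rw [← h]
  refine continuous_indicator (fun x hx => h0 x ?_) (𝒯.continuousOn_hat z)
  rw [hΩ.frontier_eq] at hx
  exact hx.2

open Classical in
/-- The mesh nodes in `Ω`. -/
def inner : Finset (Sp d) := 𝒯.nodes.filter (· ∈ Ω)

variable {𝒯} in
theorem mem_inner {z : Sp d} : z ∈ 𝒯.inner ↔ z ∈ 𝒯.nodes ∧ z ∈ Ω := by
  classical
  simp [inner]

theorem interp_mem_feSpace (hΩ : IsOpen Ω) (hΩr : interior (closure Ω) = Ω) {v : Sp d → ℝ}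
    (hv : ∀ z ∈ 𝒯.nodes, z ∉ Ω → v z = 0) : 𝒯.interp v ∈ 𝒯.feSpace := by
  classical
  have : 𝒯.interp v = ∑ z ∈ 𝒯.inner, v z • 𝒯.hat z := by
    funext x
    rw [Finset.sum_apply, interp]
    refine (Finset.sum_subset (Finset.filter_subset _ _) fun z hz hz' => ?_).symm
    rw [hv z hz fun h => hz' (mem_inner.mpr ⟨hz, h⟩), zero_mul]
  rw [this]
  exact Submodule.sum_mem _ fun z hz =>
    Submodule.smul_mem _ _ (𝒯.hat_mem_feSpace hΩ hΩr (mem_inner.mp hz).2)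

theorem hat_eq_interp (z : Sp d) (hz : z ∈ 𝒯.nodes) : 𝒯.hat z = 𝒯.interp (𝒯.hat z) := by
  classical
  funext x
  rw [interp, Finset.sum_eq_single_of_mem z hz]
  · rw [𝒯.hat_node z hz, if_pos rfl, one_mul]
  · intro y hy hyz
    rw [𝒯.hat_node z hy, if_neg hyz.symm, zero_mul]

/-- The gradient on the mesh element `s` of the piecewise affine function with the nodal values
`U`. -/
def cellGrad (s : Finset (Sp d)) (U : Sp d → ℝ) : Sp d :=
  ∑ z ∈ 𝒯.nodes, U z • (InnerProductSpace.toDual ℝ (Sp d)).symm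
    (LinearMap.toContinuousLinearMap (𝒯.hatAffine s z).linear)

theorem hasGradientAt_interp {s : Finset (Sp d)} (hs : s ∈ 𝒯.cells) (U : Sp d → ℝ) {x : Sp d}
    (hx : x ∈ interior (convexHull ℝ (s : Set (Sp d)))) :
    HasGradientAt (𝒯.interp U) (𝒯.cellGrad s U) x := by
  have h1 : ∀ z, HasFDerivAt (𝒯.hat z)
      (LinearMap.toContinuousLinearMap (𝒯.hatAffine s z).linear) x := by
    intro z
    have h : HasFDerivAt (fun y => (𝒯.hatAffine s z).linear y + 𝒯.hatAffine s z 0)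
        (LinearMap.toContinuousLinearMap (𝒯.hatAffine s z).linear) x :=
      (LinearMap.toContinuousLinearMap (𝒯.hatAffine s z).linear).hasFDerivAt.add_const _
    refine h.congr_of_eventuallyEq ?_
    filter_upwards [mem_interior_iff_mem_nhds.mp hx] with y hy
    rw [𝒯.hat_eq_hatAffine hs z hy]
    exact congrFun (𝒯.hatAffine s z).decomp y
  have h2 : HasFDerivAt (𝒯.interp U)
      (∑ z ∈ 𝒯.nodes, U z • LinearMap.toContinuousLinearMap (𝒯.hatAffine s z).linear) x :=
    HasFDerivAt.fun_sum fun z _ => (h1 z).const_mul (U z)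
  rw [hasGradientAt_iff_hasFDerivAt]
  convert! h2 using 1
  simp [cellGrad, map_sum]

theorem interior_cell_subset (hΩr : interior (closure Ω) = Ω) {s : Finset (Sp d)}
    (hs : s ∈ 𝒯.cells) : interior (convexHull ℝ (s : Set (Sp d))) ⊆ Ω :=
  (interior_mono (𝒯.convexHull_subset_closure hs)).trans hΩr.le

theorem volume_frontier_cell (s : Finset (Sp d)) :
    volume (frontier (convexHull ℝ (s : Set (Sp d)))) = 0 :=
  (convex_convexHull ℝ _).addHaar_frontier volume

/-- Two elements meet in the hull of their common vertices. If they differ, there are at most `d` of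
these, too few for a hull with interior points. -/
theorem disjoint_interior_cells {s s' : Finset (Sp d)} (hs : s ∈ 𝒯.cells) (hs' : s' ∈ 𝒯.cells)
    (hne : s ≠ s') : Disjoint (interior (convexHull ℝ (s : Set (Sp d))))
      (interior (convexHull ℝ (s' : Set (Sp d)))) := by
  classical
  rw [Set.disjoint_iff_inter_eq_empty, ← interior_inter]
  by_contra hcon
  obtain ⟨x, hx⟩ := nonempty_iff_ne_empty.mpr hcon
  have hsub := 𝒯.inter_subset_convexHull (mem_cells.mp hs).1 (mem_cells.mp hs').1
  have hn : (interior (convexHull ℝ ((s : Set (Sp d)) ∩ s'))).Nonempty :=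
    ⟨x, interior_mono hsub hx⟩
  rw [interior_convexHull_nonempty_iff_affineSpan_eq_top] at hn
  have hlt : (s ∩ s').card < d + 1 := by
    rw [← (mem_cells.mp hs).2]
    refine Finset.card_lt_card (Finset.inter_subset_left.ssubset_of_ne fun h => ?_)
    have hss : s ⊆ s' := Finset.inter_eq_left.mp h
    exact hne (Finset.eq_of_subset_of_card_le hss
      (by rw [(mem_cells.mp hs).2, (mem_cells.mp hs').2]))
  have hind : AffineIndependent ℝ ((↑) : (s ∩ s' : Finset (Sp d)) → Sp d) :=
    (𝒯.affineIndependent_cell hs).mono (t := (s : Set (Sp d)))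
      (s := ((s ∩ s' : Finset (Sp d)) : Set (Sp d))) (by simp)
  have := hind.affineSpan_eq_top_iff_card_eq_finrank_add_one.mp
    (by
      rw [← hn]
      congr 1
      ext
      simp)
  simp at this
  omega

theorem ae_eq_iUnion_interior (hΩr : interior (closure Ω) = Ω) :
    Ω =ᵐ[volume] ⋃ s ∈ 𝒯.cells, interior (convexHull ℝ (s : Set (Sp d))) := by
  have hsub : (⋃ s ∈ 𝒯.cells, interior (convexHull ℝ (s : Set (Sp d)))) ⊆ Ω :=
    iUnion₂_subset fun s hs => 𝒯.interior_cell_subset hΩr hs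
  have hnull : volume (⋃ s ∈ 𝒯.cells, frontier (convexHull ℝ (s : Set (Sp d)))) = 0 :=
    (measure_biUnion_null_iff 𝒯.cells.countable_toSet).mpr fun s _ => volume_frontier_cell s
  have : ∀ᵐ x ∂volume, x ∉ ⋃ s ∈ 𝒯.cells, frontier (convexHull ℝ (s : Set (Sp d))) :=
    compl_mem_ae_iff.mpr hnull
  refine Filter.eventuallyEq_set.mpr ?_
  filter_upwards [this] with x hx
  refine ⟨fun hxΩ => ?_, fun h => hsub h⟩
  obtain ⟨s, hs, hxs⟩ := 𝒯.exists_cell (subset_closure hxΩ)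
  simp only [mem_iUnion, not_exists] at hx
  refine mem_biUnion hs ?_
  by_contra h
  exact hx s hs ⟨subset_closure hxs, h⟩

/-- The gradient is constant inside each element, and what remains of `Ω` lies in the frontiers of
finitely many convex sets, a null set. -/
theorem stiffness_eq (hΩr : interior (closure Ω) = Ω) (U W : Sp d → ℝ) :
    stiffness Ω (𝒯.interp U) (𝒯.interp W) = ∑ s ∈ 𝒯.cells,
      volume.real (convexHull ℝ (s : Set (Sp d))) *
        Inner.inner ℝ (𝒯.cellGrad s U) (𝒯.cellGrad s W) := by
  have hval : ∀ s ∈ 𝒯.cells, ∀ x ∈ interior (convexHull ℝ (s : Set (Sp d))),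
      Inner.inner ℝ (∇ (𝒯.interp U) x) (∇ (𝒯.interp W) x) =
        Inner.inner ℝ (𝒯.cellGrad s U) (𝒯.cellGrad s W) := fun s hs x hx => by
    rw [(𝒯.hasGradientAt_interp hs U hx).gradient, (𝒯.hasGradientAt_interp hs W hx).gradient]
  rw [stiffness, setIntegral_congr_set (𝒯.ae_eq_iUnion_interior hΩr), integral_biUnion_finset]
  · refine Finset.sum_congr rfl fun s hs => ?_
    rw [setIntegral_congr_fun isOpen_interior.measurableSet (hval s hs), setIntegral_const,
      smul_eq_mul]
    congr 1
    exact congrArg ENNReal.toReal (measure_congr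
      (interior_ae_eq_of_null_frontier (volume_frontier_cell s)))
  · exact fun s _ => isOpen_interior.measurableSet
  · intro s hs s' hs' hne
    exact 𝒯.disjoint_interior_cells hs hs' hne
  · intro s hs
    refine IntegrableOn.congr_fun (f := fun _ => Inner.inner ℝ (𝒯.cellGrad s U) (𝒯.cellGrad s W))
      ?_ (fun x hx => (hval s hs x hx).symm) isOpen_interior.measurableSet
    refine integrableOn_const ?_
    exact ((measure_mono interior_subset).trans_lt (volume_cell_ne_top s).lt_top).ne

theorem cellGrad_add (s : Finset (Sp d)) (U W : Sp d → ℝ) :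
    𝒯.cellGrad s (U + W) = 𝒯.cellGrad s U + 𝒯.cellGrad s W := by
  simp [cellGrad, add_smul, Finset.sum_add_distrib]

theorem cellGrad_smul (s : Finset (Sp d)) (a : ℝ) (U : Sp d → ℝ) :
    𝒯.cellGrad s (a • U) = a • 𝒯.cellGrad s U := by
  simp [cellGrad, mul_smul, Finset.smul_sum]

/-- The hat functions sum to one on the element. The vanishing row sums of `ℒ_h` come from here. -/
theorem cellGrad_const {s : Finset (Sp d)} (hs : s ∈ 𝒯.cells) (a : ℝ) :
    𝒯.cellGrad s (fun _ => a) = 0 := by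
  obtain ⟨x, hx⟩ := 𝒯.interior_cell_nonempty hs
  have h1 := 𝒯.hasGradientAt_interp hs (fun _ => a) hx
  have h2 : HasGradientAt (𝒯.interp fun _ => a) 0 x := by
    refine (hasGradientAt_const x a).congr_of_eventuallyEq ?_
    filter_upwards [mem_interior_iff_mem_nhds.mp hx] with y hy
    exact 𝒯.interp_const (𝒯.convexHull_subset_closure hs hy) a
  exact h1.unique h2

theorem cellGrad_congr (s : Finset (Sp d)) {U W : Sp d → ℝ} (h : ∀ z ∈ 𝒯.nodes, U z = W z) :
    𝒯.cellGrad s U = 𝒯.cellGrad s W :=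
  Finset.sum_congr rfl fun z hz => by rw [h z hz]

/-- The stiffness form in terms of nodal values. -/
def stiff (U W : Sp d → ℝ) : ℝ := ∑ s ∈ 𝒯.cells,
  volume.real (convexHull ℝ (s : Set (Sp d))) * Inner.inner ℝ (𝒯.cellGrad s U) (𝒯.cellGrad s W)

theorem stiff_add_left (U V W : Sp d → ℝ) : 𝒯.stiff (U + V) W = 𝒯.stiff U W + 𝒯.stiff V W := by
  simp [stiff, cellGrad_add, inner_add_left, mul_add, Finset.sum_add_distrib]

theorem stiff_smul_left (a : ℝ) (U W : Sp d → ℝ) : 𝒯.stiff (a • U) W = a * 𝒯.stiff U W := by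
  simp only [stiff, cellGrad_smul, inner_smul_left, Finset.mul_sum]
  exact Finset.sum_congr rfl fun s _ => by simp; ring

theorem stiff_comm (U W : Sp d → ℝ) : 𝒯.stiff U W = 𝒯.stiff W U :=
  Finset.sum_congr rfl fun s _ => by rw [real_inner_comm]

theorem stiff_const_left (a : ℝ) (W : Sp d → ℝ) : 𝒯.stiff (fun _ => a) W = 0 :=
  Finset.sum_eq_zero fun s hs => by rw [𝒯.cellGrad_const hs]; simp

theorem stiff_congr {U U' W W' : Sp d → ℝ} (h : ∀ z ∈ 𝒯.nodes, U z = U' z)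
    (h' : ∀ z ∈ 𝒯.nodes, W z = W' z) : 𝒯.stiff U W = 𝒯.stiff U' W' :=
  Finset.sum_congr rfl fun s _ => by rw [𝒯.cellGrad_congr s h, 𝒯.cellGrad_congr s h']

theorem stiff_sum_left {ι : Type*} (I : Finset ι) (U : ι → Sp d → ℝ) (W : Sp d → ℝ) :
    𝒯.stiff (∑ i ∈ I, U i) W = ∑ i ∈ I, 𝒯.stiff (U i) W := by
  classical
  induction I using Finset.induction_on with
  | empty => exact 𝒯.stiff_const_left 0 W
  | insert i I hi ih => rw [Finset.sum_insert hi, Finset.sum_insert hi, stiff_add_left, ih]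

theorem stiff_expand (U W : Sp d → ℝ) :
    𝒯.stiff U W = ∑ y ∈ 𝒯.nodes, U y * 𝒯.stiff (𝒯.hat y) W := by
  classical
  have : 𝒯.stiff U W = 𝒯.stiff (∑ y ∈ 𝒯.nodes, U y • 𝒯.hat y) W := by
    refine 𝒯.stiff_congr (fun z hz => ?_) fun _ _ => rfl
    rw [Finset.sum_apply]
    exact (𝒯.interp_node U hz).symm
  rw [this, stiff_sum_left]
  exact Finset.sum_congr rfl fun y _ => 𝒯.stiff_smul_left _ _ _

theorem stiffness_eq_stiff (hΩr : interior (closure Ω) = Ω) {U W : Sp d → ℝ}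
    (hU : 𝒯.interp U = U) (hW : 𝒯.interp W = W) : stiffness Ω U W = 𝒯.stiff U W := by
  rw [stiff, ← 𝒯.stiffness_eq hΩr, hU, hW]

end Triangulation

/-! ### The discrete Laplacian: maximum principle and solvability -/

namespace Triangulation

variable {Ω : Set (Sp d)} (𝒯 : Triangulation Ω)

/-- The discrete operator `ℒ_h v(z) = ⟨∇ v, ∇ φ_z⟩ / ⟨1, φ_z⟩_h`. -/
def opL (v : Sp d → ℝ) (z : Sp d) : ℝ := 𝒯.stiff v (𝒯.hat z) / 𝒯.mass z

theorem opL_add (v w : Sp d → ℝ) (z : Sp d) : 𝒯.opL (v + w) z = 𝒯.opL v z + 𝒯.opL w z := by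
  rw [opL, stiff_add_left, add_div, opL, opL]

theorem opL_smul (a : ℝ) (v : Sp d → ℝ) (z : Sp d) : 𝒯.opL (a • v) z = a * 𝒯.opL v z := by
  rw [opL, stiff_smul_left, mul_div_assoc, opL]

theorem opL_sub (v w : Sp d → ℝ) (z : Sp d) : 𝒯.opL (v - w) z = 𝒯.opL v z - 𝒯.opL w z := by
  have : v - w = v + (-1 : ℝ) • w := by simp [sub_eq_add_neg]
  rw [this, opL_add, opL_smul]; ring

theorem opL_neg (v : Sp d → ℝ) (z : Sp d) : 𝒯.opL (-v) z = -𝒯.opL v z := by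
  rw [← zero_sub, opL_sub, opL, show (0 : Sp d → ℝ) = fun _ => 0 from rfl, stiff_const_left]
  simp

theorem opL_congr {v w : Sp d → ℝ} (h : ∀ z ∈ 𝒯.nodes, v z = w z) (z : Sp d) :
    𝒯.opL v z = 𝒯.opL w z := by
  rw [opL, 𝒯.stiff_congr h fun _ _ => rfl, opL]

theorem opL_expand (v : Sp d → ℝ) (z : Sp d) :
    𝒯.opL v z = ∑ y ∈ 𝒯.nodes, v y * 𝒯.opL (𝒯.hat y) z := by
  rw [opL, stiff_expand, Finset.sum_div]
  exact Finset.sum_congr rfl fun y _ => by rw [opL, mul_div_assoc]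

/-- Constants have zero gradient. The boundary nodes have to be included in the sum. -/
theorem sum_opL_hat (z : Sp d) : ∑ y ∈ 𝒯.nodes, 𝒯.opL (𝒯.hat y) z = 0 := by
  have := 𝒯.opL_expand (fun _ => 1) z
  rw [opL, stiff_const_left, zero_div] at this
  simpa using this.symm

/-- The off-diagonal entries of the stiffness matrix are nonpositive. -/
def OffDiagNonpos : Prop := ∀ z ∈ 𝒯.inner, ∀ y ∈ 𝒯.nodes, y ≠ z → 𝒯.opL (𝒯.hat y) z ≤ 0

theorem lumpedMatrix_inner (hΩr : interior (closure Ω) = Ω) {z : Sp d} (hz : z ∈ 𝒯.inner)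
    {y : Sp d} (hy : y ∈ 𝒯.nodes) :
    lumpedMatrix 𝒯 ⟨z, (mem_inner.mp hz).1⟩ ⟨y, hy⟩ = 𝒯.opL (𝒯.hat y) z := by
  have hzn := (mem_inner.mp hz).1
  rw [lumpedMatrix, if_pos (mem_inner.mp hz).2, 𝒯.lumped_hat _ hzn,
    𝒯.stiffness_eq_stiff hΩr (𝒯.hat_eq_interp y hy).symm (𝒯.hat_eq_interp z hzn).symm, one_mul,
    opL]

theorem offDiagNonpos (hΩr : interior (closure Ω) = Ω) (hM : HasMMatrix 𝒯) :
    𝒯.OffDiagNonpos := by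
  intro z hz y hy hyz
  rw [← 𝒯.lumpedMatrix_inner hΩr hz hy]
  exact hM.1 _ _ fun h => hyz (congrArg Subtype.val h).symm

variable {𝒯} in
/-- The discrete maximum principle at a node with the maximal nodal value. -/
theorem OffDiagNonpos.opL_nonneg (h : 𝒯.OffDiagNonpos) {v : Sp d → ℝ} {z : Sp d}
    (hz : z ∈ 𝒯.inner) (hmax : ∀ y ∈ 𝒯.nodes, v y ≤ v z) : 0 ≤ 𝒯.opL v z := by
  have h0 : 𝒯.opL v z = ∑ y ∈ 𝒯.nodes, (v y - v z) * 𝒯.opL (𝒯.hat y) z := by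
    simp_rw [sub_mul]
    rw [Finset.sum_sub_distrib, ← Finset.mul_sum, sum_opL_hat, mul_zero, sub_zero, opL_expand]
  rw [h0]
  refine Finset.sum_nonneg fun y hy => ?_
  by_cases hyz : y = z
  · rw [hyz, sub_self, zero_mul]
  · exact mul_nonneg_of_nonpos_of_nonpos (sub_nonpos.mpr (hmax y hy)) (h z hz y hy hyz)

variable {𝒯} in
/-- To bound a nodal function, it suffices to bound it at the interior nodes at which `ℒ_h` of it
is nonnegative, and on the boundary. -/
theorem OffDiagNonpos.le_of_inner (h : 𝒯.OffDiagNonpos) {v : Sp d → ℝ} {S : ℝ}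
    (hb : ∀ z ∈ 𝒯.nodes, z ∉ Ω → v z ≤ S)
    (hi : ∀ z ∈ 𝒯.inner, 0 ≤ 𝒯.opL v z → v z ≤ S) : ∀ z ∈ 𝒯.nodes, v z ≤ S := by
  intro y hy
  obtain ⟨z, hz, hmax⟩ := Finset.exists_max_image 𝒯.nodes v ⟨y, hy⟩
  refine (hmax y hy).trans ?_
  by_cases hzΩ : z ∈ Ω
  · have hzi := mem_inner.mpr ⟨hz, hzΩ⟩
    exact hi z hzi (h.opL_nonneg hzi hmax)
  · exact hb z hz hzΩ

theorem le_of_nodes {v : Sp d → ℝ} (hv : v ∈ 𝒯.feSpace) {a : ℝ}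
    (h : ∀ z ∈ 𝒯.nodes, v z ≤ a) {x : Sp d} (hx : x ∈ closure Ω) : v x ≤ a := by
  rw [← 𝒯.interp_eq_self hv, ← 𝒯.interp_const hx a]
  exact Finset.sum_le_sum fun z hz => mul_le_mul_of_nonneg_right (h z hz) (𝒯.hat_nonneg z x)

/-- The hat function of an interior node isolates one nodal value of `g` on the lumped side. No
other test functions are needed, because members of `S_h` vanish at the boundary nodes. -/
theorem weak_iff (hΩ : IsOpen Ω) (hΩr : interior (closure Ω) = Ω) {U : Sp d → ℝ}
    (hU : U ∈ 𝒯.feSpace) (g : Sp d → ℝ) :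
    (∀ v ∈ 𝒯.feSpace, stiffness Ω U v = 𝒯.lumped g v) ↔ ∀ z ∈ 𝒯.inner, 𝒯.opL U z = g z := by
  have hst : ∀ v ∈ 𝒯.feSpace, stiffness Ω U v = 𝒯.stiff U v := fun v hv =>
    𝒯.stiffness_eq_stiff hΩr (𝒯.interp_eq_self hU) (𝒯.interp_eq_self hv)
  constructor
  · intro h z hz
    have hzn := (mem_inner.mp hz).1
    have hh := 𝒯.hat_mem_feSpace hΩ hΩr (mem_inner.mp hz).2
    have := h _ hh
    rw [hst _ hh, 𝒯.lumped_hat g hzn] at this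
    rw [opL, this, mul_div_cancel_right₀ _ (𝒯.mass_pos hzn).ne']
  · intro h v hv
    have hzero : ∀ z ∈ 𝒯.nodes, z ∉ 𝒯.inner → v z = 0 := fun z hz hz' =>
      hv.2.1 z fun hc => hz' (mem_inner.mpr ⟨hz, hc⟩)
    have hsub : 𝒯.inner ⊆ 𝒯.nodes := fun z hz => (mem_inner.mp hz).1
    rw [hst v hv, stiff_comm, stiff_expand, lumped_eq]
    refine Finset.sum_congr rfl fun z hz => ?_
    by_cases hzi : z ∈ 𝒯.inner
    · rw [stiff_comm, ← h z hzi, opL]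
      field_simp [(𝒯.mass_pos hz).ne']
    · rw [hzero z hz hzi]; ring

/-- The discrete Poisson problem is solvable. -/
theorem exists_opL_eq (hΩ : IsOpen Ω) (hΩr : interior (closure Ω) = Ω) (hM : HasMMatrix 𝒯)
    (g : Sp d → ℝ) : ∃ R ∈ 𝒯.feSpace, ∀ z ∈ 𝒯.inner, 𝒯.opL R z = g z := by
  classical
  have hdet : IsUnit (lumpedMatrix 𝒯).det := by convert hM.2.1
  set b : 𝒯.nodes → ℝ := fun z => if (z : Sp d) ∈ Ω then g z else 0
  set X : 𝒯.nodes → ℝ := (lumpedMatrix 𝒯)⁻¹.mulVec b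
  have hX : (lumpedMatrix 𝒯).mulVec X = b := by
    rw [Matrix.mulVec_mulVec, Matrix.mul_nonsing_inv _ hdet, Matrix.one_mulVec]
  set Y : Sp d → ℝ := fun z => if h : z ∈ 𝒯.nodes then X ⟨z, h⟩ else 0
  have hY : ∀ z : 𝒯.nodes, Y z = X z := fun z => by simp [Y]
  refine ⟨𝒯.interp Y, 𝒯.interp_mem_feSpace hΩ hΩr fun z hz hzΩ => ?_, fun z hz => ?_⟩
  -- The rows of the boundary nodes are rows of the identity, so the solution vanishes there.
  · have h1 := congrFun hX ⟨z, hz⟩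
    have h2 : ∀ y, lumpedMatrix 𝒯 ⟨z, hz⟩ y = if (⟨z, hz⟩ : 𝒯.nodes) = y then 1 else 0 :=
      fun y => by rw [lumpedMatrix, if_neg hzΩ]
    simp only [Matrix.mulVec, dotProduct, h2, b, if_neg hzΩ] at h1
    rw [hY ⟨z, hz⟩]
    simpa using h1
  · have hzn := (mem_inner.mp hz).1
    have h1 := congrFun hX ⟨z, hzn⟩
    simp only [b, if_pos (mem_inner.mp hz).2, Matrix.mulVec, dotProduct] at h1
    rw [𝒯.opL_congr (fun y hy => 𝒯.interp_node Y hy), opL_expand, ← h1,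
      ← Finset.sum_coe_sort 𝒯.nodes fun y => Y y * 𝒯.opL (𝒯.hat y) z]
    refine Finset.sum_congr rfl fun y _ => ?_
    rw [hY, 𝒯.lumpedMatrix_inner hΩr hz y.2, mul_comm]

theorem ritz_spec (hΩ : IsOpen Ω) (hΩr : interior (closure Ω) = Ω) (hM : HasMMatrix 𝒯)
    (w : Sp d → ℝ) : ritz 𝒯 w ∈ 𝒯.feSpace ∧ ∀ z ∈ 𝒯.inner, 𝒯.opL (ritz 𝒯 w) z = w z := by
  obtain ⟨R, hR, hRw⟩ := 𝒯.exists_opL_eq hΩ hΩr hM w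
  have hex : ∃ R, IsRitz 𝒯 w R := ⟨R, hR, (𝒯.weak_iff hΩ hΩr hR w).mpr hRw⟩
  have hsp : IsRitz 𝒯 w (ritz 𝒯 w) := by rw [ritz, dif_pos hex]; exact hex.choose_spec
  exact ⟨hsp.1, (𝒯.weak_iff hΩ hΩr hsp.1 w).mp hsp.2⟩

/-- A continuous, strongly monotone function on `ℝ` is onto. -/
theorem exists_eq_of_strongMono {ν : ℝ} (hν : 0 < ν) {g : ℝ → ℝ} (hg : Continuous g)
    (hm : ∀ s₁ s₂, s₂ ≤ s₁ → ν * (s₁ - s₂) ≤ g s₁ - g s₂) (q : ℝ) : ∃ s, g s = q := by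
  refine hg.surjective ?_ ?_ q
  · refine tendsto_atTop_mono' atTop (f₁ := fun s => ν * s + g 0) ?_ ?_
    · filter_upwards [eventually_ge_atTop 0] with s hs
      have := hm s 0 hs
      linarith
    · exact tendsto_atTop_add_const_right _ _ (tendsto_id.const_mul_atTop hν)
  · refine tendsto_atBot_mono' atBot (f₁ := fun s => ν * s + g 0) ?_ ?_
    · filter_upwards [eventually_le_atBot 0] with s hs
      have := hm 0 s hs
      linarith
    · exact tendsto_atBot_add_const_right _ _ (tendsto_id.const_mul_atBot hν)

variable {𝒯} in
theorem OffDiagNonpos.opL_hat_self_nonneg (h : 𝒯.OffDiagNonpos) {z : Sp d} (hz : z ∈ 𝒯.inner) :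
    0 ≤ 𝒯.opL (𝒯.hat z) z := by
  classical
  refine h.opL_nonneg hz fun y hy => ?_
  rw [𝒯.hat_node z hy, 𝒯.hat_node z (mem_inner.mp hz).1, if_pos rfl]
  split_ifs
  exacts [le_rfl, zero_le_one]

-- Weak diagonal dominance: a full row sums to zero, its off-diagonal entries have one sign, and
-- leaving out the boundary nodes only decreases the sum of their absolute values.
variable {𝒯} in
theorem OffDiagNonpos.sum_abs_le (h : 𝒯.OffDiagNonpos) {z : Sp d} (hz : z ∈ 𝒯.inner) :
    ∑ y ∈ 𝒯.inner.erase z, |𝒯.opL (𝒯.hat y) z| ≤ 𝒯.opL (𝒯.hat z) z := by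
  have h0 := 𝒯.sum_opL_hat z
  have hzn := (mem_inner.mp hz).1
  rw [← Finset.add_sum_erase _ _ hzn] at h0
  have hneg : ∀ y ∈ 𝒯.nodes.erase z, 𝒯.opL (𝒯.hat y) z = -|𝒯.opL (𝒯.hat y) z| := fun y hy => by
    rw [abs_of_nonpos (h z hz y (Finset.mem_of_mem_erase hy) (Finset.ne_of_mem_erase hy)), neg_neg]
  rw [Finset.sum_congr rfl hneg, Finset.sum_neg_distrib] at h0
  have : ∑ y ∈ 𝒯.inner.erase z, |𝒯.opL (𝒯.hat y) z| ≤
      ∑ y ∈ 𝒯.nodes.erase z, |𝒯.opL (𝒯.hat y) z| :=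
    Finset.sum_le_sum_of_subset_of_nonneg
      (Finset.erase_subset_erase _ fun y hy => (mem_inner.mp hy).1) fun _ _ _ => abs_nonneg _
  linarith

/-- The nonlinear discrete problem `ℒ_h U + g(·, U) = 0` with a strongly monotone `g` is solvable,
by Banach's fixed point theorem in the maximum norm. -/
theorem exists_nonlinear (hΩ : IsOpen Ω) (hΩr : interior (closure Ω) = Ω)
    (h : 𝒯.OffDiagNonpos) {ν : ℝ} (hν : 0 < ν) (g : Sp d → ℝ → ℝ)
    (hg : ∀ z ∈ 𝒯.inner, Continuous (g z))
    (hm : ∀ z ∈ 𝒯.inner, ∀ s₁ s₂, s₂ ≤ s₁ → ν * (s₁ - s₂) ≤ g z s₁ - g z s₂) :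
    ∃ U ∈ 𝒯.feSpace, ∀ z ∈ 𝒯.inner, 𝒯.opL U z + g z (U z) = 0 := by
  classical
  set a : Sp d → ℝ := fun z => 𝒯.opL (𝒯.hat z) z with ha
  have ha0 : ∀ z ∈ 𝒯.inner, 0 ≤ a z := fun z hz => h.opL_hat_self_nonneg hz
  have hmono : ∀ z ∈ 𝒯.inner, ∀ s₁ s₂, s₂ ≤ s₁ →
      (a z + ν) * (s₁ - s₂) ≤ (a z * s₁ + g z s₁) - (a z * s₂ + g z s₂) := by
    intro z hz s₁ s₂ hs
    have := hm z hz s₁ s₂ hs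
    nlinarith
  -- The scalar equation at one node, all other nodal values being frozen in `q`. Its solution `σ z
  -- q` is Lipschitz in `q` with the constant `1/(a z + ν)`.
  have hex : ∀ z : 𝒯.inner, ∀ q : ℝ, ∃ s, a z * s + g z s = q := fun z q =>
    exists_eq_of_strongMono (add_pos_of_nonneg_of_pos (ha0 z z.2) hν)
      (g := fun s => a z * s + g z s) (by have := hg z z.2; fun_prop) (hmono z z.2) q
  choose σ hσ using hex
  have hlip : ∀ z : 𝒯.inner, ∀ p q, (a z + ν) * |σ z p - σ z q| ≤ |p - q| := by
    intro z p q
    wlog hle : σ z q ≤ σ z p generalizing p q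
    · have := this q p (le_of_not_ge hle)
      rwa [abs_sub_comm, abs_sub_comm q p] at this
    have := hmono z z.2 _ _ hle
    rw [hσ, hσ] at this
    rw [abs_of_nonneg (sub_nonneg.mpr hle)]
    exact this.trans (le_abs_self _)
  set Y : (𝒯.inner → ℝ) → Sp d → ℝ := fun X z => if hz : z ∈ 𝒯.inner then X ⟨z, hz⟩ else 0 with hY
  -- One sweep of the nonlinear Jacobi iteration. By diagonal dominance its Lipschitz constant at
  -- `z` is at most `a z/(a z + ν)`; the sum `A` of all diagonal entries yields the common bound
  -- `A/(A + ν) < 1`.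
  set Φ : (𝒯.inner → ℝ) → 𝒯.inner → ℝ := fun X z =>
    σ z (-∑ y ∈ 𝒯.inner.erase z, Y X y * 𝒯.opL (𝒯.hat y) z) with hΦ
  set A : ℝ := ∑ z ∈ 𝒯.inner, a z with hA
  have hA0 : 0 ≤ A := Finset.sum_nonneg ha0
  have haA : ∀ z ∈ 𝒯.inner, a z ≤ A := fun z hz => Finset.single_le_sum ha0 hz
  have hK : A / (A + ν) < 1 := by rw [div_lt_one (by linarith)]; linarith
  have hKn : 0 ≤ A / (A + ν) := by positivity
  have hcontr : ContractingWith (A / (A + ν)).toNNReal Φ := by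
    refine ⟨by rwa [Real.toNNReal_lt_one], LipschitzWith.of_dist_le_mul fun X X' => ?_⟩
    rw [Real.coe_toNNReal _ hKn, dist_pi_le_iff (mul_nonneg hKn dist_nonneg)]
    intro z
    have h1 := hlip z (-∑ y ∈ 𝒯.inner.erase z, Y X y * 𝒯.opL (𝒯.hat y) z)
      (-∑ y ∈ 𝒯.inner.erase z, Y X' y * 𝒯.opL (𝒯.hat y) z)
    have h2 : |(-∑ y ∈ 𝒯.inner.erase z, Y X y * 𝒯.opL (𝒯.hat y) z) -
        (-∑ y ∈ 𝒯.inner.erase z, Y X' y * 𝒯.opL (𝒯.hat y) z)| ≤ a z * dist X X' := by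
      rw [neg_sub_neg, ← Finset.sum_sub_distrib]
      refine (Finset.abs_sum_le_sum_abs _ _).trans ?_
      calc ∑ y ∈ 𝒯.inner.erase z, |Y X' y * 𝒯.opL (𝒯.hat y) z - Y X y * 𝒯.opL (𝒯.hat y) z|
          ≤ ∑ y ∈ 𝒯.inner.erase z, |𝒯.opL (𝒯.hat y) z| * dist X X' := by
            refine Finset.sum_le_sum fun y hy => ?_
            have hyi := Finset.mem_of_mem_erase hy
            rw [← sub_mul, abs_mul, mul_comm]
            refine mul_le_mul_of_nonneg_left ?_ (abs_nonneg _)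
            simp only [hY, dif_pos hyi]
            rw [abs_sub_comm]
            exact dist_le_pi_dist X X' ⟨y, hyi⟩
        _ ≤ a z * dist X X' := by
            rw [← Finset.sum_mul]
            exact mul_le_mul_of_nonneg_right (h.sum_abs_le z.2) dist_nonneg
    have haz := ha0 z z.2
    have hp : 0 < a z + ν := by linarith
    change |Φ X z - Φ X' z| ≤ A / (A + ν) * dist X X'
    have h3 : |Φ X z - Φ X' z| ≤ a z / (a z + ν) * dist X X' := by
      rw [div_mul_eq_mul_div, le_div_iff₀ hp, mul_comm]
      exact h1.trans h2
    refine h3.trans (mul_le_mul_of_nonneg_right ?_ dist_nonneg)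
    rw [div_le_div_iff₀ hp (by linarith)]
    nlinarith [haA z z.2]
  obtain ⟨X, hX, -⟩ := hcontr.exists_fixedPoint 0 (edist_ne_top _ _)
  have hYb : ∀ z ∈ 𝒯.nodes, z ∉ Ω → Y X z = 0 := fun z hz hzΩ => by
    simp only [hY]
    rw [dif_neg fun hc => hzΩ (mem_inner.mp hc).2]
  refine ⟨𝒯.interp (Y X), 𝒯.interp_mem_feSpace hΩ hΩr hYb, fun z hz => ?_⟩
  have hzn := (mem_inner.mp hz).1
  have h1 := hσ ⟨z, hz⟩ (-∑ y ∈ 𝒯.inner.erase z, Y X y * 𝒯.opL (𝒯.hat y) z)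
  have h2 : σ ⟨z, hz⟩ (-∑ y ∈ 𝒯.inner.erase z, Y X y * 𝒯.opL (𝒯.hat y) z) = Y X z := by
    have : Φ X ⟨z, hz⟩ = X ⟨z, hz⟩ := congrFun hX ⟨z, hz⟩
    simp only [hY, dif_pos hz]
    exact this
  rw [h2] at h1
  rw [𝒯.interp_node _ hzn, 𝒯.opL_congr fun y hy => 𝒯.interp_node (Y X) hy, opL_expand]
  have h3 : ∑ y ∈ 𝒯.nodes, Y X y * 𝒯.opL (𝒯.hat y) z =
      ∑ y ∈ 𝒯.inner, Y X y * 𝒯.opL (𝒯.hat y) z := by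
    refine (Finset.sum_subset (Finset.filter_subset _ _) fun y hy hy' => ?_).symm
    rw [hYb y hy fun hc => hy' (mem_inner.mpr ⟨hy, hc⟩), zero_mul]
  rw [h3, ← Finset.add_sum_erase _ _ hz]
  simp only [ha] at h1
  linarith

end Triangulation

/-! ### The L1 operator -/

section L1

variable {α T : ℝ} {M : ℕ} {t : ℕ → ℝ}

namespace IsTimeMesh

theorem lt (h : IsTimeMesh T M t) {i j : ℕ} (hij : i < j) (hj : j ≤ M) : t i < t j := by
  induction j, hij using Nat.le_induction with
  | base => exact h.lt_succ i (by omega)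
  | succ j hij ih => exact (ih (by omega)).trans (h.lt_succ j (by omega))

theorem le (h : IsTimeMesh T M t) {i j : ℕ} (hij : i ≤ j) (hj : j ≤ M) : t i ≤ t j := by
  rcases hij.eq_or_lt with rfl | hlt
  · rfl
  · exact (h.lt hlt hj).le

theorem nonneg (h : IsTimeMesh T M t) {j : ℕ} (hj : j ≤ M) : 0 ≤ t j := by
  simpa [h.zero] using h.le (Nat.zero_le j) hj

theorem pos' (h : IsTimeMesh T M t) {j : ℕ} (h1 : 1 ≤ j) (hj : j ≤ M) : 0 < t j := by
  simpa [h.zero] using h.lt (i := 0) (by omega) hj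

theorem step_pos (h : IsTimeMesh T M t) {j : ℕ} (h1 : 1 ≤ j) (hj : j ≤ M) :
    0 < t j - t (j - 1) := sub_pos.mpr (h.lt (by omega) hj)

theorem le_final (h : IsTimeMesh T M t) {j : ℕ} (hj : j ≤ M) : t j ≤ T := by
  simpa [h.final] using h.le hj le_rfl

end IsTimeMesh

theorem intervalIntegrable_sub_rpow {p : ℝ} (hp : -1 < p) (a b c : ℝ) :
    IntervalIntegrable (fun s => (c - s) ^ p) volume a b := by
  have := (intervalIntegral.intervalIntegrable_rpow' (a := c - a) (b := c - b) hp).comp_sub_left c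
  simpa using this

theorem integral_sub_rpow {p : ℝ} (hp : -1 < p) (a b c : ℝ) :
    ∫ s in a..b, (c - s) ^ p = ((c - a) ^ (p + 1) - (c - b) ^ (p + 1)) / (p + 1) := by
  rw [intervalIntegral.integral_comp_sub_left (fun x => x ^ p) c, integral_rpow (Or.inl hp)]

/-- The weights of the increments `U^j - U^{j-1}` in the L1 operator. -/
def l1w (α : ℝ) (t : ℕ → ℝ) (m j : ℕ) : ℝ :=
  (t j - t (j - 1))⁻¹ * ∫ s in (t (j - 1))..(t j), (t m - s) ^ (-α)

theorem deltaL1_eq (α : ℝ) (t U : ℕ → ℝ) (m : ℕ) : deltaL1 α t U m =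
    (Real.Gamma (1 - α))⁻¹ * ∑ j ∈ Finset.Icc 1 m, l1w α t m j * (U j - U (j - 1)) := by
  rw [deltaL1]
  congr 1
  exact Finset.sum_congr rfl fun j _ => by rw [l1w]; ring

/-- The weight is the mean of `s ↦ (t_m - s)^{-α}` over a mesh interval, and this kernel increases
in `s`. The endpoint bounds here and in `l1w_le` together make the weights increase in `j`. -/
theorem l1w_ge (hα₀ : 0 < α) (hα₁ : α < 1) (h : IsTimeMesh T M t) {m j : ℕ} (hj : 1 ≤ j)
    (hjm : j ≤ m) (hm : m ≤ M) : (t m - t (j - 1)) ^ (-α) ≤ l1w α t m j := by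
  have hτ := h.step_pos hj (hjm.trans hm)
  rw [l1w, inv_mul_eq_div, le_div_iff₀ hτ]
  calc (t m - t (j - 1)) ^ (-α) * (t j - t (j - 1))
      = ∫ s in (t (j - 1))..(t j), (t m - t (j - 1)) ^ (-α) := by simp [mul_comm]
    _ ≤ _ := by
      -- Only the open interval is compared: for `j = m` the kernel at `s = t_m` has the default
      -- value `0`.
      refine intervalIntegral.integral_mono_on_of_le_Ioo (by linarith) (by simp)
        (intervalIntegrable_sub_rpow (by linarith) _ _ _) fun s hs => ?_
      have := h.le hjm hm
      exact Real.rpow_le_rpow_of_nonpos (by linarith [hs.2]) (by linarith [hs.1]) (by linarith)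

theorem l1w_le (hα₀ : 0 < α) (hα₁ : α < 1) (h : IsTimeMesh T M t) {m j : ℕ} (hj : 1 ≤ j)
    (hjm : j < m) (hm : m ≤ M) : l1w α t m j ≤ (t m - t j) ^ (-α) := by
  have hτ := h.step_pos hj (hjm.le.trans hm)
  have hlt := h.lt hjm hm
  rw [l1w, inv_mul_eq_div, div_le_iff₀ hτ]
  calc _ ≤ ∫ s in (t (j - 1))..(t j), (t m - t j) ^ (-α) := by
        refine intervalIntegral.integral_mono_on (by linarith)
          (intervalIntegrable_sub_rpow (by linarith) _ _ _) (by simp) fun s hs => ?_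
        exact Real.rpow_le_rpow_of_nonpos (by linarith) (by linarith [hs.2]) (by linarith)
    _ = _ := by simp [mul_comm]

theorem l1w_mono (hα₀ : 0 < α) (hα₁ : α < 1) (h : IsTimeMesh T M t) {m j : ℕ} (hj : 1 ≤ j)
    (hjm : j < m) (hm : m ≤ M) : l1w α t m j ≤ l1w α t m (j + 1) :=
  (l1w_le hα₀ hα₁ h hj hjm hm).trans (l1w_ge hα₀ hα₁ h (by omega) hjm hm)

theorem l1w_pos (hα₀ : 0 < α) (hα₁ : α < 1) (h : IsTimeMesh T M t) {m j : ℕ} (hj : 1 ≤ j)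
    (hjm : j ≤ m) (hm : m ≤ M) : 0 < l1w α t m j :=
  (Real.rpow_pos_of_pos (sub_pos.mpr (h.lt (by omega) hm)) _).trans_le
    (l1w_ge hα₀ hα₁ h hj hjm hm)

theorem gammaInv_pos (hα₁ : α < 1) : 0 < (Real.Gamma (1 - α))⁻¹ :=
  inv_pos.mpr (Real.Gamma_pos_of_pos (by linarith))

/-- The coefficient of `U^m` in `δ_t^α U^m`. -/
def l1diag (α : ℝ) (t : ℕ → ℝ) (m : ℕ) : ℝ := (Real.Gamma (1 - α))⁻¹ * l1w α t m m

theorem l1diag_eq (hα₁ : α < 1) (h : IsTimeMesh T M t) {m : ℕ} (h1 : 1 ≤ m)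
    (hm : m ≤ M) : l1diag α t m = (Real.Gamma (2 - α))⁻¹ * (t m - t (m - 1)) ^ (-α) := by
  have hτ := h.step_pos h1 hm
  have hG : Real.Gamma (2 - α) = (1 - α) * Real.Gamma (1 - α) := by
    rw [← Real.Gamma_add_one (by linarith)]; ring_nf
  rw [l1diag, l1w, integral_sub_rpow (by linarith), sub_self, Real.zero_rpow (by linarith), hG,
    Real.rpow_add_one hτ.ne']
  have : -α + 1 ≠ 0 := by linarith
  have h' : 1 - α ≠ 0 := by linarith
  have := (Real.Gamma_pos_of_pos (by linarith : 0 < 1 - α)).ne'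
  field_simp
  ring

theorem l1diag_pos (hα₁ : α < 1) (h : IsTimeMesh T M t) {m : ℕ} (h1 : 1 ≤ m)
    (hm : m ≤ M) : 0 < l1diag α t m := by
  rw [l1diag_eq hα₁ h h1 hm]
  exact mul_pos (inv_pos.mpr (Real.Gamma_pos_of_pos (by linarith)))
    (Real.rpow_pos_of_pos (h.step_pos h1 hm) _)

/-- The step condition in the form in which it is used: `δ_t^α - λ` keeps a positive diagonal
coefficient. -/
theorem StepCondition.lt_l1diag {lam : ℝ} (hs : StepCondition α lam M t) (hα₁ : α < 1)
    (h : IsTimeMesh T M t) {m : ℕ} (h1 : 1 ≤ m) (hm : m ≤ M) : lam < l1diag α t m := by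
  have hτ := h.step_pos h1 hm
  have := hs m (Finset.mem_Icc.mpr ⟨h1, hm⟩)
  rwa [l1diag_eq hα₁ h h1 hm, Real.rpow_neg hτ.le, ← div_eq_mul_inv,
    lt_div_iff₀ (Real.rpow_pos_of_pos hτ _)]

theorem l1diag_ge (hα₀ : 0 < α) (hα₁ : α < 1) (h : IsTimeMesh T M t) {m : ℕ}
    (h1 : 1 ≤ m) (hm : m ≤ M) : (Real.Gamma (2 - α))⁻¹ * T ^ (-α) ≤ l1diag α t m := by
  rw [l1diag_eq hα₁ h h1 hm]
  refine mul_le_mul_of_nonneg_left ?_ (inv_pos.mpr (Real.Gamma_pos_of_pos (by linarith))).le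
  have := h.nonneg (j := m - 1) (by omega)
  exact Real.rpow_le_rpow_of_nonpos (h.step_pos h1 hm) (by linarith [h.le_final hm]) (by linarith)

theorem deltaL1_add (U V : ℕ → ℝ) (m : ℕ) :
    deltaL1 α t (fun j => U j + V j) m = deltaL1 α t U m + deltaL1 α t V m := by
  simp only [deltaL1_eq]
  rw [← mul_add, ← Finset.sum_add_distrib]
  congr 1
  exact Finset.sum_congr rfl fun j _ => by ring

theorem deltaL1_smul (a : ℝ) (U : ℕ → ℝ) (m : ℕ) :
    deltaL1 α t (fun j => a * U j) m = a * deltaL1 α t U m := by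
  simp only [deltaL1_eq]
  rw [mul_left_comm]
  congr 1
  rw [Finset.mul_sum]
  exact Finset.sum_congr rfl fun j _ => by ring

theorem deltaL1_neg (U : ℕ → ℝ) (m : ℕ) :
    deltaL1 α t (fun j => -U j) m = -deltaL1 α t U m := by
  have := deltaL1_smul (α := α) (t := t) (-1) U m
  simpa using this

theorem deltaL1_sub (U V : ℕ → ℝ) (m : ℕ) :
    deltaL1 α t (fun j => U j - V j) m = deltaL1 α t U m - deltaL1 α t V m := by
  simp only [sub_eq_add_neg]
  rw [deltaL1_add, deltaL1_neg]

theorem deltaL1_const (a : ℝ) (m : ℕ) : deltaL1 α t (fun _ => a) m = 0 := by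
  simp [deltaL1_eq]

theorem deltaL1_sum {ι : Type*} (I : Finset ι) (U : ι → ℕ → ℝ) (m : ℕ) :
    deltaL1 α t (fun j => ∑ i ∈ I, U i j) m = ∑ i ∈ I, deltaL1 α t (U i) m := by
  classical
  induction I using Finset.induction_on with
  | empty => simpa using deltaL1_const (α := α) (t := t) 0 m
  | insert i I hi ih => simp only [Finset.sum_insert hi]; rw [deltaL1_add, ih]

theorem deltaL1_congr {U V : ℕ → ℝ} {m : ℕ} (h : ∀ j ≤ m, U j = V j) :
    deltaL1 α t U m = deltaL1 α t V m := by
  simp only [deltaL1_eq]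
  congr 1
  refine Finset.sum_congr rfl fun j hj => ?_
  have := (Finset.mem_Icc.mp hj).2
  rw [h j this, h (j - 1) (by omega)]

theorem deltaL1_single {m : ℕ} (h1 : 1 ≤ m) (a : ℝ) :
    deltaL1 α t (fun j => if j = m then a else 0) m = l1diag α t m * a := by
  rw [deltaL1_eq, Finset.sum_eq_single_of_mem m (Finset.mem_Icc.mpr ⟨h1, le_rfl⟩), if_pos rfl,
    if_neg (by omega), sub_zero, l1diag]
  · ring
  · intro j hj hjm
    have := (Finset.mem_Icc.mp hj).2
    rw [if_neg hjm, if_neg (by omega)]; ring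

theorem deltaL1_split {m : ℕ} (h1 : 1 ≤ m) (U : ℕ → ℝ) : deltaL1 α t U m =
    l1diag α t m * U m + deltaL1 α t (fun j => if j < m then U j else 0) m := by
  rw [← deltaL1_single h1, ← deltaL1_add]
  refine deltaL1_congr fun j hj => ?_
  rcases hj.eq_or_lt with rfl | hlt
  · simp
  · simp [hlt, hlt.ne]

/-- The L1 operator has nonpositive coefficients for the past values. -/
theorem deltaL1_le_of_nonneg (hα₀ : 0 < α) (hα₁ : α < 1) (h : IsTimeMesh T M t) {m : ℕ}
    (h1 : 1 ≤ m) (hm : m ≤ M) {D : ℕ → ℝ} (hD : ∀ j < m, 0 ≤ D j) :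
    deltaL1 α t D m ≤ l1diag α t m * D m := by
  -- Summation by parts in the form of an induction: since the weights increase and `D n ≥ 0`,
  -- replacing `l1w α t m n * D n` by `l1w α t m (n + 1) * D n` only enlarges the bound.
  have key : ∀ n, 1 ≤ n → n ≤ m →
      ∑ j ∈ Finset.Icc 1 n, l1w α t m j * (D j - D (j - 1)) ≤ l1w α t m n * D n := by
    intro n hn
    induction n, hn using Nat.le_induction with
    | base =>
      intro h1m
      simp only [Finset.Icc_self, Finset.sum_singleton]
      have := l1w_pos hα₀ hα₁ h le_rfl h1m hm
      have := hD 0 (by omega)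
      simp only [Nat.sub_self]
      nlinarith
    | succ n hn ih =>
      intro hnm
      rw [Finset.sum_Icc_succ_top (by omega)]
      have h2 := ih (by omega)
      have h3 := l1w_mono hα₀ hα₁ h hn (by omega : n < m) hm
      have h4 := hD n (by omega)
      simp only [Nat.add_sub_cancel]
      nlinarith
  rw [deltaL1_eq, l1diag, mul_assoc]
  exact mul_le_mul_of_nonneg_left (key m h1 le_rfl) (gammaInv_pos hα₁).le

/-- Constants are annihilated, so `deltaL1_le_of_nonneg` can be applied to `Y - D` and to `Y + D`.
-/
theorem abs_deltaL1_le_of_bound (hα₀ : 0 < α) (hα₁ : α < 1) (h : IsTimeMesh T M t) {m : ℕ}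
    (h1 : 1 ≤ m) (hm : m ≤ M) {D : ℕ → ℝ} {Y : ℝ} (hD : ∀ j ≤ m, |D j| ≤ Y) :
    |deltaL1 α t D m| ≤ 2 * l1diag α t m * Y := by
  have hd := (l1diag_pos hα₁ h h1 hm).le
  have key : ∀ D : ℕ → ℝ, (∀ j ≤ m, |D j| ≤ Y) → -deltaL1 α t D m ≤ 2 * l1diag α t m * Y := by
    intro D hD
    have h2 := deltaL1_le_of_nonneg hα₀ hα₁ h h1 hm (D := fun j => Y - D j)
      fun j hj => sub_nonneg.mpr ((le_abs_self _).trans (hD j hj.le))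
    rw [deltaL1_sub, deltaL1_const] at h2
    have h3 := neg_abs_le (D m)
    have h4 := hD m le_rfl
    nlinarith
  rw [abs_le]
  constructor
  · linarith [key D hD]
  · have := key (fun j => -D j) fun j hj => by rw [abs_neg]; exact hD j hj
    rw [deltaL1_neg] at this
    linarith

theorem abs_deltaL1_le_deltaL1 (hα₀ : 0 < α) (hα₁ : α < 1) (h : IsTimeMesh T M t) {m : ℕ}
    (hm : m ≤ M) {D P : ℕ → ℝ}
    (hD : ∀ j ∈ Finset.Icc 1 m, |D j - D (j - 1)| ≤ P j - P (j - 1)) :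
    |deltaL1 α t D m| ≤ deltaL1 α t P m := by
  simp only [deltaL1_eq]
  rw [abs_mul, abs_of_pos (gammaInv_pos hα₁)]
  refine mul_le_mul_of_nonneg_left ?_ (gammaInv_pos hα₁).le
  refine (Finset.abs_sum_le_sum_abs _ _).trans (Finset.sum_le_sum fun j hj => ?_)
  have hj' := Finset.mem_Icc.mp hj
  have := l1w_pos hα₀ hα₁ h hj'.1 hj'.2 hm
  rw [abs_mul, abs_of_pos this]
  exact mul_le_mul_of_nonneg_left (hD j hj) this.le

theorem sum_increments (V : ℕ → ℝ) (m : ℕ) :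
    ∑ j ∈ Finset.Icc 1 m, (V j - V (j - 1)) = V m - V 0 := by
  induction m with
  | zero => simp
  | succ m ih => rw [Finset.sum_Icc_succ_top (by omega), ih]; simp

/-- Every weight is at least `t_m^{-α}`, and the increments add up to `V m - V 0`. -/
theorem deltaL1_ge_of_monotone (hα₀ : 0 < α) (hα₁ : α < 1) (h : IsTimeMesh T M t) {m : ℕ}
    (hm : m ≤ M) {V : ℕ → ℝ} (hV : ∀ j ∈ Finset.Icc 1 m, V (j - 1) ≤ V j) :
    (Real.Gamma (1 - α))⁻¹ * ((t m) ^ (-α) * (V m - V 0)) ≤ deltaL1 α t V m := by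
  rw [deltaL1_eq, ← sum_increments V m, Finset.mul_sum]
  refine mul_le_mul_of_nonneg_left (Finset.sum_le_sum fun j hj => ?_) (gammaInv_pos hα₁).le
  have hj' := Finset.mem_Icc.mp hj
  refine mul_le_mul_of_nonneg_right ?_ (sub_nonneg.mpr (hV j hj))
  refine le_trans ?_ (l1w_ge hα₀ hα₁ h hj'.1 hj'.2 hm)
  have := h.nonneg (j := j - 1) (by omega)
  exact Real.rpow_le_rpow_of_nonpos (sub_pos.mpr (h.lt (by omega) hm)) (by linarith) (by linarith)

/-- On meshes with `μ τ_j ≤ 1`, the L1 operator applied to `e^{μ t} X(t)` with an increasing `X`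
is at least a multiple of `μ^α e^{μ t} X(t)`. -/
theorem deltaL1_exp_ge (hα₀ : 0 < α) (hα₁ : α < 1) (h : IsTimeMesh T M t) {m : ℕ}
    (hm : m ≤ M) {μ : ℝ} (hμ : 0 < μ)
    (hstep : ∀ j ∈ Finset.Icc 1 M, t j - t (j - 1) ≤ μ⁻¹) {X : ℕ → ℝ} (hX0 : X 0 = 0)
    (hX : ∀ j ∈ Finset.Icc 1 m, X (j - 1) ≤ X j) :
    (Real.Gamma (1 - α))⁻¹ * ((1 - Real.exp (-1)) * (μ / 2) ^ α * (Real.exp (μ * t m) * X m)) ≤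
      deltaL1 α t (fun j => Real.exp (μ * t j) * X j) m := by
  have hXle : ∀ n ≤ m, ∀ j ≤ n, X j ≤ X n := by
    intro n hn j hj
    induction n, hj using Nat.le_induction with
    | base => rfl
    | succ n hjn ih =>
      exact (ih (by omega)).trans (by simpa using hX (n + 1) (Finset.mem_Icc.mpr ⟨by omega, hn⟩))
  have hXnn : ∀ j ≤ m, 0 ≤ X j := fun j hj => by rw [← hX0]; exact hXle j hj 0 (Nat.zero_le j)
  set V : ℕ → ℝ := fun j => Real.exp (μ * t j) * X j with hV
  have hVnn : ∀ j ≤ m, 0 ≤ V j := fun j hj => mul_nonneg (Real.exp_pos _).le (hXnn j hj)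
  have hVmono : ∀ j ∈ Finset.Icc 1 m, V (j - 1) ≤ V j := fun j hj => by
    have hj' := Finset.mem_Icc.mp hj
    refine mul_le_mul (Real.exp_le_exp.mpr (mul_le_mul_of_nonneg_left
      (h.le (by omega) (hj'.2.trans hm)) hμ.le)) (hX j hj) (hXnn _ (by omega)) (Real.exp_pos _).le
  -- Only the increments of `V` above the level `q` are kept; they add up to `(1 - e^{-1}) V m`. If
  -- `V j > q`, then `t_m - t_j ≤ 1/μ`, so `t_m - t_{j-1} ≤ 2/μ` by the step restriction, and the
  -- weight is at least `(μ/2)^α`.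
  set q : ℝ := Real.exp (-1) * V m with hq
  have he1 : Real.exp (-1) < 1 := Real.exp_lt_one_iff.mpr (by norm_num)
  have hq0 : 0 ≤ q := mul_nonneg (Real.exp_pos _).le (hVnn m le_rfl)
  have hqV : q ≤ V m := by nlinarith [hVnn m le_rfl]
  have hV0 : V 0 = 0 := by simp [hV, hX0]
  have hsum := sum_increments (fun j => max (V j) q) m
  simp only [hV0, max_eq_right hq0, max_eq_left hqV] at hsum
  rw [deltaL1_eq]
  refine mul_le_mul_of_nonneg_left ?_ (gammaInv_pos hα₁).le
  have : (1 - Real.exp (-1)) * (μ / 2) ^ α * V m = (μ / 2) ^ α * (V m - q) := by rw [hq]; ring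
  rw [this, ← hsum, Finset.mul_sum]
  refine Finset.sum_le_sum fun j hj => ?_
  have hj' := Finset.mem_Icc.mp hj
  have hw := l1w_pos hα₀ hα₁ h hj'.1 hj'.2 hm
  rcases le_or_gt (V j) q with hle | hgt
  · rw [max_eq_right hle, max_eq_right ((hVmono j hj).trans hle), sub_self, mul_zero]
    exact mul_nonneg hw.le (sub_nonneg.mpr (hVmono j hj))
  · have hinc : max (V j) q - max (V (j - 1)) q ≤ V j - V (j - 1) := by
      rw [max_eq_left hgt.le]; linarith [le_max_left (V (j - 1)) q]
    have hmono' : 0 ≤ max (V j) q - max (V (j - 1)) q :=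
      sub_nonneg.mpr (max_le_max_right q (hVmono j hj))
    refine mul_le_mul ?_ hinc hmono' hw.le
    refine le_trans ?_ (l1w_ge hα₀ hα₁ h hj'.1 hj'.2 hm)
    have hclose : t m - t (j - 1) ≤ (μ / 2)⁻¹ := by
      by_contra hcon
      push Not at hcon
      have hs := hstep j (Finset.mem_Icc.mpr ⟨hj'.1, hj'.2.trans hm⟩)
      have h2 : (μ / 2)⁻¹ = 2 * μ⁻¹ := by field_simp
      have h3 : μ⁻¹ < t m - t j := by linarith
      have h4 : 1 < μ * (t m - t j) := by
        have := mul_lt_mul_of_pos_left h3 hμ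
        rwa [mul_inv_cancel₀ hμ.ne'] at this
      refine absurd hgt (not_lt.mpr ?_)
      rw [hq, hV]
      simp only
      rw [← mul_assoc, ← Real.exp_add]
      exact mul_le_mul (Real.exp_le_exp.mpr (by linarith)) (hXle m le_rfl j hj'.2)
        (hXnn j hj'.2) (Real.exp_pos _).le
    have hpos : 0 < t m - t (j - 1) := sub_pos.mpr (h.lt (by omega) hm)
    calc (μ / 2) ^ α = ((μ / 2)⁻¹) ^ (-α) := by
          rw [Real.inv_rpow (by positivity), Real.rpow_neg (by positivity), inv_inv]
      _ ≤ _ := Real.rpow_le_rpow_of_nonpos hpos hclose (by linarith)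

end L1

/-! ### The discrete problem -/

section Discrete

variable {α T lam : ℝ} {M : ℕ} {t : ℕ → ℝ} {Ω : Set (Sp d)} {𝒯 : Triangulation Ω}
  {f : Sp d → ℝ → ℝ → ℝ}

open Triangulation

/-- By `weak_iff`, with the time derivative and the reaction moved to the right-hand side. In this
form the nodes are coupled only through `ℒ_h`. -/
theorem isDiscreteSolution_iff (hΩ : IsOpen Ω) (hΩr : interior (closure Ω) = Ω)
    {u₀ : Sp d → ℝ} {U : ℕ → Sp d → ℝ} :
    IsDiscreteSolution 𝒯 α f u₀ M t U ↔ U 0 = u₀ ∧ ∀ m ∈ Finset.Icc 1 M, U m ∈ 𝒯.feSpace ∧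
      ∀ z ∈ 𝒯.inner, deltaL1 α t (fun j => U j z) m + 𝒯.opL (U m) z + f z (t m) (U m z) = 0 := by
  have key : ∀ m, U m ∈ 𝒯.feSpace → ((∀ v ∈ 𝒯.feSpace,
      𝒯.lumped (fun x => deltaL1 α t (fun j => U j x) m) v + stiffness Ω (U m) v +
        𝒯.lumped (fun x => f x (t m) (U m x)) v = 0) ↔
      ∀ z ∈ 𝒯.inner, deltaL1 α t (fun j => U j z) m + 𝒯.opL (U m) z + f z (t m) (U m z) = 0) := by
    intro m hm
    have h := 𝒯.weak_iff hΩ hΩr hm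
      (fun x => -(deltaL1 α t (fun j => U j x) m + f x (t m) (U m x)))
    have hl : ∀ v, 𝒯.lumped (fun x => -(deltaL1 α t (fun j => U j x) m + f x (t m) (U m x))) v =
        -(𝒯.lumped (fun x => deltaL1 α t (fun j => U j x) m) v +
          𝒯.lumped (fun x => f x (t m) (U m x)) v) := fun v => by
      simp only [lumped_eq]
      rw [← Finset.sum_add_distrib, ← Finset.sum_neg_distrib]
      exact Finset.sum_congr rfl fun z _ => by ring
    simp only [hl] at h
    constructor
    · intro h' z hz
      have := h.mp (fun v hv => by linarith [h' v hv]) z hz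
      linarith
    · intro h' v hv
      have := h.mpr (fun z hz => by linarith [h' z hz]) v hv
      linarith
  constructor
  · intro h
    exact ⟨h.initial, fun m hm => ⟨h.mem m hm, (key m (h.mem m hm)).mp (h.equation m hm)⟩⟩
  · intro h
    exact ⟨h.1, fun m hm => (h.2 m hm).1, fun m hm => (key m (h.2 m hm).1).mpr (h.2 m hm).2⟩

variable (hΩ : IsOpen Ω) (hΩr : interior (closure Ω) = Ω) (hoff : 𝒯.OffDiagNonpos)
  (hα₀ : 0 < α) (hα₁ : α < 1) (ht : IsTimeMesh T M t) (hs : StepCondition α lam M t)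

include hΩ hΩr hoff hα₁ ht hs

/-- Time stepping: at a new level the history is data, and the remaining nonlinearity `s ↦ l1diag *
s + f(s)` is strongly monotone with the constant `l1diag - λ > 0`. -/
theorem exists_discreteSolution (hf : AssumptionA1 Ω T lam f) (u₀ : Sp d → ℝ) :
    ∃ U, IsDiscreteSolution 𝒯 α f u₀ M t U := by
  classical
  simp only [isDiscreteSolution_iff hΩ hΩr]
  suffices H : ∀ n ≤ M, ∃ U : ℕ → Sp d → ℝ, U 0 = u₀ ∧ ∀ m ∈ Finset.Icc 1 n, U m ∈ 𝒯.feSpace ∧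
      ∀ z ∈ 𝒯.inner, deltaL1 α t (fun j => U j z) m + 𝒯.opL (U m) z + f z (t m) (U m z) = 0 from
    H M le_rfl
  intro n
  induction n with
  | zero => exact fun _ => ⟨fun _ => u₀, rfl, by simp⟩
  | succ n ih =>
    intro hn
    obtain ⟨U, hU0, hU⟩ := ih (by omega)
    have h1 : 1 ≤ n + 1 := by omega
    have hlam := hs.lt_l1diag hα₁ ht h1 hn
    have htm : t (n + 1) ∈ Ioc 0 T := ⟨ht.pos' h1 hn, ht.le_final hn⟩
    obtain ⟨W, hW, hWeq⟩ := 𝒯.exists_nonlinear hΩ hΩr hoff (sub_pos.mpr hlam)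
      (fun z s => l1diag α t (n + 1) * s +
        deltaL1 α t (fun j => if j < n + 1 then U j z else 0) (n + 1) + f z (t (n + 1)) s)
      (fun z hz => by
        have := hf.continuous z (mem_inner.mp hz).2 _ htm
        fun_prop)
      (fun z hz s₁ s₂ hle => by
        have := hf.one_sided z (mem_inner.mp hz).2 _ htm s₁ s₂ hle
        linarith)
    refine ⟨Function.update U (n + 1) W, by simpa [Function.update_apply] using hU0,
      fun m hm => ?_⟩
    have hm' := Finset.mem_Icc.mp hm
    rcases hm'.2.eq_or_lt with rfl | hlt
    · refine ⟨by simpa using hW, fun z hz => ?_⟩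
      have hsplit : deltaL1 α t (fun j => if j < n + 1 then
          Function.update U (n + 1) W j z else 0) (n + 1) =
          deltaL1 α t (fun j => if j < n + 1 then U j z else 0) (n + 1) :=
        deltaL1_congr fun j _ => by
          by_cases hj : j < n + 1
          · simp [hj, Function.update_of_ne hj.ne]
          · simp [hj]
      have := hWeq z hz
      rw [deltaL1_split h1, hsplit]
      simp only [Function.update_self]
      linarith
    · have h2 := hU m (Finset.mem_Icc.mpr ⟨hm'.1, by omega⟩)
      have hcongr : ∀ z, deltaL1 α t (fun j => Function.update U (n + 1) W j z) m =
          deltaL1 α t (fun j => U j z) m := fun z =>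
        deltaL1_congr fun j hj => by rw [Function.update_of_ne (by omega)]
      simpa only [hcongr, Function.update_of_ne hlt.ne] using h2

/-- With equal histories, at a node where `V - U` is positive and `ℒ_h(V - U) ≥ 0` the difference of
the equations gives `(l1diag - λ)(V - U) ≤ 0`, a contradiction. Exchanging `U` and `V` gives
equality. -/
theorem discreteSolution_unique (hf : AssumptionA1 Ω T lam f) {u₀ : Sp d → ℝ}
    {U V : ℕ → Sp d → ℝ} (hU : IsDiscreteSolution 𝒯 α f u₀ M t U)
    (hV : IsDiscreteSolution 𝒯 α f u₀ M t V) : ∀ m ≤ M, V m = U m := by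
  rw [isDiscreteSolution_iff hΩ hΩr] at hU hV
  have key : ∀ U V : ℕ → Sp d → ℝ, ∀ m ∈ Finset.Icc 1 M,
      (∀ m ∈ Finset.Icc 1 M, U m ∈ 𝒯.feSpace ∧
      ∀ z ∈ 𝒯.inner, deltaL1 α t (fun j => U j z) m + 𝒯.opL (U m) z + f z (t m) (U m z) = 0) →
      (∀ m ∈ Finset.Icc 1 M, V m ∈ 𝒯.feSpace ∧
      ∀ z ∈ 𝒯.inner, deltaL1 α t (fun j => V j z) m + 𝒯.opL (V m) z + f z (t m) (V m z) = 0) →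
      (∀ j < m, V j = U j) → ∀ z ∈ 𝒯.nodes, (V m - U m) z ≤ 0 := by
    intro U V m hm hU hV hlt
    have hm' := Finset.mem_Icc.mp hm
    have hlam := hs.lt_l1diag hα₁ ht hm'.1 hm'.2
    obtain ⟨hUm, hUe⟩ := hU m hm
    obtain ⟨hVm, hVe⟩ := hV m hm
    refine hoff.le_of_inner (fun z _ hz => ?_) fun z hz hL => ?_
    · simp [hUm.2.1 z hz, hVm.2.1 z hz]
    · by_contra hcon
      push Not at hcon
      rw [opL_sub] at hL
      have h1 := hUe z hz
      have h2 := hVe z hz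
      have h3 : deltaL1 α t (fun j => if j < m then U j z else 0) m =
          deltaL1 α t (fun j => if j < m then V j z else 0) m := deltaL1_congr fun j _ => by
        by_cases hj : j < m
        · simp [hj, hlt j hj]
        · simp [hj]
      rw [deltaL1_split hm'.1, h3] at h1
      rw [deltaL1_split hm'.1] at h2
      simp only [Pi.sub_apply] at hcon
      have h4 := hf.one_sided z (mem_inner.mp hz).2 (t m)
        ⟨ht.pos' hm'.1 hm'.2, ht.le_final hm'.2⟩ (V m z) (U m z) (by linarith)
      nlinarith
  intro m
  induction m using Nat.strong_induction_on with
  | _ m ih =>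
    intro hm
    rcases Nat.eq_zero_or_pos m with rfl | hpos
    · rw [hU.1, hV.1]
    · have hmI := Finset.mem_Icc.mpr ⟨hpos, hm⟩
      have h1 := key U V m hmI hU.2 hV.2 fun j hj => ih j hj (by omega)
      have h2 := key V U m hmI hV.2 hU.2 fun j hj => (ih j hj (by omega)).symm
      have hnode : ∀ z ∈ 𝒯.nodes, V m z = U m z := fun z hz => by
        have := h1 z hz
        have := h2 z hz
        simp only [Pi.sub_apply] at *
        linarith
      rw [← 𝒯.interp_eq_self (hV.2 m hmI).1, ← 𝒯.interp_eq_self (hU.2 m hmI).1]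
      funext x
      exact Finset.sum_congr rfl fun z hz => by rw [hnode z hz]

-- The history satisfies `σ - U ≥ 0`, so an excess `U^m(z) > σ` at a node with `ℒ_h U^m ≥ 0` makes
-- `δ_t^α U^m` at least `l1diag * (U^m - σ)`, whereas `f(U^m) ≥ f(σ) - λ(U^m - σ) ≥ -λ(U^m - σ)`.
-- The sum would be positive.
omit hΩ hΩr in
include hα₀ in
theorem le_of_upperSolution {σ : ℝ} (hσ : 0 ≤ σ)
    (hf : ∀ z ∈ Ω, ∀ τ ∈ Ioc 0 T, ∀ s₁ s₂ : ℝ, s₂ ≤ s₁ → -lam * (s₁ - s₂) ≤ f z τ s₁ - f z τ s₂)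
    (hup : ∀ z ∈ Ω, ∀ τ ∈ Ioc 0 T, 0 ≤ f z τ σ) {U : ℕ → Sp d → ℝ}
    (hU : ∀ m ∈ Finset.Icc 1 M, U m ∈ 𝒯.feSpace ∧ ∀ z ∈ 𝒯.inner,
      deltaL1 α t (fun j => U j z) m + 𝒯.opL (U m) z + f z (t m) (U m z) = 0)
    (h0 : ∀ x ∈ Ω, U 0 x ≤ σ) : ∀ m ≤ M, ∀ x ∈ Ω, U m x ≤ σ := by
  intro m
  induction m using Nat.strong_induction_on with
  | _ m ih =>
    intro hm
    rcases Nat.eq_zero_or_pos m with rfl | hpos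
    · exact h0
    · obtain ⟨hUm, hUe⟩ := hU m (Finset.mem_Icc.mpr ⟨hpos, hm⟩)
      have hlam := hs.lt_l1diag hα₁ ht hpos hm
      have hnode : ∀ z ∈ 𝒯.nodes, U m z ≤ σ := by
        refine hoff.le_of_inner (fun z _ hz => by rw [hUm.2.1 z hz]; exact hσ) fun z hz hL => ?_
        by_contra hcon
        push Not at hcon
        have hzΩ := (mem_inner.mp hz).2
        have htm : t m ∈ Ioc 0 T := ⟨ht.pos' hpos hm, ht.le_final hm⟩
        have h1 := deltaL1_le_of_nonneg hα₀ hα₁ ht hpos hm (D := fun j => σ - U j z)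
          fun j hj => sub_nonneg.mpr (ih j hj (by omega) z hzΩ)
        rw [deltaL1_sub, deltaL1_const] at h1
        have h2 := hUe z hz
        have h3 := hf z hzΩ _ htm _ _ hcon.le
        have h4 := hup z hzΩ _ htm
        nlinarith
      exact fun x hx => 𝒯.le_of_nodes hUm hnode (subset_closure hx)

-- The lower bound is the upper bound for `-U`, which solves the scheme with `f` replaced by `s ↦
-- -f(-s)`.
include hα₀ in
theorem discreteSolution_bounds (hf : AssumptionA1 Ω T lam f) {σ₁ σ₂ : ℝ}
    (h2 : AssumptionA2 Ω T σ₁ σ₂ f) {u₀ : Sp d → ℝ} (h0 : ∀ x ∈ Ω, σ₁ ≤ u₀ x ∧ u₀ x ≤ σ₂)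
    {U : ℕ → Sp d → ℝ} (hU : IsDiscreteSolution 𝒯 α f u₀ M t U) :
    ∀ m ≤ M, ∀ x ∈ Ω, σ₁ ≤ U m x ∧ U m x ≤ σ₂ := by
  rw [isDiscreteSolution_iff hΩ hΩr] at hU
  have hup := le_of_upperSolution hoff hα₀ hα₁ ht hs h2.nonneg hf.one_sided h2.upper hU.2
    fun x hx => by rw [hU.1]; exact (h0 x hx).2
  have hlow := le_of_upperSolution hoff hα₀ hα₁ ht hs (σ := -σ₁) (neg_nonneg.mpr h2.nonpos)
    (f := fun x τ s => -f x τ (-s)) (U := fun j x => -U j x)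
    (fun z hz τ hτ s₁ s₂ hle => by
      have := hf.one_sided z hz τ hτ (-s₂) (-s₁) (by linarith)
      linarith)
    (fun z hz τ hτ => by
      have := h2.lower z hz τ hτ
      simpa using this)
    (fun m hm => by
      obtain ⟨h3, h4⟩ := hU.2 m hm
      refine ⟨𝒯.feSpace.neg_mem h3, fun z hz => ?_⟩
      have h5 := h4 z hz
      have h6 : 𝒯.opL (fun x => -U m x) z = -𝒯.opL (U m) z := 𝒯.opL_neg (U m) z
      rw [deltaL1_neg, h6, neg_neg]
      linarith)
    (fun x hx => by simpa [hU.1] using (h0 x hx).1)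
  intro m hm x hx
  exact ⟨neg_le_neg_iff.mp (hlow m hm x hx), hup m hm x hx⟩

end Discrete

/-! ### Weakly singular integrals -/

section Kernel

variable {α T : ℝ} {M : ℕ} {t : ℕ → ℝ}

/-- Each half of the interval contains only one of the two singularities. -/
theorem intervalIntegrable_beta {p q : ℝ} (hp : -1 < p) (hq : -1 < q) {c : ℝ} (hc : 0 < c) :
    IntervalIntegrable (fun s => (c - s) ^ p * s ^ q) volume 0 c := by
  have hc2 : 0 < c / 2 := by linarith
  refine IntervalIntegrable.trans (b := c / 2) ?_ ?_
  · refine (intervalIntegral.intervalIntegrable_rpow' hq).continuousOn_mul ?_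
    refine ContinuousOn.rpow_const (by fun_prop) fun s hs => Or.inl ?_
    rw [uIcc_of_le hc2.le] at hs
    linarith [hs.2]
  · refine (intervalIntegrable_sub_rpow hp _ _ _).mul_continuousOn ?_
    refine ContinuousOn.rpow_const (by fun_prop) fun s hs => Or.inl ?_
    rw [uIcc_of_le (by linarith)] at hs
    linarith [hs.1]

theorem integral_beta_eq (p q : ℝ) {c : ℝ} (hc : 0 < c) :
    ∫ s in (0 : ℝ)..c, (c - s) ^ p * s ^ q =
      c ^ (p + q + 1) * ∫ x in (0 : ℝ)..1, (1 - x) ^ p * x ^ q := by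
  have h := intervalIntegral.mul_integral_comp_mul_left (a := 0) (b := 1)
    (f := fun s => (c - s) ^ p * s ^ q) (c := c)
  rw [mul_zero, mul_one] at h
  rw [← h]
  have : ∀ x ∈ uIcc (0 : ℝ) 1, (c - c * x) ^ p * (c * x) ^ q =
      c ^ (p + q) * ((1 - x) ^ p * x ^ q) := fun x hx => by
    rw [uIcc_of_le zero_le_one] at hx
    rw [show c - c * x = c * (1 - x) by ring, Real.mul_rpow hc.le (by linarith [hx.2]),
      Real.mul_rpow hc.le hx.1, Real.rpow_add hc]
    ring
  rw [intervalIntegral.integral_congr this, intervalIntegral.integral_const_mul,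
    Real.rpow_add_one hc.ne']
  ring

/-- Integration by parts against the kernel `(c - s)^{-α}`. -/
theorem integral_kernel_deriv (hα₁ : α < 1) {a b c Y : ℝ} (hab : a < b) (hbc : b ≤ c) {y y' : ℝ → ℝ}
    (hy : ContinuousOn y (Icc a b)) (hd : ∀ s ∈ Ioo a b, HasDerivAt y (y' s) s)
    (hlip : b = c → ∃ L, ∀ᶠ s in 𝓝[<] c, |Y - y s| ≤ L * (c - s)) (hα₀ : 0 < α)
    (hi1 : IntervalIntegrable (fun s => (c - s) ^ (-α) * y' s) volume a b)
    (hi2 : IntervalIntegrable (fun s => (c - s) ^ (-α - 1) * (Y - y s)) volume a b) :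
    ∫ s in a..b, (c - s) ^ (-α) * y' s = (c - a) ^ (-α) * (Y - y a) - (c - b) ^ (-α) * (Y - y b) +
      α * ∫ s in a..b, (c - s) ^ (-α - 1) * (Y - y s) := by
  -- The only critical point is `s = c`, reached when `b = c`. There the product has the default
  -- value `0`, and the Lipschitz bound makes it `O((c - s)^{1-α})` nearby.
  have hF : ContinuousOn (fun s => (c - s) ^ (-α) * (Y - y s)) (Icc a b) := by
    intro s hs
    by_cases hsc : s = c
    · have hb : b = c := le_antisymm hbc (hsc ▸ hs.2)
      obtain ⟨L, hL⟩ := hlip hb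
      have hzero : (c - s) ^ (-α) * (Y - y s) = 0 := by
        rw [hsc, sub_self, Real.zero_rpow (by linarith), zero_mul]
      rw [ContinuousWithinAt, hzero, hsc]
      have hlim : Tendsto (fun s => |L| * (c - s) ^ (1 - α)) (𝓝 c) (𝓝 0) := by
        have : Continuous (fun s : ℝ => |L| * (c - s) ^ (1 - α)) := by
          refine continuous_const.mul (Continuous.rpow_const (by fun_prop) fun s => Or.inr ?_)
          linarith
        have := this.tendsto c
        simpa [Real.zero_rpow (by linarith : 1 - α ≠ 0)] using this
      refine squeeze_zero_norm' ?_ (hlim.mono_left nhdsWithin_le_nhds)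
      have hsub : Icc a b ⊆ insert c (Iio c) := fun x hx => by
        rcases (hb ▸ hx.2 : x ≤ c).eq_or_lt with h | h
        · exact Or.inl h
        · exact Or.inr h
      refine Filter.Eventually.filter_mono (nhdsWithin_mono c hsub) ?_
      rw [nhdsWithin_insert, eventually_sup]
      refine ⟨?_, ?_⟩
      · simp [Real.zero_rpow (by linarith : -α ≠ 0), Real.zero_rpow (by linarith : 1 - α ≠ 0)]
      · filter_upwards [hL, self_mem_nhdsWithin] with x hx hxc
        have hpos : 0 < c - x := sub_pos.mpr hxc
        rw [norm_mul, Real.norm_of_nonneg (Real.rpow_nonneg hpos.le _), Real.norm_eq_abs,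
          show (1 - α) = -α + 1 by ring, Real.rpow_add_one hpos.ne']
        have : |Y - y x| ≤ |L| * (c - x) :=
          hx.trans (mul_le_mul_of_nonneg_right (le_abs_self L) hpos.le)
        nlinarith [Real.rpow_nonneg hpos.le (-α)]
    · have hne : c - s ≠ 0 := fun h => hsc (by linarith)
      have h1 : ContinuousAt (fun s : ℝ => (c - s) ^ (-α)) s :=
        ContinuousAt.rpow_const (by fun_prop) (Or.inl hne)
      exact h1.continuousWithinAt.mul (continuousWithinAt_const.sub (hy s hs))
  have hFd : ∀ s ∈ Ioo a b, HasDerivAt (fun s => (c - s) ^ (-α) * (Y - y s))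
      (α * ((c - s) ^ (-α - 1) * (Y - y s)) - (c - s) ^ (-α) * y' s) s := by
    intro s hs
    have hne : c - s ≠ 0 := by linarith [hs.2]
    have h1 : HasDerivAt (fun s : ℝ => (c - s) ^ (-α)) (-1 * (-α) * (c - s) ^ (-α - 1)) s :=
      ((hasDerivAt_id s).const_sub c).rpow_const (Or.inl hne)
    have h2 := h1.mul ((hd s hs).const_sub Y)
    convert! h2 using 1
    ring
  have hint : IntervalIntegrable
      (fun s => α * ((c - s) ^ (-α - 1) * (Y - y s)) - (c - s) ^ (-α) * y' s) volume a b :=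
    (hi2.const_mul α).sub hi1
  have h := intervalIntegral.integral_eq_sub_of_hasDerivAt_of_le hab.le hF hFd hint
  rw [intervalIntegral.integral_sub (hi2.const_mul α) hi1,
    intervalIntegral.integral_const_mul] at h
  linarith

/-- A lower bound for the L1 operator in terms of the Marchaud form of the fractional derivative of
the piecewise linear interpolant. -/
theorem deltaL1_ge_marchaud (hα₀ : 0 < α) (hα₁ : α < 1) (h : IsTimeMesh T M t) {m : ℕ}
    (h1 : 1 ≤ m) (hm : m ≤ M) (V : ℕ → ℝ) (g : ℝ → ℝ)
    (hg : IntervalIntegrable (fun s => (t m - s) ^ (-α - 1) * g s) volume 0 (t m))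
    (hV : ∀ j ∈ Finset.Icc 1 m, ∀ s ∈ Ioo (t (j - 1)) (t j), g s ≤
      V m - (V j + (V j - V (j - 1)) / (t j - t (j - 1)) * (s - t j))) :
    (Real.Gamma (1 - α))⁻¹ * ((t m) ^ (-α) * (V m - V 0) +
      α * ∫ s in (0 : ℝ)..(t m), (t m - s) ^ (-α - 1) * g s) ≤ deltaL1 α t V m := by
  rw [deltaL1_eq]
  refine mul_le_mul_of_nonneg_left ?_ (gammaInv_pos hα₁).le
  have hsub : ∀ j ∈ Finset.Icc 1 m, uIcc (t (j - 1)) (t j) ⊆ uIcc 0 (t m) := fun j hj => by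
    have hj' := Finset.mem_Icc.mp hj
    rw [uIcc_of_le (h.le (by omega) (hj'.2.trans hm)), uIcc_of_le (h.nonneg hm)]
    exact Icc_subset_Icc (h.nonneg (by omega)) (h.le hj'.2 hm)
  have hgj : ∀ j ∈ Finset.Icc 1 m, IntervalIntegrable (fun s => (t m - s) ^ (-α - 1) * g s) volume
      (t (j - 1)) (t j) := fun j hj => hg.mono_set (hsub j hj)
  -- On each mesh interval the weight times the increment is `∫ (t_m - s)^{-α} σ ds` with the slope
  -- `σ` of the chord. Integration by parts against `V m` minus the chord leaves boundary terms that
  -- telescope over `j`.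
  have key : ∀ j ∈ Finset.Icc 1 m,
      ((t m - t (j - 1)) ^ (-α) * (V m - V (j - 1)) - (t m - t j) ^ (-α) * (V m - V j)) +
        α * ∫ s in (t (j - 1))..(t j), (t m - s) ^ (-α - 1) * g s ≤
      l1w α t m j * (V j - V (j - 1)) := by
    intro j hj
    have hj' := Finset.mem_Icc.mp hj
    have hlt := h.lt (i := j - 1) (by omega) (hj'.2.trans hm)
    have hτ : 0 < t j - t (j - 1) := sub_pos.mpr hlt
    have htm := h.le hj'.2 hm
    set σ := (V j - V (j - 1)) / (t j - t (j - 1)) with hσ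
    have hi2 : IntervalIntegrable
        (fun s => (t m - s) ^ (-α - 1) * (V m - (V j + σ * (s - t j)))) volume
        (t (j - 1)) (t j) := by
      -- On the last interval `V m` minus the chord is a multiple of `t_m - s` and removes one power
      -- of the kernel.
      rcases hj'.2.eq_or_lt with rfl | hjm
      · have := (intervalIntegrable_sub_rpow (p := -α) (by linarith)
          (t (j - 1)) (t j) (t j)).const_mul σ
        refine this.congr_ae ?_
        filter_upwards [ae_restrict_mem measurableSet_uIoc,
          compl_mem_ae_iff.mpr (measure_singleton (t j))] with s hs hsne
        rw [uIoc_of_le hlt.le] at hs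
        have hpos : 0 < t j - s := sub_pos.mpr (lt_of_le_of_ne hs.2 hsne)
        have : (t j - s) ^ (-α) = (t j - s) ^ (-α - 1) * (t j - s) := by
          rw [← Real.rpow_add_one hpos.ne']; ring_nf
        rw [this]; ring
      · have hjlt := h.lt hjm hm
        refine ContinuousOn.intervalIntegrable ?_
        refine ContinuousOn.mul (ContinuousOn.rpow_const (by fun_prop) fun s hs => Or.inl ?_)
          (by fun_prop)
        rw [uIcc_of_le hlt.le] at hs
        linarith [hs.2]
    have hlin := integral_kernel_deriv (Y := V m) (y' := fun _ => σ)
      (y := fun s => V j + σ * (s - t j)) hα₁ hlt htm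
      (by fun_prop) (fun s _ => by
        have := (((hasDerivAt_id s).sub_const (t j)).const_mul σ).const_add (V j)
        simpa using this)
      (fun hb => by
        have hjm : j = m := by
          rcases hj'.2.eq_or_lt with h' | h'
          · exact h'
          · exact absurd hb (h.lt h' hm).ne
        subst hjm
        refine ⟨|σ|, ?_⟩
        filter_upwards [self_mem_nhdsWithin] with s hs
        have hpos : 0 < t j - s := sub_pos.mpr hs
        rw [show V j - (V j + σ * (s - t j)) = σ * (t j - s) by ring, abs_mul, abs_of_pos hpos])
      hα₀ ((intervalIntegrable_sub_rpow (by linarith) _ _ _).mul_const σ) hi2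
    have hends : V j + σ * (t (j - 1) - t j) = V (j - 1) := by rw [hσ]; field_simp; ring
    have hw : l1w α t m j * (V j - V (j - 1)) =
        ∫ s in (t (j - 1))..(t j), (t m - s) ^ (-α) * σ := by
      rw [intervalIntegral.integral_mul_const, l1w, hσ]
      ring
    simp only [hends, sub_self, mul_zero, add_zero] at hlin
    rw [hw, hlin]
    refine add_le_add le_rfl (mul_le_mul_of_nonneg_left ?_ hα₀.le)
    refine intervalIntegral.integral_mono_on_of_le_Ioo hlt.le (hgj j hj) hi2 fun s hs => ?_
    exact mul_le_mul_of_nonneg_left (hV j hj s hs) (Real.rpow_nonneg (by linarith [hs.2]) _)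
  refine le_trans (le_of_eq ?_) (Finset.sum_le_sum key)
  rw [Finset.sum_add_distrib, ← Finset.mul_sum]
  congr 1
  · have := sum_increments (fun j => -((t m - t j) ^ (-α) * (V m - V j))) m
    simp only [sub_self, mul_zero, h.zero, sub_zero] at this
    rw [neg_zero, zero_sub, neg_neg] at this
    rw [← this]
    exact Finset.sum_congr rfl fun j _ => by ring
  · congr 1
    have hadj := intervalIntegral.sum_integral_adjacent_intervals (a := t) (n := m)
      (f := fun s => (t m - s) ^ (-α - 1) * g s) (μ := volume) fun k hk => by
        simpa using hgj (k + 1) (Finset.mem_Icc.mpr ⟨by omega, by omega⟩)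
    rw [h.zero] at hadj
    have hshift := Finset.sum_Ico_add' (fun j =>
      ∫ s in (t (j - 1))..(t j), (t m - s) ^ (-α - 1) * g s) 0 m 1
    simp only [Nat.add_sub_cancel] at hshift
    rw [← hadj, Finset.range_eq_Ico, hshift]
    rfl

end Kernel

/-! ### Quasi-graded meshes and interpolation errors -/

section Graded

variable {α T r κ : ℝ} {M : ℕ} {t : ℕ → ℝ}

theorem step_le_graded (ht : IsTimeMesh T M t)
    (hq : IsQuasiGraded r κ M t) {j : ℕ} (h1 : 1 ≤ j) (hj : j ≤ M) :
    t j - t (j - 1) ≤ κ * ((t 1 / t j) ^ (1 / r) * t j) := by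
  have hτ := ht.pos' le_rfl (h1.trans hj)
  have htj := ht.pos' h1 hj
  have := hq.step_le j (Finset.mem_Icc.mpr ⟨h1, hj⟩)
  rw [Real.div_rpow hτ.le htj.le]
  rw [Real.rpow_sub htj, Real.rpow_one, mul_assoc] at this
  refine this.trans (le_of_eq ?_)
  ring

/-- Either the step is at most half of `t_j`, and the ratio is at most `2`; or `κ(t_1/t_j)^{1/r} >
1/2`, and then `t_j ≤ (2κ)^r t_1 ≤ (2κ)^r t_{j-1}`. The first interval has to be excluded, because
`t_0 = 0`. -/
theorem exists_ratio_bound (hr : 1 ≤ r) (hκ : 0 < κ) : ∃ Λ : ℝ, 1 ≤ Λ ∧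
    ∀ (T : ℝ) (M : ℕ) (t : ℕ → ℝ), IsTimeMesh T M t → IsQuasiGraded r κ M t →
      ∀ j, 2 ≤ j → j ≤ M → t j ≤ Λ * t (j - 1) := by
  refine ⟨max 2 ((2 * κ) ^ r), le_max_of_le_left (by norm_num), fun T M t ht hq j h2 hj => ?_⟩
  have hτ := ht.pos' le_rfl (by omega : 1 ≤ M)
  have htj := ht.pos' (by omega : 1 ≤ j) hj
  have htj1 := ht.pos' (by omega : 1 ≤ j - 1) (by omega : j - 1 ≤ M)
  have hτ1 := ht.le (by omega : 1 ≤ j - 1) (by omega : j - 1 ≤ M)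
  have hs := step_le_graded ht hq (by omega : 1 ≤ j) hj
  set x := t 1 / t j with hx
  have hx0 : 0 < x := div_pos hτ htj
  rcases le_or_gt (κ * x ^ (1 / r)) (1 / 2) with hle | hgt
  · have : t j ≤ 2 * t (j - 1) := by nlinarith
    exact this.trans (mul_le_mul_of_nonneg_right (le_max_left _ _) htj1.le)
  · have h3 : 1 < (2 * κ) ^ r * x := by
      have h4 : 1 < 2 * κ * x ^ (1 / r) := by linarith
      have h5 := Real.one_lt_rpow h4 (by linarith : 0 < r)
      rwa [Real.mul_rpow (by positivity) (by positivity), ← Real.rpow_mul hx0.le,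
        one_div_mul_cancel (by linarith), Real.rpow_one] at h5
    have h6 : t j ≤ (2 * κ) ^ r * t 1 := by
      have := mul_lt_mul_of_pos_right h3 htj
      rw [one_mul, hx, mul_assoc, div_mul_cancel₀ _ htj.ne'] at this
      exact this.le
    calc t j ≤ (2 * κ) ^ r * t 1 := h6
      _ ≤ max 2 ((2 * κ) ^ r) * t (j - 1) :=
        mul_le_mul (le_max_right _ _) hτ1 hτ.le (le_max_of_le_left (by norm_num))

/-- The kernel of the interpolation error near the singularity. -/
theorem intervalIntegrable_min_kernel (hα₁ : α < 1) {a : ℝ} (ha : 0 < a) {c : ℝ}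
    (hc : 0 < c) : IntervalIntegrable (fun x => min (a ^ 2) (a * x) * x ^ (-α - 1)) volume 0 c := by
  have h1 : IntervalIntegrable (fun x : ℝ => a * x ^ (-α)) volume 0 c :=
    (intervalIntegral.intervalIntegrable_rpow' (by linarith)).const_mul a
  refine h1.mono_fun (Measurable.aestronglyMeasurable (by fun_prop)) ?_
  filter_upwards [ae_restrict_mem measurableSet_uIoc] with x hx
  rw [uIoc_of_le hc.le] at hx
  have hx0 := hx.1
  rw [Real.norm_of_nonneg (by positivity), Real.norm_of_nonneg (by positivity),
    Real.rpow_sub_one hx0.ne']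
  have : min (a ^ 2) (a * x) ≤ a * x := min_le_right _ _
  calc min (a ^ 2) (a * x) * (x ^ (-α) / x) ≤ a * x * (x ^ (-α) / x) :=
        mul_le_mul_of_nonneg_right this (by positivity)
    _ = a * x ^ (-α) := by field_simp

/-- Split at `x = a`: the linear branch gives `a ∫ x^{-α}` below, the quadratic one gives `a² ∫
x^{-α-1}` above, and both are `O(a^{2-α})`. -/
theorem integral_min_kernel_le (hα₀ : 0 < α) (hα₁ : α < 1) {a : ℝ} (ha : 0 < a) {c : ℝ}
    (hc : 0 < c) : ∫ x in (0 : ℝ)..c, min (a ^ 2) (a * x) * x ^ (-α - 1) ≤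
      (1 / (1 - α) + 1 / α) * a ^ (2 - α) := by
  have hnear : ∀ b, 0 < b → b ≤ a →
      ∫ x in (0 : ℝ)..b, min (a ^ 2) (a * x) * x ^ (-α - 1) ≤ 1 / (1 - α) * a ^ (2 - α) := by
    intro b hb hba
    calc _ ≤ ∫ x in (0 : ℝ)..b, a * x ^ (-α) := by
          refine intervalIntegral.integral_mono_on_of_le_Ioo hb.le
            (intervalIntegrable_min_kernel hα₁ ha hb)
            ((intervalIntegral.intervalIntegrable_rpow' (by linarith)).const_mul a) fun x hx => ?_
          rw [Real.rpow_sub_one hx.1.ne']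
          have hx0 := hx.1
          calc min (a ^ 2) (a * x) * (x ^ (-α) / x) ≤ a * x * (x ^ (-α) / x) :=
                mul_le_mul_of_nonneg_right (min_le_right _ _) (by positivity)
            _ = a * x ^ (-α) := by field_simp
      _ = a * (b ^ (1 - α) / (1 - α)) := by
          rw [intervalIntegral.integral_const_mul, integral_rpow (Or.inl (by linarith)),
            Real.zero_rpow (by linarith)]
          ring_nf
      _ ≤ a * (a ^ (1 - α) / (1 - α)) := by
          have h1 : b ^ (1 - α) ≤ a ^ (1 - α) := Real.rpow_le_rpow hb.le hba (by linarith)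
          have h2 : 0 < 1 - α := by linarith
          gcongr
      _ = 1 / (1 - α) * a ^ (2 - α) := by
          rw [show 2 - α = (1 - α) + 1 by ring, Real.rpow_add_one ha.ne']; ring
  have hpos : 0 < a ^ (2 - α) := Real.rpow_pos_of_pos ha _
  rcases le_or_gt c a with hca | hac
  · refine (hnear c hc hca).trans ?_
    have : 0 < 1 / α := by positivity
    nlinarith
  · have hi := intervalIntegrable_min_kernel hα₁ ha hc
    have hsplit := intervalIntegral.integral_add_adjacent_intervals (a := 0) (b := a) (c := c)
      (μ := volume) (f := fun x => min (a ^ 2) (a * x) * x ^ (-α - 1))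
      (intervalIntegrable_min_kernel hα₁ ha ha)
      (hi.mono_set (by
        rw [uIcc_of_le hac.le, uIcc_of_le hc.le]
        exact Icc_subset_Icc ha.le le_rfl))
    have hc0 : (0 : ℝ) ∉ uIcc a c := by
      rw [uIcc_of_le hac.le]
      exact fun h => absurd h.1 (not_le.mpr ha)
    have hfar : ∫ x in a..c, min (a ^ 2) (a * x) * x ^ (-α - 1) ≤ 1 / α * a ^ (2 - α) := by
      calc _ ≤ ∫ x in a..c, a ^ 2 * x ^ (-α - 1) := by
            refine intervalIntegral.integral_mono_on_of_le_Ioo hac.le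
              (hi.mono_set (by
                rw [uIcc_of_le hac.le, uIcc_of_le hc.le]
                exact Icc_subset_Icc ha.le le_rfl))
              ((intervalIntegral.intervalIntegrable_rpow (Or.inr hc0)).const_mul _) fun x hx => ?_
            exact mul_le_mul_of_nonneg_right (min_le_left _ _)
              (Real.rpow_nonneg (ha.trans hx.1).le _)
        _ = a ^ 2 * ((a ^ (-α) - c ^ (-α)) / α) := by
            rw [intervalIntegral.integral_const_mul, integral_rpow (Or.inr ⟨by linarith, hc0⟩)]
            rw [show -α - 1 + 1 = -α by ring]
            congr 1
            rw [div_neg, ← neg_div, neg_sub]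
        _ ≤ a ^ 2 * (a ^ (-α) / α) := by
            have : 0 ≤ c ^ (-α) := Real.rpow_nonneg hc.le _
            gcongr
            linarith
        _ = 1 / α * a ^ (2 - α) := by
            rw [sub_eq_add_neg, Real.rpow_add ha, Real.rpow_two]; ring
    have := hnear a ha le_rfl
    linarith

/-- A majorant of the interpolation error of `s ^ b`, weighted by the kernel `(t_m - s)^{-α-1}`. -/
theorem exists_kernel_majorant (hα₀ : 0 < α) (hα₁ : α < 1) (hr : 1 ≤ r) (hκ : 0 < κ) {b p : ℝ}
    (hb2 : b ≤ 2) (hpb : p < 1 + b) (hpr : p ≤ (2 - α) / r) :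
    ∃ C : ℝ, 0 ≤ C ∧ ∀ (T : ℝ) (M : ℕ) (t : ℕ → ℝ), IsTimeMesh T M t → IsQuasiGraded r κ M t →
      ∀ m, 1 ≤ m → m ≤ M → ∃ Ψ : ℝ → ℝ, IntervalIntegrable Ψ volume 0 (t m) ∧
        (∀ s ∈ Ioo 0 (t m), 0 ≤ Ψ s) ∧
        (∀ j, 2 ≤ j → j ≤ m → ∀ s ∈ Ioo (t (j - 1)) (t j),
          (t j - s) * (s - t (j - 1)) * (t (j - 1)) ^ (b - 2) * (t m - s) ^ (-α - 1) ≤ Ψ s) ∧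
        ∫ s in (0 : ℝ)..(t m), Ψ s ≤ C * ((t m) ^ (b - α) * (t 1 / t m) ^ p) := by
  obtain ⟨Λ, hΛ1, hΛ⟩ := exists_ratio_bound hr hκ
  have hr0 : 0 < r := by linarith
  set C₁ : ℝ := Λ ^ (2 - b) * (κ ^ 2 * Λ ^ 2 * 2 ^ (α + 1)) with hC₁
  set C₂ : ℝ := Λ ^ (2 - b) * 2 ^ (2 - b) with hC₂
  have hC₁0 : 0 ≤ C₁ := by positivity
  have hC₂0 : 0 ≤ C₂ := by positivity
  have hcoef : 0 ≤ 1 / (1 - α) + 1 / α := by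
    have : 0 < 1 - α := by linarith
    positivity
  refine ⟨C₁ / (b - p + 1) + C₂ * ((1 / (1 - α) + 1 / α) * κ ^ (2 - α)), ?_,
    fun T M t ht hq m h1 hm => ?_⟩
  · have : 0 < b - p + 1 := by linarith
    positivity
  have htm := ht.pos' h1 hm
  have hτ := ht.pos' le_rfl (h1.trans hm)
  set c := t m with hc
  set τ := t 1 with hτdef
  have hτc : τ ≤ c := ht.le h1 hm
  -- An upper bound for all steps up to `t_m = c`, because `t^{1-1/r}` is nondecreasing.
  set a : ℝ := κ * ((τ / c) ^ (1 / r) * c) with ha_def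
  have ha : 0 < a := by positivity
  have hx0 : 0 < τ / c := by positivity
  have hx1 : τ / c ≤ 1 := (div_le_one htm).mpr hτc
  have hmin := (intervalIntegrable_min_kernel hα₁ ha htm).comp_sub_left c
  simp only [sub_zero, sub_self] at hmin
  have hI1 : IntervalIntegrable (fun s : ℝ => s ^ (b - p)) volume 0 c :=
    intervalIntegral.intervalIntegrable_rpow' (by linarith)
  -- The first term covers `s ≤ c/2`: the kernel is comparable to `c^{-α-1}`, and the grading bounds
  -- the squared step by a multiple of `(τ/s)^p s²`; `p < 1 + b` makes the result integrable at `0`.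
  -- The second term covers `s > c/2`: there `s^{b-2}` is comparable to `c^{b-2}`, and the product
  -- of the distances to the mesh points is at most both `a²` and `a(c - s)`, which tames the kernel
  -- at `s = c`.
  refine ⟨fun s => C₁ * (c ^ (-α - 1) * τ ^ p) * s ^ (b - p) +
    C₂ * c ^ (b - 2) * (min (a ^ 2) (a * (c - s)) * (c - s) ^ (-α - 1)),
    (hI1.const_mul _).add (hmin.symm.const_mul _), fun s hs => ?_, fun j h2 hjm s hs => ?_, ?_⟩
  · have hs0 := hs.1
    have : 0 < c - s := by linarith [hs.2]
    positivity
  · have hjM : j ≤ M := hjm.trans hm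
    have hj1 := ht.pos' (by omega : 1 ≤ j - 1) (by omega : j - 1 ≤ M)
    have hj := ht.pos' (by omega : 1 ≤ j) hjM
    have hs0 : 0 < s := hj1.trans hs.1
    have hτs : τ ≤ s := (ht.le (by omega : 1 ≤ j - 1) (by omega : j - 1 ≤ M)).trans hs.1.le
    have hjc : t j ≤ c := ht.le hjm hm
    have hsc : 0 < c - s := by linarith [hs.2]
    have hr1 := hΛ T M t ht hq j h2 hjM
    have hst := step_le_graded ht hq (by omega : 1 ≤ j) hjM
    have hu : 0 < t j - s := sub_pos.mpr hs.2
    have hv : 0 < s - t (j - 1) := sub_pos.mpr hs.1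
    have hbase : (t (j - 1)) ^ (b - 2) ≤ Λ ^ (2 - b) * s ^ (b - 2) := by
      have h3 : s / Λ ≤ t (j - 1) := by
        rw [div_le_iff₀ (by linarith), mul_comm]
        exact hs.2.le.trans hr1
      calc (t (j - 1)) ^ (b - 2) ≤ (s / Λ) ^ (b - 2) :=
            Real.rpow_le_rpow_of_nonpos (by positivity) h3 (by linarith)
        _ = Λ ^ (2 - b) * s ^ (b - 2) := by
            rw [Real.div_rpow hs0.le (by linarith), show 2 - b = -(b - 2) by ring,
              Real.rpow_neg (by linarith), div_eq_mul_inv, mul_comm]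
    have hterm1 : 0 ≤ C₁ * (c ^ (-α - 1) * τ ^ p) * s ^ (b - p) := by positivity
    have hterm2 : 0 ≤ C₂ * c ^ (b - 2) *
        (min (a ^ 2) (a * (c - s)) * (c - s) ^ (-α - 1)) := by positivity
    rcases le_or_gt s (c / 2) with hle | hgt
    · refine le_trans ?_ (le_add_of_nonneg_right hterm2)
      have e1 : (c - s) ^ (-α - 1) ≤ 2 ^ (α + 1) * c ^ (-α - 1) := by
        calc (c - s) ^ (-α - 1) ≤ (c / 2) ^ (-α - 1) :=
              Real.rpow_le_rpow_of_nonpos (by positivity) (by linarith) (by linarith)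
          _ = _ := by
              rw [Real.div_rpow htm.le (by norm_num), show -α - 1 = -(α + 1) by ring,
                Real.rpow_neg zero_le_two, div_inv_eq_mul, mul_comm]
      have e2 : t j - t (j - 1) ≤ κ * ((τ / s) ^ (1 / r) * (Λ * s)) := by
        refine hst.trans ?_
        have e3 : (τ / t j) ^ (1 / r) ≤ (τ / s) ^ (1 / r) := by
          refine Real.rpow_le_rpow (by positivity) ?_ (by positivity)
          exact div_le_div_of_nonneg_left hτ.le hs0 hs.2.le
        have e4 : t j ≤ Λ * s := hr1.trans (mul_le_mul_of_nonneg_left hs.1.le (by linarith))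
        gcongr
      have e5 : (t j - s) * (s - t (j - 1)) ≤ κ ^ 2 * Λ ^ 2 * ((τ / s) ^ p * s ^ 2) := by
        calc (t j - s) * (s - t (j - 1)) ≤ (t j - t (j - 1)) * (t j - t (j - 1)) := by
              apply mul_le_mul <;> linarith
          _ ≤ (κ * ((τ / s) ^ (1 / r) * (Λ * s))) * (κ * ((τ / s) ^ (1 / r) * (Λ * s))) :=
              mul_le_mul e2 e2 (by linarith) (by positivity)
          _ = κ ^ 2 * Λ ^ 2 * ((τ / s) ^ (2 / r) * s ^ 2) := by
              rw [show (2 : ℝ) / r = 1 / r + 1 / r by ring, Real.rpow_add (by positivity)]; ring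
          _ ≤ κ ^ 2 * Λ ^ 2 * ((τ / s) ^ p * s ^ 2) := by
              have : (τ / s) ^ (2 / r) ≤ (τ / s) ^ p := by
                refine Real.rpow_le_rpow_of_exponent_ge (by positivity)
                  ((div_le_one hs0).mpr hτs) (hpr.trans ?_)
                gcongr
                linarith
              gcongr
      calc (t j - s) * (s - t (j - 1)) * (t (j - 1)) ^ (b - 2) * (c - s) ^ (-α - 1)
          ≤ κ ^ 2 * Λ ^ 2 * ((τ / s) ^ p * s ^ 2) * (Λ ^ (2 - b) * s ^ (b - 2)) *
            (2 ^ (α + 1) * c ^ (-α - 1)) := by gcongr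
        _ = C₁ * (c ^ (-α - 1) * τ ^ p) * s ^ (b - p) := by
            rw [hC₁, Real.div_rpow hτ.le hs0.le, Real.rpow_sub hs0, Real.rpow_sub hs0,
              Real.rpow_two]
            field_simp
    · refine le_trans ?_ (le_add_of_nonneg_left hterm1)
      have e2 : t j - t (j - 1) ≤ a := by
        refine hst.trans (mul_le_mul_of_nonneg_left ?_ hκ.le)
        rw [Real.div_rpow hτ.le hj.le, Real.div_rpow hτ.le htm.le]
        have e3 : ∀ x : ℝ, 0 < x → τ ^ (1 / r) / x ^ (1 / r) * x = τ ^ (1 / r) * x ^ (1 - 1 / r) :=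
          fun x hx => by rw [Real.rpow_sub hx, Real.rpow_one]; field_simp
        rw [e3 _ hj, e3 _ htm]
        have : 1 / r ≤ 1 := (div_le_one hr0).mpr hr
        have : (t j) ^ (1 - 1 / r) ≤ c ^ (1 - 1 / r) :=
          Real.rpow_le_rpow hj.le hjc (by linarith)
        gcongr
      have e5 : (t j - s) * (s - t (j - 1)) ≤ min (a ^ 2) (a * (c - s)) := by
        refine le_min ?_ ?_
        · rw [sq]; apply mul_le_mul <;> linarith
        · rw [mul_comm]; apply mul_le_mul <;> linarith
      have e6 : s ^ (b - 2) ≤ 2 ^ (2 - b) * c ^ (b - 2) := by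
        calc s ^ (b - 2) ≤ (c / 2) ^ (b - 2) :=
              Real.rpow_le_rpow_of_nonpos (by positivity) hgt.le (by linarith)
          _ = _ := by
              rw [Real.div_rpow htm.le (by norm_num), show b - 2 = -(2 - b) by ring,
                Real.rpow_neg zero_le_two, div_inv_eq_mul, mul_comm]
      calc (t j - s) * (s - t (j - 1)) * (t (j - 1)) ^ (b - 2) * (c - s) ^ (-α - 1)
          ≤ min (a ^ 2) (a * (c - s)) * (Λ ^ (2 - b) * (2 ^ (2 - b) * c ^ (b - 2))) *
            (c - s) ^ (-α - 1) := by
            have := hbase.trans (mul_le_mul_of_nonneg_left e6 (by positivity))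
            gcongr
        _ = _ := by rw [hC₂]; ring
  · rw [intervalIntegral.integral_add (hI1.const_mul _) (hmin.symm.const_mul _),
      intervalIntegral.integral_const_mul, intervalIntegral.integral_const_mul,
      intervalIntegral.integral_comp_sub_left
        (fun x => min (a ^ 2) (a * x) * x ^ (-α - 1)) c, sub_self, sub_zero,
      integral_rpow (Or.inl (by linarith)), Real.zero_rpow (by linarith), sub_zero, add_mul]
    refine add_le_add (le_of_eq ?_) ?_
    · rw [Real.div_rpow hτ.le htm.le, show b - p + 1 = b + 1 - p by ring,
        Real.rpow_sub htm (b + 1) p, Real.rpow_add_one htm.ne', Real.rpow_sub_one htm.ne',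
        Real.rpow_neg htm.le, Real.rpow_sub htm b α]
      have : b + 1 - p ≠ 0 := by linarith
      field_simp
    · have hm2 := integral_min_kernel_le hα₀ hα₁ ha htm
      have ea : a ^ (2 - α) ≤ κ ^ (2 - α) * ((τ / c) ^ p * c ^ (2 - α)) := by
        rw [ha_def, Real.mul_rpow hκ.le (by positivity), Real.mul_rpow (by positivity) htm.le,
          ← Real.rpow_mul hx0.le]
        have : (τ / c) ^ (1 / r * (2 - α)) ≤ (τ / c) ^ p :=
          Real.rpow_le_rpow_of_exponent_ge hx0 hx1 (by rwa [one_div_mul_eq_div])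
        gcongr
      calc C₂ * c ^ (b - 2) * ∫ x in (0 : ℝ)..c, min (a ^ 2) (a * x) * x ^ (-α - 1)
          ≤ C₂ * c ^ (b - 2) * ((1 / (1 - α) + 1 / α) *
            (κ ^ (2 - α) * ((τ / c) ^ p * c ^ (2 - α)))) := by
            have := hm2.trans (mul_le_mul_of_nonneg_left ea hcoef)
            gcongr
        _ = C₂ * ((1 / (1 - α) + 1 / α) * κ ^ (2 - α)) * (c ^ (b - α) * (τ / c) ^ p) := by
            rw [show b - α = (b - 2) + (2 - α) by ring, Real.rpow_add htm]; ring

/-- The linear interpolant of a semiconcave function. -/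
theorem chord_sub_le_of_concaveOn {a b D : ℝ} (hab : a < b) {y : ℝ → ℝ}
    (hy : ConcaveOn ℝ (Icc a b) (fun x => y x - D / 2 * x ^ 2)) {s : ℝ} (hs : s ∈ Ioo a b) :
    y b + (y b - y a) / (b - a) * (s - b) - y s ≤ D / 2 * ((b - s) * (s - a)) := by
  have hba : 0 < b - a := sub_pos.mpr hab
  have h := hy.2 (left_mem_Icc.mpr hab.le) (right_mem_Icc.mpr hab.le)
    (div_nonneg (by linarith [hs.2]) hba.le : 0 ≤ (b - s) / (b - a))
    (div_nonneg (by linarith [hs.1]) hba.le : 0 ≤ (s - a) / (b - a))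
    (by field_simp; ring)
  have hpt : (b - s) / (b - a) * a + (s - a) / (b - a) * b = s := by field_simp; ring
  simp only [smul_eq_mul] at h
  rw [hpt] at h
  have hchord : y b + (y b - y a) / (b - a) * (s - b) =
      (b - s) / (b - a) * y a + (s - a) / (b - a) * y b := by field_simp; ring
  have hsq : (b - s) / (b - a) * a ^ 2 + (s - a) / (b - a) * b ^ 2 = s ^ 2 + (b - s) * (s - a) := by
    field_simp; ring
  rw [hchord]
  linear_combination h + (D / 2) * hsq

end Graded

/-! ### The truncation error of the L1 scheme -/

section Truncation

variable {α T r κ : ℝ} {M : ℕ} {t : ℕ → ℝ}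

/-- A function of time with the weak initial singularity `s ^ α`. -/
structure HasWeakSingularity (α T K : ℝ) (y : ℝ → ℝ) : Prop where
  continuousOn : ContinuousOn y (Icc 0 T)
  differentiable : ∀ s ∈ Ioo 0 T, DifferentiableAt ℝ y s ∧ DifferentiableAt ℝ (deriv y) s
  deriv_le : ∀ s ∈ Ioo 0 T, |deriv y s| ≤ K * s ^ (α - 1)
  deriv2_le : ∀ s ∈ Ioo 0 T, |deriv (deriv y) s| ≤ K * s ^ (α - 2)

namespace HasWeakSingularity

variable {K : ℝ} {y : ℝ → ℝ}

theorem neg (h : HasWeakSingularity α T K y) : HasWeakSingularity α T K (fun s => -y s) := by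
  have hd : deriv (fun s => -y s) = fun s => -deriv y s := by funext s; exact deriv.fun_neg
  refine ⟨h.continuousOn.neg, fun s hs => ⟨(h.differentiable s hs).1.neg, ?_⟩, fun s hs => ?_,
    fun s hs => ?_⟩
  · rw [hd]; exact (h.differentiable s hs).2.neg
  · rw [hd, abs_neg]; exact h.deriv_le s hs
  · rw [hd, deriv.fun_neg, abs_neg]; exact h.deriv2_le s hs

theorem abs_sub_le (h : HasWeakSingularity α T K y) (hα₁ : α < 1) (hK : 0 ≤ K) {a b : ℝ}
    (ha : 0 < a) (hab : a < b) (hb : b ≤ T) : |y b - y a| ≤ K * (a ^ (α - 1) * (b - a)) := by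
  obtain ⟨c, hc, hcd⟩ := exists_deriv_eq_slope y hab
    (h.continuousOn.mono (Icc_subset_Icc ha.le hb))
    (fun s hs => (h.differentiable s ⟨ha.trans hs.1, hs.2.trans_le hb⟩).1.differentiableWithinAt)
  have hba : 0 < b - a := sub_pos.mpr hab
  have h1 := h.deriv_le c ⟨ha.trans hc.1, hc.2.trans_le hb⟩
  have h2 : c ^ (α - 1) ≤ a ^ (α - 1) := Real.rpow_le_rpow_of_nonpos ha hc.1.le (by linarith)
  rw [hcd, abs_div, abs_of_pos hba, div_le_iff₀ hba] at h1
  calc _ ≤ K * c ^ (α - 1) * (b - a) := h1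
    _ ≤ K * a ^ (α - 1) * (b - a) := by gcongr
    _ = _ := by ring

/-- The function `K/α * s^α` has the largest derivative that is allowed, so `y` minus it is
antitone; at `s = 0` continuity suffices. -/
theorem sub_zero_le (h : HasWeakSingularity α T K y) (hα₀ : 0 < α) {b : ℝ} (hb0 : 0 ≤ b)
    (hb : b ≤ T) : y b - y 0 ≤ K / α * b ^ α := by
  have hanti : AntitoneOn (fun s => y s - K / α * s ^ α) (Icc 0 b) := by
    refine antitoneOn_of_deriv_nonpos (convex_Icc 0 b) ?_ ?_ ?_
    · refine (h.continuousOn.mono (Icc_subset_Icc le_rfl hb)).sub (continuousOn_const.mul ?_)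
      exact (Real.continuous_rpow_const hα₀.le).continuousOn
    · intro s hs
      rw [interior_Icc] at hs
      have hd := (h.differentiable s ⟨hs.1, hs.2.trans_le hb⟩).1
      exact (hd.sub ((Real.differentiableAt_rpow_const_of_ne α hs.1.ne').const_mul _)).differentiableWithinAt
    · intro s hs
      rw [interior_Icc] at hs
      have hsT : s ∈ Ioo 0 T := ⟨hs.1, hs.2.trans_le hb⟩
      have hd := (h.differentiable s hsT).1
      have h1 : HasDerivAt (fun s => y s - K / α * s ^ α)
          (deriv y s - K / α * (α * s ^ (α - 1))) s :=
        hd.hasDerivAt.sub ((Real.hasDerivAt_rpow_const (Or.inl hs.1.ne')).const_mul _)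
      rw [h1.deriv]
      have h2 := (le_abs_self _).trans (h.deriv_le s hsT)
      have h3 : K / α * (α * s ^ (α - 1)) = K * s ^ (α - 1) := by field_simp
      linarith
  have := hanti (left_mem_Icc.mpr hb0) (right_mem_Icc.mpr hb0) hb0
  simp only [Real.zero_rpow hα₀.ne', mul_zero, sub_zero] at this
  linarith

theorem abs_sub_zero_le (h : HasWeakSingularity α T K y) (hα₀ : 0 < α) {b : ℝ} (hb0 : 0 ≤ b)
    (hb : b ≤ T) : |y b - y 0| ≤ K / α * b ^ α := by
  rw [abs_le]
  have h1 := h.sub_zero_le hα₀ hb0 hb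
  have h2 := h.neg.sub_zero_le hα₀ hb0 hb
  exact ⟨by linarith, h1⟩

/-- The Caputo derivative in Marchaud form. -/
theorem caputo_eq (h : HasWeakSingularity α T K y) (hα₀ : 0 < α) (hα₁ : α < 1) (hK : 0 ≤ K)
    {c : ℝ} (hc : 0 < c) (hcT : c ≤ T) :
    IntervalIntegrable (fun s => (c - s) ^ (-α - 1) * (y c - y s)) volume 0 c ∧
    caputo α y c = (Real.Gamma (1 - α))⁻¹ * (c ^ (-α) * (y c - y 0) +
      α * ∫ s in (0 : ℝ)..c, (c - s) ^ (-α - 1) * (y c - y s)) := by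
  have hβ : IntervalIntegrable (fun s => K * ((c - s) ^ (-α) * s ^ (α - 1))) volume 0 c :=
    (intervalIntegrable_beta (by linarith) (by linarith) hc).const_mul K
  have hcont : ContinuousOn y (Icc 0 c) := h.continuousOn.mono (Icc_subset_Icc le_rfl hcT)
  have hi1 : IntervalIntegrable (fun s => (c - s) ^ (-α) * deriv y s) volume 0 c := by
    refine hβ.mono_fun (Measurable.aestronglyMeasurable (by
      have := measurable_deriv y
      fun_prop)) ?_
    filter_upwards [ae_restrict_mem measurableSet_uIoc,
      compl_mem_ae_iff.mpr (measure_singleton c)] with s hs hsc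
    rw [uIoc_of_le hc.le] at hs
    have hsc : s < c := lt_of_le_of_ne hs.2 hsc
    have h1 := h.deriv_le s ⟨hs.1, hsc.trans_le hcT⟩
    have hnn : 0 ≤ (c - s) ^ (-α) := Real.rpow_nonneg (by linarith) _
    have hs0 := hs.1
    rw [norm_mul, Real.norm_of_nonneg hnn, Real.norm_eq_abs, Real.norm_of_nonneg (by positivity)]
    calc _ ≤ (c - s) ^ (-α) * (K * s ^ (α - 1)) := mul_le_mul_of_nonneg_left h1 hnn
      _ = _ := by ring
  have hi2 : IntervalIntegrable (fun s => (c - s) ^ (-α - 1) * (y c - y s)) volume 0 c := by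
    refine hβ.mono_fun ?_ ?_
    · refine (Measurable.aestronglyMeasurable (by fun_prop)).mul
        (aestronglyMeasurable_const.sub ?_)
      rw [uIoc_of_le hc.le]
      exact (hcont.mono Ioc_subset_Icc_self).aestronglyMeasurable measurableSet_Ioc
    · filter_upwards [ae_restrict_mem measurableSet_uIoc,
        compl_mem_ae_iff.mpr (measure_singleton c)] with s hs hsc
      rw [uIoc_of_le hc.le] at hs
      have hsc : s < c := lt_of_le_of_ne hs.2 hsc
      have hpos : 0 < c - s := sub_pos.mpr hsc
      have h1 := h.abs_sub_le hα₁ hK hs.1 hsc hcT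
      have hnn : 0 ≤ (c - s) ^ (-α - 1) := Real.rpow_nonneg hpos.le _
      have hs0 := hs.1
      rw [norm_mul, Real.norm_of_nonneg hnn, Real.norm_eq_abs, Real.norm_of_nonneg (by positivity)]
      calc _ ≤ (c - s) ^ (-α - 1) * (K * (s ^ (α - 1) * (c - s))) :=
            mul_le_mul_of_nonneg_left h1 hnn
        _ = _ := by rw [Real.rpow_sub_one hpos.ne']; field_simp
  refine ⟨hi2, ?_⟩
  rw [caputo, integral_kernel_deriv (Y := y c) hα₁ hc le_rfl hcont
    (fun s hs => (h.differentiable s ⟨hs.1, hs.2.trans_le hcT⟩).1.hasDerivAt) ?_ hα₀ hi1 hi2]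
  · simp
  · intro _
    refine ⟨K * (c / 2) ^ (α - 1), ?_⟩
    have : ∀ᶠ s in 𝓝[<] c, s ∈ Ioo (c / 2) c := Ioo_mem_nhdsLT (by linarith)
    filter_upwards [this] with s hs
    have h0 : 0 < c / 2 := by linarith
    have h1 := h.abs_sub_le hα₁ hK (h0.trans hs.1) hs.2 hcT
    have h2 : s ^ (α - 1) ≤ (c / 2) ^ (α - 1) :=
      Real.rpow_le_rpow_of_nonpos h0 hs.1.le (by linarith)
    have h3 : 0 < c - s := sub_pos.mpr hs.2
    calc _ ≤ _ := h1
      _ ≤ K * ((c / 2) ^ (α - 1) * (c - s)) := by gcongr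
      _ = _ := by ring

/-- The interpolation error on the mesh interval that touches the singularity. -/
theorem chord_first_le (h : HasWeakSingularity α T K y) (hα₀ : 0 < α) (hα₁ : α < 1) (hK : 0 ≤ K)
    {b : ℝ} (hb : b ≤ T) {s : ℝ} (hs : s ∈ Ioo 0 b) :
    y b + (y b - y 0) / b * (s - b) - y s ≤ K * (1 + 1 / α) * (s ^ (α - 1) * (b - s)) := by
  have hb0 : 0 < b := hs.1.trans hs.2
  have hbs : 0 < b - s := sub_pos.mpr hs.2
  have h1 := (le_abs_self _).trans (h.abs_sub_le hα₁ hK hs.1 hs.2 hb)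
  have h2 := h.abs_sub_zero_le hα₀ hb0.le hb
  have h3 : -((y b - y 0) / b) ≤ K / α * s ^ (α - 1) := by
    rw [← neg_div, div_le_iff₀ hb0]
    calc _ ≤ _ := (neg_le_abs _).trans h2
      _ = K / α * b ^ (α - 1) * b := by rw [Real.rpow_sub_one hb0.ne']; field_simp
      _ ≤ _ := by
        have : b ^ (α - 1) ≤ s ^ (α - 1) :=
          Real.rpow_le_rpow_of_nonpos hs.1 hs.2.le (by linarith)
        gcongr
  have h4 := mul_le_mul_of_nonneg_right h3 hbs.le
  have h5 : K * (1 + 1 / α) * (s ^ (α - 1) * (b - s)) =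
    K * (s ^ (α - 1) * (b - s)) + K / α * s ^ (α - 1) * (b - s) := by ring
  rw [h5]
  linarith

/-- The interpolation error away from the singularity. -/
theorem chord_le (h : HasWeakSingularity α T K y) (hα₁ : α < 1) (hK : 0 ≤ K)
    {a b : ℝ} (ha : 0 < a) (hab : a < b) (hb : b ≤ T) {s : ℝ} (hs : s ∈ Ioo a b) :
    y b + (y b - y a) / (b - a) * (s - b) - y s ≤
      K * a ^ (α - 2) / 2 * ((b - s) * (s - a)) := by
  refine chord_sub_le_of_concaveOn hab ?_ hs
  -- The largest value that the bound on `y''` allows on `[a, b]`, since `α - 2 < 0`. Subtracting `D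
  -- x²/2` makes `y` concave; `y''` need not be continuous.
  set D := K * a ^ (α - 2)
  have hsub : ∀ x ∈ Ioo a b, x ∈ Ioo 0 T := fun x hx => ⟨ha.trans hx.1, hx.2.trans_le hb⟩
  have hd1 : ∀ x ∈ Ioo a b, HasDerivAt (fun x => y x - D / 2 * x ^ 2) (deriv y x - D * x) x := by
    intro x hx
    have h1 := (h.differentiable x (hsub x hx)).1.hasDerivAt
    have h2 := h1.sub (((hasDerivAt_id x).pow 2).const_mul (D / 2))
    convert! h2 using 1
    simp; ring
  have hd2 : ∀ x ∈ Ioo a b, HasDerivAt (deriv fun x => y x - D / 2 * x ^ 2)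
      (deriv (deriv y) x - D) x := by
    intro x hx
    have h1 := (h.differentiable x (hsub x hx)).2.hasDerivAt
    have h2 : HasDerivAt (fun x => deriv y x - D * x) (deriv (deriv y) x - D) x := by
      have := h1.fun_sub ((hasDerivAt_id x).const_mul D)
      simpa using this
    refine h2.congr_of_eventuallyEq ?_
    filter_upwards [Ioo_mem_nhds hx.1 hx.2] with z hz
    exact (hd1 z hz).deriv
  refine concaveOn_of_deriv2_nonpos (convex_Icc a b) ?_ ?_ ?_ ?_
  · exact (h.continuousOn.mono (Icc_subset_Icc ha.le hb)).sub (by fun_prop)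
  · rw [interior_Icc]
    exact fun x hx => (hd1 x hx).differentiableAt.differentiableWithinAt
  · rw [interior_Icc]
    exact fun x hx => (hd2 x hx).differentiableAt.differentiableWithinAt
  · rw [interior_Icc]
    intro x hx
    simp only [Function.iterate_succ, Function.iterate_zero, Function.comp_apply, id]
    rw [(hd2 x hx).deriv]
    have h1 := (le_abs_self _).trans (h.deriv2_le x (hsub x hx))
    have h2 : x ^ (α - 2) ≤ a ^ (α - 2) := Real.rpow_le_rpow_of_nonpos ha hx.1.le (by linarith)
    have h3 : K * x ^ (α - 2) ≤ D := mul_le_mul_of_nonneg_left h2 hK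
    linarith

end HasWeakSingularity

/-- A majorant of the interpolation error on the first mesh interval. -/
theorem exists_first_majorant (hα₀ : 0 < α) (hα₁ : α < 1) {p : ℝ} (hp0 : 0 ≤ p)
    (hp : p < 1 + α) : ∃ C : ℝ, 0 ≤ C ∧ ∀ τ c : ℝ, 0 < τ → τ ≤ c → ∃ Ψ : ℝ → ℝ,
      IntervalIntegrable Ψ volume 0 c ∧ (∀ s ∈ Ioo 0 c, 0 ≤ Ψ s) ∧
      (∀ s ∈ Ioo 0 τ, s ^ (α - 1) * (τ - s) * (c - s) ^ (-α - 1) ≤ Ψ s) ∧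
      ∫ s in (0 : ℝ)..c, Ψ s ≤ C * (τ / c) ^ p := by
  set B := ∫ x in (0 : ℝ)..1, (1 - x) ^ (-α) * x ^ (α - 1) with hB
  have hB0 : 0 ≤ B := intervalIntegral.integral_nonneg zero_le_one fun x hx =>
    mul_nonneg (Real.rpow_nonneg (by linarith [hx.2]) _) (Real.rpow_nonneg hx.1 _)
  -- An exponent of at least `1` is needed for `τ/s ≤ (τ/s)^q` on the first interval; `q < 1 + α`
  -- keeps `s^{α-q}` integrable.
  set q := max p 1 with hq
  have hq1 : q < 1 + α := max_lt hp (by linarith)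
  have hden : 0 < α - q + 1 := by linarith
  refine ⟨2 ^ p * B + 2 ^ (α + 1) / (α - q + 1), by positivity, fun τ c hτ hτc => ?_⟩
  have hc : 0 < c := hτ.trans_le hτc
  have hx0 : 0 < τ / c := by positivity
  have hx1 : τ / c ≤ 1 := (div_le_one hc).mpr hτc
  have hpow : 0 < (τ / c) ^ p := by positivity
  -- If `c < 2τ`, then `(τ/c)^p` is bounded below and a beta integral, which does not depend on `c`,
  -- suffices. Otherwise the kernel is comparable to `c^{-α-1}` on the whole first interval.
  rcases lt_or_ge c (2 * τ) with hlt | hge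
  · refine ⟨fun s => (c - s) ^ (-α) * s ^ (α - 1),
      intervalIntegrable_beta (by linarith) (by linarith) hc, fun s hs => ?_, fun s hs => ?_, ?_⟩
    · exact mul_nonneg (Real.rpow_nonneg (by linarith [hs.2]) _) (Real.rpow_nonneg hs.1.le _)
    · have hs0 := hs.1
      have hpos : 0 < c - s := by linarith [hs.2]
      rw [Real.rpow_sub_one hpos.ne']
      calc s ^ (α - 1) * (τ - s) * ((c - s) ^ (-α) / (c - s))
          ≤ s ^ (α - 1) * (c - s) * ((c - s) ^ (-α) / (c - s)) := by gcongr
        _ = _ := by field_simp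
    · rw [integral_beta_eq _ _ hc, show -α + (α - 1) + 1 = 0 by ring, Real.rpow_zero, one_mul,
        ← hB]
      have h1 : 1 ≤ 2 ^ p * (τ / c) ^ p := by
        rw [← Real.mul_rpow zero_le_two hx0.le]
        refine Real.one_le_rpow ?_ hp0
        rw [mul_div_assoc', le_div_iff₀ hc]; linarith
      have h2 : 0 ≤ 2 ^ (α + 1) / (α - q + 1) * (τ / c) ^ p := by positivity
      nlinarith
  · have hI : IntervalIntegrable (fun s : ℝ => s ^ (α - q)) volume 0 c :=
      intervalIntegral.intervalIntegrable_rpow' (by linarith)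
    refine ⟨fun s => 2 ^ (α + 1) * (c ^ (-α - 1) * τ ^ q) * s ^ (α - q), hI.const_mul _,
      fun s hs => ?_, fun s hs => ?_, ?_⟩
    · have := hs.1
      positivity
    · have hs0 := hs.1
      have hpos : 0 < c - s := by linarith [hs.2]
      have e1 : (c - s) ^ (-α - 1) ≤ 2 ^ (α + 1) * c ^ (-α - 1) := by
        calc (c - s) ^ (-α - 1) ≤ (c / 2) ^ (-α - 1) :=
              Real.rpow_le_rpow_of_nonpos (by positivity) (by linarith [hs.2]) (by linarith)
          _ = _ := by
              rw [Real.div_rpow hc.le (by norm_num), show -α - 1 = -(α + 1) by ring,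
                Real.rpow_neg zero_le_two, div_inv_eq_mul, mul_comm]
      have e2 : s ^ (α - 1) * (τ - s) ≤ τ ^ q * s ^ (α - q) := by
        have e3 : τ / s ≤ (τ / s) ^ q := by
          have : (1 : ℝ) ≤ τ / s := (one_le_div hs0).mpr hs.2.le
          calc τ / s = (τ / s) ^ (1 : ℝ) := (Real.rpow_one _).symm
            _ ≤ _ := Real.rpow_le_rpow_of_exponent_le this (le_max_right _ _)
        calc s ^ (α - 1) * (τ - s) ≤ s ^ (α - 1) * τ := by gcongr; linarith
          _ = s ^ α * (τ / s) := by rw [Real.rpow_sub_one hs0.ne']; field_simp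
          _ ≤ s ^ α * (τ / s) ^ q := by gcongr
          _ = _ := by rw [Real.div_rpow hτ.le hs0.le, Real.rpow_sub hs0]; ring
      calc _ ≤ τ ^ q * s ^ (α - q) * (2 ^ (α + 1) * c ^ (-α - 1)) := by
            have : 0 ≤ (c - s) ^ (-α - 1) := Real.rpow_nonneg hpos.le _
            gcongr
        _ = _ := by ring
    · rw [intervalIntegral.integral_const_mul, integral_rpow (Or.inl (by linarith)),
        Real.zero_rpow (by linarith), sub_zero]
      have e1 : 2 ^ (α + 1) * (c ^ (-α - 1) * τ ^ q) * (c ^ (α - q + 1) / (α - q + 1)) =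
          2 ^ (α + 1) / (α - q + 1) * (τ / c) ^ q := by
        rw [Real.div_rpow hτ.le hc.le, Real.rpow_add_one hc.ne',
          Real.rpow_sub_one hc.ne', Real.rpow_sub hc, Real.rpow_neg hc.le]
        field_simp
      rw [e1, add_mul]
      have e2 : (τ / c) ^ q ≤ (τ / c) ^ p :=
        Real.rpow_le_rpow_of_exponent_ge hx0 hx1 (le_max_left _ _)
      have e3 : 2 ^ (α + 1) / (α - q + 1) * (τ / c) ^ q ≤
        2 ^ (α + 1) / (α - q + 1) * (τ / c) ^ p := by gcongr
      have e4 : 0 ≤ 2 ^ p * B * (τ / c) ^ p := by positivity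
      linarith

/-- In Marchaud form, the L1 operator and the Caputo derivative differ by the integral of the kernel
against `y` minus its interpolant. The first interval is estimated by `exists_first_majorant`, the
others by `exists_kernel_majorant` with `b = α`, so that no power of `t_m` remains. It suffices to
prove a one-sided estimate for all admissible functions, as `-y` is admissible too. -/
theorem exists_truncation_bound (hα₀ : 0 < α) (hα₁ : α < 1) (hr : 1 ≤ r) (hκ : 0 < κ) {p K : ℝ}
    (hK : 0 ≤ K) (hp0 : 0 ≤ p) (hpα : p < 1 + α) (hpr : p ≤ (2 - α) / r) :
    ∃ C : ℝ, 0 ≤ C ∧ ∀ (T : ℝ) (M : ℕ) (t : ℕ → ℝ), IsTimeMesh T M t → IsQuasiGraded r κ M t →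
      ∀ y, HasWeakSingularity α T K y → ∀ m, 1 ≤ m → m ≤ M →
        |deltaL1 α t (fun j => y (t j)) m - caputo α y (t m)| ≤ C * (t 1 / t m) ^ p := by
  obtain ⟨C₁, hC₁, h₁⟩ := exists_kernel_majorant (b := α) (p := p) hα₀ hα₁ hr hκ (by linarith)
    hpα hpr
  obtain ⟨C₂, hC₂, h₂⟩ := exists_first_majorant hα₀ hα₁ hp0 hpα
  have hG := gammaInv_pos hα₁
  set G := (Real.Gamma (1 - α))⁻¹ with hGdef
  refine ⟨G * (α * (K / 2 * C₁ + K * (1 + 1 / α) * C₂)), by positivity,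
    fun T M t ht hq y hy m h1 hm => ?_⟩
  have hc := ht.pos' h1 hm
  have hcT := ht.le_final hm
  have hτ := ht.pos' le_rfl (h1.trans hm)
  obtain ⟨Ψ₁, hi₁, hn₁, hb₁, hI₁⟩ := h₁ T M t ht hq m h1 hm
  obtain ⟨Ψ₂, hi₂, hn₂, hb₂, hI₂⟩ := h₂ (t 1) (t m) hτ (ht.le h1 hm)
  rw [sub_self, Real.rpow_zero, one_mul] at hI₁
  have hone : ∀ y, HasWeakSingularity α T K y →
      caputo α y (t m) - G * (α * (K / 2 * C₁ + K * (1 + 1 / α) * C₂)) * (t 1 / t m) ^ p ≤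
        deltaL1 α t (fun j => y (t j)) m := by
    intro y hy
    obtain ⟨hci, hce⟩ := hy.caputo_eq hα₀ hα₁ hK hc hcT
    set Θ : ℝ → ℝ := fun s => K / 2 * Ψ₁ s + K * (1 + 1 / α) * Ψ₂ s with hΘ
    have hΘi : IntervalIntegrable Θ volume 0 (t m) := (hi₁.const_mul _).add (hi₂.const_mul _)
    have hΘI : ∫ s in (0 : ℝ)..(t m), Θ s ≤
        (K / 2 * C₁ + K * (1 + 1 / α) * C₂) * (t 1 / t m) ^ p := by
      rw [hΘ, intervalIntegral.integral_add (hi₁.const_mul _) (hi₂.const_mul _),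
        intervalIntegral.integral_const_mul, intervalIntegral.integral_const_mul]
      have e1 := mul_le_mul_of_nonneg_left hI₁ (by positivity : 0 ≤ K / 2)
      have e2 := mul_le_mul_of_nonneg_left hI₂ (by positivity : 0 ≤ K * (1 + 1 / α))
      linarith
    have hkg : ∀ s ∈ Ioo 0 (t m), (t m - s) ^ (-α - 1) *
        (y (t m) - y s - (t m - s) ^ (α + 1) * Θ s) =
        (t m - s) ^ (-α - 1) * (y (t m) - y s) - Θ s := by
      intro s hs
      have hpos : 0 < t m - s := sub_pos.mpr hs.2
      rw [mul_sub, ← mul_assoc ((t m - s) ^ (-α - 1)), ← Real.rpow_add hpos,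
        show -α - 1 + (α + 1) = 0 by ring, Real.rpow_zero, one_mul]
    have hae : (fun s => (t m - s) ^ (-α - 1) * (y (t m) - y s) - Θ s) =ᵐ[volume.restrict
        (uIoc 0 (t m))] fun s => (t m - s) ^ (-α - 1) *
        (y (t m) - y s - (t m - s) ^ (α + 1) * Θ s) := by
      filter_upwards [ae_restrict_mem measurableSet_uIoc,
        ae_restrict_of_ae (compl_mem_ae_iff.mpr (measure_singleton (t m)))] with s hs hsc
      rw [uIoc_of_le hc.le] at hs
      exact (hkg s ⟨hs.1, lt_of_le_of_ne hs.2 hsc⟩).symm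
    -- The factor `(t_m - s)^{α+1}` cancels the kernel for `s < t_m`, so the majorant `Θ`, in which
    -- the kernel is included already, is subtracted from the integrand unchanged.
    have hmain := deltaL1_ge_marchaud hα₀ hα₁ ht h1 hm (fun j => y (t j))
      (fun s => y (t m) - y s - (t m - s) ^ (α + 1) * Θ s)
      ((hci.sub hΘi).congr_ae hae) (fun j hj s hs => ?_)
    · rw [← intervalIntegral.integral_congr_ae_restrict hae,
        intervalIntegral.integral_sub hci hΘi, ht.zero] at hmain
      rw [hce]
      refine le_trans ?_ hmain
      have e1 := mul_le_mul_of_nonneg_left hΘI (mul_nonneg hG.le hα₀.le)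
      rw [← hGdef] at *
      linarith
    · have hj' := Finset.mem_Icc.mp hj
      have hjM := hj'.2.trans hm
      have hjT := ht.le_final hjM
      have hjm := ht.le hj'.2 hm
      have hst : 0 < t m - s := by linarith [hs.2]
      have hs0 : 0 < s := (ht.nonneg (j := j - 1) (by omega)).trans_lt hs.1
      have hsm : s ∈ Ioo 0 (t m) := ⟨hs0, by linarith⟩
      have hprod : ∀ A B, A * (t m - s) ^ (-α - 1) ≤ B → A ≤ (t m - s) ^ (α + 1) * B := by
        intro A B hAB
        have hp : 0 < (t m - s) ^ (α + 1) := Real.rpow_pos_of_pos hst _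
        have := mul_le_mul_of_nonneg_left hAB hp.le
        rwa [mul_left_comm, ← Real.rpow_add hst, show α + 1 + (-α - 1) = 0 by ring,
          Real.rpow_zero, mul_one] at this
      have hmaj : y (t j) + (y (t j) - y (t (j - 1))) / (t j - t (j - 1)) * (s - t j) - y s ≤
          (t m - s) ^ (α + 1) * Θ s := by
        rcases hj'.1.eq_or_lt with h1j | h1j
        · subst h1j
          simp only [Nat.sub_self, ht.zero, sub_zero] at hs ⊢
          refine (hy.chord_first_le hα₀ hα₁ hK hjT hs).trans (hprod _ _ ?_)
          have e1 := mul_le_mul_of_nonneg_left (hb₂ s hs)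
            (by positivity : 0 ≤ K * (1 + 1 / α))
          have e2 := mul_nonneg (by positivity : 0 ≤ K / 2) (hn₁ s hsm)
          simp only [hΘ]
          linarith
        · have ha := ht.pos' (by omega : 1 ≤ j - 1) (by omega : j - 1 ≤ M)
          refine (hy.chord_le hα₁ hK ha (ht.lt (by omega) hjM) hjT hs).trans (hprod _ _ ?_)
          have e1 := mul_le_mul_of_nonneg_left (hb₁ j h1j hj'.2 s hs)
            (by positivity : 0 ≤ K / 2)
          have e2 := mul_nonneg (by positivity : 0 ≤ K * (1 + 1 / α)) (hn₂ s hsm)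
          simp only [hΘ]
          linarith
      linarith
  rw [abs_le]
  have e1 := hone y hy
  have e2 := hone _ hy.neg
  have e3 : caputo α (fun s => -y s) (t m) = -caputo α y (t m) := by
    have hd : deriv (fun s => -y s) = fun s => -deriv y s := by funext s; exact deriv.fun_neg
    simp only [caputo, hd, mul_neg, intervalIntegral.integral_neg]
  rw [deltaL1_neg, e3] at e2
  constructor <;> linarith

end Truncation

/-! ### Barrier functions -/

section Cutoff

variable {α : ℝ}

/-- Since `-β ≤ 1`, `(s/c)^{-β} ≥ s/c`. The factor `c - s` on the right makes the Marchaud integral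
of a negative power converge. -/
theorem rpow_sub_rpow_le {β : ℝ} (hβ1 : -1 ≤ β) {c s : ℝ} (hs : s ∈ Ioo 0 c) :
    s ^ β - c ^ β ≤ c⁻¹ * (s ^ β * (c - s)) := by
  have hs0 := hs.1
  have hc : 0 < c := hs.1.trans hs.2
  have h1 : s / c ≤ (s / c) ^ (-β) := by
    have := Real.rpow_le_rpow_of_exponent_ge (div_pos hs0 hc) ((div_le_one hc).mpr hs.2.le)
      (by linarith : -β ≤ 1)
    rwa [Real.rpow_one] at this
  have h2 : s ^ β * (s / c) ^ (-β) = c ^ β := by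
    rw [Real.div_rpow hs0.le hc.le, Real.rpow_neg hs0.le, Real.rpow_neg hc.le]
    have := (Real.rpow_pos_of_pos hs0 β).ne'
    have := (Real.rpow_pos_of_pos hc β).ne'
    field_simp
  have h3 := mul_le_mul_of_nonneg_left h1 (Real.rpow_pos_of_pos hs0 β).le
  rw [h2] at h3
  have h4 : c⁻¹ * (s ^ β * (c - s)) = s ^ β - s ^ β * (s / c) := by field_simp
  linarith

theorem intervalIntegrable_kernel_rpow (hα₁ : α < 1) {β : ℝ} (hβ0 : β < 0)
    (hβ1 : -1 < β) {c : ℝ} (hc : 0 < c) :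
    IntervalIntegrable (fun s => (c - s) ^ (-α - 1) * (c ^ β - s ^ β)) volume 0 c := by
  have hb : IntervalIntegrable (fun s => c⁻¹ * ((c - s) ^ (-α) * s ^ β)) volume 0 c :=
    (intervalIntegrable_beta (by linarith) hβ1 hc).const_mul _
  refine hb.mono_fun (Measurable.aestronglyMeasurable (by fun_prop)) ?_
  filter_upwards [ae_restrict_mem measurableSet_uIoc,
    ae_restrict_of_ae (compl_mem_ae_iff.mpr (measure_singleton c))] with s hs hsc
  rw [uIoc_of_le hc.le] at hs
  have hs' : s ∈ Ioo 0 c := ⟨hs.1, lt_of_le_of_ne hs.2 hsc⟩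
  have hs0 := hs'.1
  have hpos : 0 < c - s := sub_pos.mpr hs'.2
  have h1 := rpow_sub_rpow_le hβ1.le hs'
  have h2 : c ^ β ≤ s ^ β := Real.rpow_le_rpow_of_nonpos hs0 hs.2 hβ0.le
  rw [norm_mul, Real.norm_of_nonneg (by positivity), Real.norm_eq_abs, abs_sub_comm,
    abs_of_nonneg (by linarith), Real.norm_of_nonneg (by positivity)]
  calc _ ≤ (c - s) ^ (-α - 1) * (c⁻¹ * (s ^ β * (c - s))) := by gcongr
    _ = _ := by rw [Real.rpow_sub_one hpos.ne']; field_simp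

/-- The fractional derivative of `s ^ β` (in Marchaud form) at `s = 1`. -/
def marchaudCoef (α β : ℝ) : ℝ :=
  1 + α * ∫ x in (0 : ℝ)..1, (1 - x) ^ (-α - 1) * (1 - x ^ β)

theorem marchaud_rpow {β : ℝ} {c : ℝ} (hc : 0 < c) :
    c ^ (-α) * c ^ β + α * ∫ s in (0 : ℝ)..c, (c - s) ^ (-α - 1) * (c ^ β - s ^ β) =
      marchaudCoef α β * c ^ (β - α) := by
  have h := intervalIntegral.mul_integral_comp_mul_left (a := 0) (b := 1)
    (f := fun s => (c - s) ^ (-α - 1) * (c ^ β - s ^ β)) (c := c)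
  rw [mul_zero, mul_one] at h
  have : ∀ x ∈ uIcc (0 : ℝ) 1, (c - c * x) ^ (-α - 1) * (c ^ β - (c * x) ^ β) =
      c ^ (β - α - 1) * ((1 - x) ^ (-α - 1) * (1 - x ^ β)) := fun x hx => by
    rw [uIcc_of_le zero_le_one] at hx
    rw [show c - c * x = c * (1 - x) by ring, Real.mul_rpow hc.le (by linarith [hx.2]),
      Real.mul_rpow hc.le hx.1, show β - α - 1 = (-α - 1) + β by ring, Real.rpow_add hc]
    ring
  rw [← h, intervalIntegral.integral_congr this, intervalIntegral.integral_const_mul,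
    Real.rpow_sub_one hc.ne', marchaudCoef, Real.rpow_sub hc, Real.rpow_neg hc.le]
  field_simp

/-- The power `s^{α-1}` is annihilated by the fractional derivative. Concretely, `(1 - x^α)(1 -
x)^{-α}` is a primitive of `α` times the integrand; it falls from `1` to `0`, so the integral term
equals `-1`. It is continuous at `1` because `1 - x^α ≤ 1 - x` on `[0, 1]`. -/
theorem marchaudCoef_critical (hα₀ : 0 < α) (hα₁ : α < 1) : marchaudCoef α (α - 1) = 0 := by
  have hint := intervalIntegrable_kernel_rpow hα₁ (β := α - 1) (by linarith) (by linarith)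
    one_pos
  simp only [Real.one_rpow] at hint
  have hG : ContinuousOn (fun x : ℝ => (1 - x ^ α) * (1 - x) ^ (-α)) (Icc 0 1) := by
    intro x hx
    by_cases hx1 : x = 1
    · have hzero : (1 - x ^ α) * (1 - x) ^ (-α) = 0 := by simp [hx1]
      rw [ContinuousWithinAt, hzero, hx1]
      have hlim : Tendsto (fun x : ℝ => (1 - x) ^ (1 - α)) (𝓝[Icc 0 1] 1) (𝓝 0) := by
        have : Continuous (fun x : ℝ => (1 - x) ^ (1 - α)) :=
          Continuous.rpow_const (by fun_prop) fun s => Or.inr (by linarith)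
        have := this.tendsto 1
        rw [sub_self, Real.zero_rpow (by linarith)] at this
        exact this.mono_left nhdsWithin_le_nhds
      refine squeeze_zero_norm' ?_ hlim
      filter_upwards [self_mem_nhdsWithin] with y hy
      rcases hy.2.eq_or_lt with rfl | hy1
      · simp [Real.zero_rpow (by linarith : 1 - α ≠ 0)]
      · have hpos : 0 < 1 - y := by linarith
        have e1 : y ^ α ≤ 1 := Real.rpow_le_one hy.1 hy.2 hα₀.le
        have e2 : y ≤ y ^ α := by
          have := Real.rpow_le_rpow_of_exponent_ge_of_imp hy.1 hy.2 hα₁.le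
            (fun _ h => absurd h one_ne_zero)
          rwa [Real.rpow_one] at this
        rw [Real.norm_of_nonneg (mul_nonneg (by linarith) (Real.rpow_nonneg hpos.le _)),
          show 1 - α = -α + 1 by ring, Real.rpow_add_one hpos.ne', mul_comm]
        exact mul_le_mul_of_nonneg_left (by linarith) (Real.rpow_nonneg hpos.le _)
    · have hne : 1 - x ≠ 0 := fun h => hx1 (by linarith)
      have h1 : ContinuousAt (fun x : ℝ => (1 - x) ^ (-α)) x :=
        ContinuousAt.rpow_const (by fun_prop) (Or.inl hne)
      have h2 : Continuous (fun x : ℝ => 1 - x ^ α) :=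
        continuous_const.sub (Real.continuous_rpow_const hα₀.le)
      exact (h2.continuousAt.mul h1).continuousWithinAt
  have hGd : ∀ x ∈ Ioo (0 : ℝ) 1, HasDerivAt (fun x : ℝ => (1 - x ^ α) * (1 - x) ^ (-α))
      (α * ((1 - x) ^ (-α - 1) * (1 - x ^ (α - 1)))) x := by
    intro x hx
    have hpos : 0 < 1 - x := by linarith [hx.2]
    have h1 : HasDerivAt (fun s : ℝ => (1 - s) ^ (-α)) (-1 * (-α) * (1 - x) ^ (-α - 1)) x :=
      ((hasDerivAt_id x).const_sub 1).rpow_const (Or.inl hpos.ne')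
    have h2 := ((Real.hasDerivAt_rpow_const (p := α) (Or.inl hx.1.ne')).const_sub 1).mul h1
    convert! h2 using 1
    have e1 : (1 - x) ^ (-α) = (1 - x) ^ (-α - 1) * (1 - x) := by
      rw [← Real.rpow_add_one hpos.ne']; ring_nf
    have e2 : x ^ α = x ^ (α - 1) * x := by
      rw [← Real.rpow_add_one hx.1.ne']; ring_nf
    rw [e1, e2]
    ring
  have h := intervalIntegral.integral_eq_sub_of_hasDerivAt_of_le zero_le_one hG hGd
    (hint.const_mul α)
  rw [intervalIntegral.integral_const_mul] at h
  rw [marchaudCoef, h]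
  simp [Real.zero_rpow hα₀.ne']

/-- On `(0, 1)` the integrand increases strictly with `β`, and the coefficient vanishes at `β = α -
1`. -/
theorem marchaudCoef_pos (hα₀ : 0 < α) (hα₁ : α < 1) {β : ℝ} (hβ : α - 1 < β) (hβ0 : β < 0) :
    0 < marchaudCoef α β := by
  have h1 := intervalIntegrable_kernel_rpow hα₁ (β := α - 1) (by linarith) (by linarith)
    one_pos
  have h2 := intervalIntegrable_kernel_rpow hα₁ hβ0 (by linarith) one_pos
  simp only [Real.one_rpow] at h1 h2
  have hpos := intervalIntegral.intervalIntegral_pos_of_pos_on (h2.sub h1) (fun x hx => by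
    have hp : 0 < (1 - x) ^ (-α - 1) := Real.rpow_pos_of_pos (by linarith [hx.2]) _
    have hlt : x ^ β < x ^ (α - 1) := Real.rpow_lt_rpow_of_exponent_gt hx.1 hx.2 hβ
    nlinarith) one_pos
  rw [intervalIntegral.integral_sub h2 h1] at hpos
  have hcrit := marchaudCoef_critical hα₀ hα₁
  rw [marchaudCoef] at hcrit ⊢
  nlinarith

/-- The power `s ^ β` with a linear cutoff on `[0, θ]`. -/
def cutPow (θ β s : ℝ) : ℝ := min (θ ^ (β - 1) * s) (s ^ β)

theorem cutPow_zero (θ : ℝ) {β : ℝ} (hβ : β < 0) : cutPow θ β 0 = 0 := by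
  simp [cutPow, Real.zero_rpow hβ.ne]

theorem cutPow_of_le {θ β s : ℝ} (hβ : β < 0) (hs : 0 ≤ s) (hsθ : s ≤ θ) :
    cutPow θ β s = θ ^ (β - 1) * s := by
  rcases hs.eq_or_lt with rfl | hs0
  · simp [cutPow, Real.zero_rpow hβ.ne]
  · refine min_eq_left ?_
    have h : θ ^ (β - 1) ≤ s ^ (β - 1) := Real.rpow_le_rpow_of_nonpos hs0 hsθ (by linarith)
    calc θ ^ (β - 1) * s ≤ s ^ (β - 1) * s := by gcongr
      _ = s ^ β := by rw [Real.rpow_sub_one hs0.ne', div_mul_cancel₀ _ hs0.ne']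

theorem cutPow_of_ge {θ β s : ℝ} (hβ : β < 0) (hθ : 0 < θ) (hsθ : θ ≤ s) :
    cutPow θ β s = s ^ β := by
  have hs0 : 0 < s := hθ.trans_le hsθ
  refine min_eq_right ?_
  have h : s ^ (β - 1) ≤ θ ^ (β - 1) := Real.rpow_le_rpow_of_nonpos hθ hsθ (by linarith)
  calc s ^ β = s ^ (β - 1) * s := by rw [Real.rpow_sub_one hs0.ne', div_mul_cancel₀ _ hs0.ne']
    _ ≤ θ ^ (β - 1) * s := by gcongr

theorem cutPow_nonneg {θ β s : ℝ} (hθ : 0 < θ) (hs : 0 ≤ s) : 0 ≤ cutPow θ β s :=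
  le_min (by positivity) (by positivity)

theorem cutPow_le (θ β s : ℝ) : cutPow θ β s ≤ s ^ β := min_le_right _ _

/-- A minimum of concave functions is concave, and both branches become concave when the same
parabola is subtracted. The kink at `θ` therefore does no harm, and `θ` need not be a mesh point. -/
theorem concaveOn_cutPow {θ β a b : ℝ} (hβ : β < 0) (ha : 0 < a) :
    ConcaveOn ℝ (Icc a b) (fun x => cutPow θ β x - β * (β - 1) * a ^ (β - 2) / 2 * x ^ 2) := by
  set D := β * (β - 1) * a ^ (β - 2) with hD
  have hD0 : 0 ≤ D := mul_nonneg (by nlinarith) (Real.rpow_nonneg ha.le _)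
  have hsq : ConcaveOn ℝ (Icc a b) (fun x : ℝ => -(D / 2 * x ^ 2)) :=
    ((((convexOn_pow 2).subset (fun x hx => ha.le.trans hx.1) (convex_Icc a b))).smul
      (by positivity : 0 ≤ D / 2)).neg
  have h1 : ConcaveOn ℝ (Icc a b) (fun x => θ ^ (β - 1) * x - D / 2 * x ^ 2) := by
    have hlin : ConcaveOn ℝ (Icc a b) (fun x : ℝ => θ ^ (β - 1) * x) :=
      (LinearMap.mulLeft ℝ (θ ^ (β - 1))).concaveOn (convex_Icc a b)
    exact hlin.add hsq
  have hder : ∀ p : ℝ, ∀ x ∈ Ioo a b, HasDerivAt (fun x : ℝ => x ^ p) (p * x ^ (p - 1)) x :=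
    fun p x hx => Real.hasDerivAt_rpow_const (Or.inl (ha.trans hx.1).ne')
  have h2 : ConcaveOn ℝ (Icc a b) (fun x => x ^ β - D / 2 * x ^ 2) := by
    have hd1 : ∀ x ∈ Ioo a b, HasDerivAt (fun x => x ^ β - D / 2 * x ^ 2)
        (β * x ^ (β - 1) - D * x) x := by
      intro x hx
      have h2 := (hder β x hx).fun_sub (((hasDerivAt_id x).pow 2).const_mul (D / 2))
      convert! h2 using 1
      simp; ring
    have hd2 : ∀ x ∈ Ioo a b, HasDerivAt (deriv fun x => x ^ β - D / 2 * x ^ 2)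
        (β * ((β - 1) * x ^ (β - 1 - 1)) - D) x := by
      intro x hx
      have h2 : HasDerivAt (fun x => β * x ^ (β - 1) - D * x)
          (β * ((β - 1) * x ^ (β - 1 - 1)) - D) x := by
        have := ((hder (β - 1) x hx).const_mul β).fun_sub ((hasDerivAt_id x).const_mul D)
        simpa using this
      refine h2.congr_of_eventuallyEq ?_
      filter_upwards [Ioo_mem_nhds hx.1 hx.2] with z hz
      exact (hd1 z hz).deriv
    refine concaveOn_of_deriv2_nonpos (convex_Icc a b) ?_ ?_ ?_ ?_
    · refine ContinuousOn.sub (ContinuousOn.rpow_const continuousOn_id fun x hx => Or.inl ?_)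
        (by fun_prop)
      exact (ha.trans_le hx.1).ne'
    · rw [interior_Icc]
      exact fun x hx => (hd1 x hx).differentiableAt.differentiableWithinAt
    · rw [interior_Icc]
      exact fun x hx => (hd2 x hx).differentiableAt.differentiableWithinAt
    · rw [interior_Icc]
      intro x hx
      simp only [Function.iterate_succ, Function.iterate_zero, Function.comp_apply, id]
      rw [(hd2 x hx).deriv, show β - 1 - 1 = β - 2 by ring]
      have h3 : x ^ (β - 2) ≤ a ^ (β - 2) := Real.rpow_le_rpow_of_nonpos ha hx.1.le (by linarith)
      have h4 : 0 ≤ β * (β - 1) := by nlinarith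
      have := mul_le_mul_of_nonneg_left h3 h4
      rw [hD]
      linarith
  have h3 := h1.inf h2
  refine h3.congr fun x _ => ?_
  simp only [cutPow, Pi.inf_apply]
  exact (min_sub_sub_right _ _ _)

end Cutoff

/-! ### The L1 operator on cutoff powers -/

section Barrier

variable {α T r κ : ℝ} {M : ℕ} {t : ℕ → ℝ}

/-- Up to `θ` the function is linear, so the L1 operator is exact and the integrals telescope. -/
theorem deltaL1_cutPow_of_le (hα₁ : α < 1) (ht : IsTimeMesh T M t) {m : ℕ}
    (hm : m ≤ M) {θ β : ℝ} (hβ : β < 0) (hθ : t m ≤ θ) :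
    deltaL1 α t (fun j => cutPow θ β (t j)) m =
      (Real.Gamma (1 - α))⁻¹ * (θ ^ (β - 1) * ((t m) ^ (1 - α) / (1 - α))) := by
  have hval : ∀ j ≤ m, cutPow θ β (t j) = θ ^ (β - 1) * t j := fun j hj =>
    cutPow_of_le hβ (ht.nonneg (hj.trans hm)) ((ht.le hj hm).trans hθ)
  rw [deltaL1_congr hval, deltaL1_smul, deltaL1, ← mul_assoc, mul_comm (θ ^ (β - 1)), mul_assoc]
  congr 2
  have hterm : ∀ j ∈ Finset.Icc 1 m, (t j - t (j - 1)) / (t j - t (j - 1)) *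
      ∫ s in (t (j - 1))..(t j), (t m - s) ^ (-α) =
      -((t m - t j) ^ (1 - α) / (1 - α)) - -((t m - t (j - 1)) ^ (1 - α) / (1 - α)) := by
    intro j hj
    have hj' := Finset.mem_Icc.mp hj
    rw [div_self (ht.step_pos hj'.1 (hj'.2.trans hm)).ne', integral_sub_rpow (by linarith),
      show -α + 1 = 1 - α by ring]
    ring
  rw [Finset.sum_congr rfl hterm,
    sum_increments (fun j => -((t m - t j) ^ (1 - α) / (1 - α))) m, ht.zero, sub_self,
    Real.zero_rpow (by linarith)]
  simp

/-- The L1 operator applied to a power with a linear cutoff. -/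
theorem exists_deltaL1_cutPow_ge (hα₀ : 0 < α) (hα₁ : α < 1) (hr : 1 ≤ r) (hκ : 0 < κ) {β p : ℝ}
    (hβ : α - 1 ≤ β) (hβ0 : β < 0) (hpb : p < 1 + β) (hpr : p ≤ (2 - α) / r) :
    ∃ C : ℝ, 0 ≤ C ∧ ∀ (T : ℝ) (M : ℕ) (t : ℕ → ℝ), IsTimeMesh T M t → IsQuasiGraded r κ M t →
      ∀ m, 1 ≤ m → m ≤ M → ∀ θ, t 1 ≤ θ → θ ≤ t m →
        (Real.Gamma (1 - α))⁻¹ * (marchaudCoef α β * (t m) ^ (β - α) +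
          α * (1 / (β + 1) - 1 / 2) * (θ ^ (β + 1) * (t m) ^ (-α - 1)) -
          C * ((t m) ^ (β - α) * (t 1 / t m) ^ p)) ≤
        deltaL1 α t (fun j => cutPow θ β (t j)) m := by
  obtain ⟨C, hC, hker⟩ := exists_kernel_majorant (b := β) (p := p) hα₀ hα₁ hr hκ (by linarith)
    hpb hpr
  have hββ : 0 ≤ β * (β - 1) := by nlinarith
  refine ⟨α * (β * (β - 1) / 2 * C), by positivity, fun T M t ht hq m h1 hm θ hθ1 hθm => ?_⟩
  obtain ⟨Ψ, hΨi, hΨn, hΨb, hΨI⟩ := hker T M t ht hq m h1 hm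
  have hτ := ht.pos' le_rfl (h1.trans hm)
  have hθ : 0 < θ := hτ.trans_le hθ1
  set c := t m with hcdef
  have hc : 0 < c := hθ.trans_le hθm
  -- The amount by which the cutoff lowers `s^β`. It enlarges `c^β - cutPow`, and its integral over
  -- `[0, θ]` provides the positive term with `1/(β + 1) - 1/2`.
  set P : ℝ → ℝ := fun s => max (s ^ β - θ ^ (β - 1) * s) 0 with hP
  have hI0 : ∀ b, IntervalIntegrable (fun s : ℝ => s ^ β - θ ^ (β - 1) * s) volume 0 b := fun b =>
    (intervalIntegral.intervalIntegrable_rpow' (by linarith)).sub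
      (Continuous.intervalIntegrable (by fun_prop) _ _)
  have hPi : ∀ a b, 0 ≤ a → 0 ≤ b → IntervalIntegrable P volume a b := fun a b ha hb => by
    have h := (hI0 a).symm.trans (hI0 b)
    exact ⟨h.1.pos_part, h.2.pos_part⟩
  have hPI : (1 / (β + 1) - 1 / 2) * θ ^ (β + 1) ≤ ∫ s in (0 : ℝ)..c, P s := by
    rw [← intervalIntegral.integral_add_adjacent_intervals (hPi 0 θ le_rfl hθ.le)
      (hPi θ c hθ.le hc.le)]
    have e1 : 0 ≤ ∫ s in θ..c, P s :=
      intervalIntegral.integral_nonneg hθm fun s _ => le_max_right _ _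
    have e2 : ∫ s in (0 : ℝ)..θ, (s ^ β - θ ^ (β - 1) * s) ≤ ∫ s in (0 : ℝ)..θ, P s :=
      intervalIntegral.integral_mono_on hθ.le (hI0 θ) (hPi 0 θ le_rfl hθ.le)
        fun s _ => le_max_left _ _
    have e3 : ∫ s in (0 : ℝ)..θ, (s ^ β - θ ^ (β - 1) * s) =
        (1 / (β + 1) - 1 / 2) * θ ^ (β + 1) := by
      rw [intervalIntegral.integral_sub (intervalIntegral.intervalIntegrable_rpow' (by linarith))
        (Continuous.intervalIntegrable (by fun_prop) _ _), integral_rpow (Or.inl (by linarith)),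
        intervalIntegral.integral_const_mul, integral_id, Real.zero_rpow (by linarith),
        Real.rpow_add_one hθ.ne', Real.rpow_sub_one hθ.ne']
      have : β + 1 ≠ 0 := by linarith
      field_simp
      ring
    linarith
  have hki := intervalIntegrable_kernel_rpow hα₁ hβ0 (by linarith) hc
  have hfull : IntervalIntegrable (fun s => (c - s) ^ (-α - 1) * (c ^ β - s ^ β) +
      c ^ (-α - 1) * P s - β * (β - 1) / 2 * Ψ s) volume 0 c :=
    (hki.add ((hPi 0 c le_rfl hc.le).const_mul _)).sub (hΨi.const_mul _)
  -- The lower bound for `c^β` minus the interpolant. In front of `P` the kernel is replaced by its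
  -- smaller value `c^{-α-1}`; in front of `Ψ` it is cancelled, because `Ψ` contains it already.
  set g : ℝ → ℝ := fun s => c ^ β - s ^ β + (c - s) ^ (α + 1) * (c ^ (-α - 1) * P s) -
    (c - s) ^ (α + 1) * (β * (β - 1) / 2 * Ψ s) with hg
  have hae : (fun s => (c - s) ^ (-α - 1) * (c ^ β - s ^ β) +
      c ^ (-α - 1) * P s - β * (β - 1) / 2 * Ψ s) =ᵐ[volume.restrict (uIoc 0 c)]
      fun s => (c - s) ^ (-α - 1) * g s := by
    filter_upwards [ae_restrict_mem measurableSet_uIoc,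
      ae_restrict_of_ae (compl_mem_ae_iff.mpr (measure_singleton c))] with s hs hsc
    rw [uIoc_of_le hc.le] at hs
    have hpos : 0 < c - s := sub_pos.mpr (lt_of_le_of_ne hs.2 hsc)
    have hone : (c - s) ^ (-α - 1) * (c - s) ^ (α + 1) = 1 := by
      rw [← Real.rpow_add hpos, show -α - 1 + (α + 1) = 0 by ring, Real.rpow_zero]
    simp only [hg]
    linear_combination (-(c ^ (-α - 1) * P s) + β * (β - 1) / 2 * Ψ s) * hone
  have hmain := deltaL1_ge_marchaud hα₀ hα₁ ht h1 hm (fun j => cutPow θ β (t j)) g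
    (hfull.congr_ae hae) (fun j hj s hs => ?_)
  · rw [← intervalIntegral.integral_congr_ae_restrict hae, intervalIntegral.integral_sub
      (hki.add ((hPi 0 c le_rfl hc.le).const_mul _)) (hΨi.const_mul _),
      intervalIntegral.integral_add hki ((hPi 0 c le_rfl hc.le).const_mul _),
      intervalIntegral.integral_const_mul, intervalIntegral.integral_const_mul, ht.zero,
      cutPow_zero θ hβ0, ← hcdef, cutPow_of_ge hβ0 hθ hθm, sub_zero] at hmain
    refine le_trans (mul_le_mul_of_nonneg_left ?_ (gammaInv_pos hα₁).le) hmain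
    have hmr := marchaud_rpow (α := α) (β := β) hc
    have hcp : 0 < c ^ (-α - 1) := Real.rpow_pos_of_pos hc _
    have e1 := mul_le_mul_of_nonneg_left hPI (mul_nonneg hα₀.le hcp.le)
    have e2 := mul_le_mul_of_nonneg_left hΨI
      (mul_nonneg hα₀.le (by positivity : 0 ≤ β * (β - 1) / 2))
    rw [← hmr]
    linarith
  · have hj' := Finset.mem_Icc.mp hj
    have hjM := hj'.2.trans hm
    have hjm : t j ≤ c := ht.le hj'.2 hm
    have hst : 0 < c - s := by linarith [hs.2]
    have hs0 : 0 < s := (ht.nonneg (j := j - 1) (by omega)).trans_lt hs.1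
    have hsm : s ∈ Ioo 0 c := ⟨hs0, by linarith⟩
    have hpw : 0 < (c - s) ^ (α + 1) := Real.rpow_pos_of_pos hst _
    have hratio : (c - s) ^ (α + 1) * (c ^ (-α - 1) * P s) ≤ P s := by
      have e1 : (c - s) ^ (α + 1) * c ^ (-α - 1) ≤ 1 := by
        rw [show -α - 1 = -(α + 1) by ring, Real.rpow_neg hc.le, ← div_eq_mul_inv,
          div_le_one (Real.rpow_pos_of_pos hc _)]
        exact Real.rpow_le_rpow hst.le (by linarith) (by linarith)
      rw [← mul_assoc]
      exact mul_le_of_le_one_left (le_max_right _ _) e1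
    have hcut : s ^ β - P s = cutPow θ β s := by
      simp only [hP, cutPow]
      rcases le_total (s ^ β - θ ^ (β - 1) * s) 0 with h | h
      · rw [max_eq_right h, min_eq_right (by linarith), sub_zero]
      · rw [max_eq_left h, min_eq_left (by linarith)]; ring
    have hΨs : 0 ≤ (c - s) ^ (α + 1) * (β * (β - 1) / 2 * Ψ s) :=
      mul_nonneg hpw.le (mul_nonneg (by positivity) (hΨn s hsm))
    have hchord : cutPow θ β (t j) + (cutPow θ β (t j) - cutPow θ β (t (j - 1))) /
        (t j - t (j - 1)) * (s - t j) ≤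
        cutPow θ β s + (c - s) ^ (α + 1) * (β * (β - 1) / 2 * Ψ s) := by
      rcases hj'.1.eq_or_lt with h1j | h1j
      -- On the first interval `t_1 ≤ θ`, so the function is linear there and equals its chord.
      · subst h1j
        simp only [Nat.sub_self, ht.zero, sub_zero] at hs ⊢
        rw [cutPow_zero θ hβ0, cutPow_of_le hβ0 hτ.le hθ1,
          cutPow_of_le hβ0 hs0.le (hs.2.le.trans hθ1)]
        have : θ ^ (β - 1) * t 1 + (θ ^ (β - 1) * t 1 - 0) / t 1 * (s - t 1) = θ ^ (β - 1) * s := by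
          field_simp; ring
        rw [this]
        linarith
      · have ha := ht.pos' (by omega : 1 ≤ j - 1) (by omega : j - 1 ≤ M)
        have e1 := chord_sub_le_of_concaveOn (ht.lt (by omega) hjM)
          (concaveOn_cutPow (θ := θ) hβ0 ha) hs
        have e2 := mul_le_mul_of_nonneg_left (hΨb j h1j hj'.2 s hs)
          (mul_nonneg hpw.le (by positivity : 0 ≤ β * (β - 1) / 2))
        have hone : (c - s) ^ (-α - 1) * (c - s) ^ (α + 1) = 1 := by
          rw [← Real.rpow_add hst, show -α - 1 + (α + 1) = 0 by ring, Real.rpow_zero]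
        have e3 : (c - s) ^ (α + 1) * (β * (β - 1) / 2) * ((t j - s) * (s - t (j - 1)) *
            (t (j - 1)) ^ (β - 2) * (c - s) ^ (-α - 1)) =
            β * (β - 1) * (t (j - 1)) ^ (β - 2) / 2 * ((t j - s) * (s - t (j - 1))) := by
          linear_combination (β * (β - 1) * (t (j - 1)) ^ (β - 2) / 2 *
            ((t j - s) * (s - t (j - 1)))) * hone
        linarith
    have hVm : cutPow θ β (t m) = c ^ β := cutPow_of_ge hβ0 hθ hθm
    simp only [hg, hVm]
    linarith

end Barrier

/-! ### Barriers on fine quasi-graded meshes, with the reaction term -/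

section Barrier

variable {α T r κ lam : ℝ} {M : ℕ} {t : ℕ → ℝ}

/-- On all sufficiently fine quasi-graded meshes there is a nonnegative mesh function `W = O(t^β)`
with `W^0 = 0` and `(δ_t^α - lam) W^m ≥ F(t_1, t_m)`. -/
def HasBarrier (α T r κ lam : ℝ) (F : ℝ → ℝ → ℝ) (β : ℝ) : Prop :=
  ∃ C : ℝ, 0 ≤ C ∧ ∃ M₀ : ℕ, ∀ M, M₀ ≤ M → ∀ t : ℕ → ℝ, IsTimeMesh T M t → IsQuasiGraded r κ M t →
    ∃ W : ℕ → ℝ, W 0 = 0 ∧ ∀ m, 1 ≤ m → m ≤ M →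
      0 ≤ W m ∧ W m ≤ C * (t m) ^ β ∧ F (t 1) (t m) ≤ deltaL1 α t W m - lam * W m

theorem exists_step_le (hr : 1 ≤ r) (hκ : 0 < κ) {δ : ℝ} (hδ : 0 < δ) :
    ∃ M₀ : ℕ, ∀ M, M₀ ≤ M → ∀ t : ℕ → ℝ, IsTimeMesh T M t → IsQuasiGraded r κ M t →
      ∀ j ∈ Finset.Icc 1 M, t j - t (j - 1) ≤ δ := by
  obtain ⟨M₀, hM₀⟩ := exists_nat_ge (κ * κ ^ (1 / r) * T ^ (1 - 1 / r) / δ)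
  refine ⟨M₀, fun M hM t ht hq j hj => (hq.step_le j hj).trans ?_⟩
  have hj' := Finset.mem_Icc.mp hj
  have hM1 : (0 : ℝ) < M := by exact_mod_cast ht.pos
  have hr0 : 0 < r := by linarith
  have h1r : 1 / r ≤ 1 := (div_le_one hr0).mpr hr
  have e1 : (t 1) ^ (1 / r) ≤ κ ^ (1 / r) * (M : ℝ)⁻¹ := by
    refine (Real.rpow_le_rpow (ht.pos' le_rfl ht.pos).le hq.first_le (by positivity)).trans ?_
    rw [Real.mul_rpow hκ.le (by positivity), ← Real.rpow_mul hM1.le,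
      show -r * (1 / r) = -1 by field_simp, Real.rpow_neg_one]
  have e2 : (t j) ^ (1 - 1 / r) ≤ T ^ (1 - 1 / r) :=
    Real.rpow_le_rpow (ht.nonneg hj'.2) (ht.le_final hj'.2) (by linarith)
  calc κ * t 1 ^ (1 / r) * t j ^ (1 - 1 / r)
      ≤ κ * (κ ^ (1 / r) * (M : ℝ)⁻¹) * T ^ (1 - 1 / r) := by
        have := ht.nonneg hj'.2
        gcongr
    _ = κ * κ ^ (1 / r) * T ^ (1 - 1 / r) / M := by ring
    _ ≤ δ := by
        rw [div_le_iff₀ hM1, mul_comm δ]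
        have : (M₀ : ℝ) ≤ M := by exact_mod_cast hM
        exact (div_le_iff₀ hδ).mp (hM₀.trans this)

/-- The barrier is `2Γ(1 - α)` times `V = e^{μt} t^β`. With `μ^α` large compared with `λ`,
`deltaL1_exp_ge` gives `δ_t^α V ≥ (2λ + 1)V`, so half of `δ_t^α W` absorbs `λW`; the other half
dominates `s^{β-α}` by `deltaL1_ge_of_monotone`. The restriction `μτ_j ≤ 1` is what requires a fine
mesh. -/
theorem hasBarrier_of_nonneg (hα₀ : 0 < α) (hα₁ : α < 1) (hr : 1 ≤ r) (hκ : 0 < κ)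
    (hlam : 0 ≤ lam) {β : ℝ} (hβ : 0 ≤ β) :
    HasBarrier α T r κ lam (fun _ s => s ^ (β - α)) β := by
  have hG := Real.Gamma_pos_of_pos (show 0 < 1 - α by linarith)
  have he : 0 < 1 - Real.exp (-1) := by
    have := Real.exp_lt_exp.mpr (show (-1 : ℝ) < 0 by norm_num)
    rw [Real.exp_zero] at this
    linarith
  set q := Real.Gamma (1 - α) * (2 * lam + 1) / (1 - Real.exp (-1)) with hq
  have hq0 : 0 < q := by positivity
  set μ := 2 * q ^ (1 / α) with hμ
  have hμ0 : 0 < μ := by positivity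
  have hμq : (μ / 2) ^ α = q := by
    rw [hμ, mul_div_cancel_left₀ _ (two_ne_zero), ← Real.rpow_mul hq0.le,
      one_div_mul_cancel hα₀.ne', Real.rpow_one]
  obtain ⟨M₀, hM₀⟩ := exists_step_le hr hκ (inv_pos.mpr hμ0)
  refine ⟨2 * Real.Gamma (1 - α) * Real.exp (μ * T), by positivity, M₀, fun M hM t ht hqg => ?_⟩
  -- The value at `j = 0` is prescribed because `0^β = 1` for `β = 0`, while a barrier has to start
  -- from `0`.
  set X : ℕ → ℝ := fun j => if j = 0 then 0 else (t j) ^ β with hX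
  have hX0 : X 0 = 0 := by simp [hX]
  have hXpos : ∀ j, 1 ≤ j → X j = (t j) ^ β := fun j hj => if_neg (by omega)
  have hXnn : ∀ j ≤ M, 0 ≤ X j := fun j hj => by
    simp only [hX]; split_ifs
    · exact le_rfl
    · exact Real.rpow_nonneg (ht.nonneg hj) _
  have hXm : ∀ j ∈ Finset.Icc 1 M, X (j - 1) ≤ X j := fun j hj => by
    obtain ⟨h1, h2⟩ := Finset.mem_Icc.mp hj
    rcases Nat.eq_zero_or_pos (j - 1) with h0 | h0
    · rw [h0, hX0]; exact hXnn j h2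
    · rw [hXpos _ h0, hXpos _ h1]
      exact Real.rpow_le_rpow (ht.nonneg (by omega)) (ht.le (by omega) h2) hβ
  refine ⟨fun j => 2 * Real.Gamma (1 - α) * (Real.exp (μ * t j) * X j), by simp [hX0],
    fun m h1 hm => ?_⟩
  have htm := ht.pos' h1 hm
  have hsub : ∀ j ∈ Finset.Icc 1 m, j ∈ Finset.Icc 1 M := fun j hj =>
    Finset.Icc_subset_Icc_right hm hj
  have hA := deltaL1_exp_ge hα₀ hα₁ ht hm hμ0 (hM₀ M hM t ht hqg) hX0 fun j hj => hXm j (hsub j hj)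
  have hB := deltaL1_ge_of_monotone hα₀ hα₁ ht hm (V := fun j => Real.exp (μ * t j) * X j)
    fun j hj => by
      obtain ⟨h1', h2'⟩ := Finset.mem_Icc.mp (hsub j hj)
      have := hXnn (j - 1) (by omega)
      have := hXm j (hsub j hj)
      have := ht.le (show j - 1 ≤ j by omega) h2'
      gcongr
  rw [hμq] at hA
  simp only [hX0, mul_zero, sub_zero] at hB
  have hV1 : 1 ≤ Real.exp (μ * t m) := Real.one_le_exp (by positivity)
  have hXmm : X m = (t m) ^ β := hXpos m h1
  have hVn : 0 ≤ Real.exp (μ * t m) * X m := mul_nonneg (by positivity) (hXnn m hm)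
  refine ⟨mul_nonneg (by positivity) hVn, ?_, ?_⟩
  · dsimp only
    rw [hXmm, ← mul_assoc]
    gcongr
    exact ht.le_final hm
  · rw [deltaL1_smul]
    set V := Real.exp (μ * t m) * X m
    set D := deltaL1 α t (fun j => Real.exp (μ * t j) * X j) m
    have hA' : (2 * lam + 1) * V ≤ D := by
      refine le_trans (le_of_eq ?_) hA
      rw [hq]; field_simp
    have hB' : (t m) ^ (β - α) ≤ Real.Gamma (1 - α) * D := by
      rw [← div_le_iff₀' hG, div_eq_inv_mul]
      refine le_trans ?_ hB
      refine mul_le_mul_of_nonneg_left ?_ (inv_pos.mpr hG).le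
      rw [show β - α = -α + β by ring, Real.rpow_add htm, ← hXmm]
      exact mul_le_mul_of_nonneg_left (le_mul_of_one_le_left (hXnn m hm) hV1)
        (Real.rpow_nonneg htm.le _)
    nlinarith [mul_le_mul_of_nonneg_left hA' hG.le, mul_nonneg hG.le hVn]

/-- The reaction term can be absorbed by a barrier with a larger exponent. -/
theorem HasBarrier.add_reaction (hT : 0 < T) (hlam : 0 ≤ lam) {F : ℝ → ℝ → ℝ} {β : ℝ}
    (hα₀ : 0 < α) (h : HasBarrier α T r κ 0 F β)
    (h' : HasBarrier α T r κ lam (fun _ s => s ^ (β + α - α)) (β + α)) :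
    HasBarrier α T r κ lam F β := by
  obtain ⟨C, hC, M₁, H⟩ := h
  obtain ⟨C', hC', M₂, H'⟩ := h'
  refine ⟨C + lam * C * (C' * T ^ α), by positivity, max M₁ M₂, fun M hM t ht hq => ?_⟩
  obtain ⟨B, hB0, hB⟩ := H M ((le_max_left _ _).trans hM) t ht hq
  obtain ⟨W, hW0, hW⟩ := H' M ((le_max_right _ _).trans hM) t ht hq
  -- The residual of the second barrier is at least `t_m^β` and pays for `λB ≤ λC t_m^β`; its size
  -- `t_m^{β+α}` is at most `T^α t_m^β`.
  refine ⟨fun j => B j + lam * C * W j, by simp [hB0, hW0], fun m h1 hm => ?_⟩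
  obtain ⟨b1, b2, b3⟩ := hB m h1 hm
  obtain ⟨w1, w2, w3⟩ := hW m h1 hm
  have htm := ht.pos' h1 hm
  refine ⟨by positivity, ?_, ?_⟩
  · have : W m ≤ C' * T ^ α * (t m) ^ β := by
      refine w2.trans ?_
      rw [Real.rpow_add htm, mul_comm ((t m) ^ β), ← mul_assoc]
      have := Real.rpow_le_rpow htm.le (ht.le_final hm) hα₀.le
      gcongr
    have := mul_le_mul_of_nonneg_left this (mul_nonneg hlam hC)
    linarith
  · rw [deltaL1_add, deltaL1_smul]
    rw [add_sub_cancel_right] at w3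
    have h3 := mul_le_mul_of_nonneg_left w3 (mul_nonneg hlam hC)
    have h4 := mul_le_mul_of_nonneg_left b2 hlam
    linarith

theorem deltaL1_cutPow_nonneg (hα₁ : α < 1) (ht : IsTimeMesh T M t) {m : ℕ}
    (hm : m ≤ M) {θ β : ℝ} (hβ : β < 0) (hθ0 : 0 < θ) (hθ : t m ≤ θ) :
    0 ≤ deltaL1 α t (fun j => cutPow θ β (t j)) m := by
  rw [deltaL1_cutPow_of_le hα₁ ht hm hβ hθ]
  have := gammaInv_pos hα₁
  have := ht.nonneg hm
  have : 0 < 1 - α := by linarith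
  positivity

theorem deltaL1_cutPow_ge_of_le (hα₀ : 0 < α) (hα₁ : α < 1) (ht : IsTimeMesh T M t) {m : ℕ}
    (h1 : 1 ≤ m) (hm : m ≤ M) {N β : ℝ} (hβ : β < 0) (hN : 0 < N) (hθ : t m ≤ N * t 1) :
    (Real.Gamma (1 - α))⁻¹ * (N ^ (β - 1) * (t m) ^ (β - α)) ≤
      deltaL1 α t (fun j => cutPow (N * t 1) β (t j)) m := by
  rw [deltaL1_cutPow_of_le hα₁ ht hm hβ hθ]
  have hG := gammaInv_pos hα₁
  have htm := ht.pos' h1 hm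
  have ht1 := ht.pos' le_rfl (h1.trans hm)
  have e1 : N ^ (β - 1) * (t m) ^ (β - 1) ≤ (N * t 1) ^ (β - 1) := by
    rw [← Real.mul_rpow hN.le htm.le]
    exact Real.rpow_le_rpow_of_nonpos (by positivity)
      (mul_le_mul_of_nonneg_left (ht.le h1 hm) hN.le) (by linarith)
  have e2 : (t m) ^ (1 - α) ≤ (t m) ^ (1 - α) / (1 - α) :=
    le_div_self (by positivity) (by linarith) (by linarith)
  refine mul_le_mul_of_nonneg_left ?_ hG.le
  calc N ^ (β - 1) * (t m) ^ (β - α) = N ^ (β - 1) * (t m) ^ (β - 1) * (t m) ^ (1 - α) := by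
        rw [mul_assoc, ← Real.rpow_add htm]; ring_nf
    _ ≤ _ := mul_le_mul e1 e2 (by positivity) (by positivity)

/-- The cutoff is put at `N τ`. For `t_m ≥ Nτ` the relative discretisation error is at most a
constant times `N^{-p}`, and a large `N` makes it at most half of the positive Marchaud coefficient.
For `t_m ≤ Nτ` the function is linear and `δ_t^α` is explicit. -/
theorem hasBarrier_zero_of_neg (hα₀ : 0 < α) (hα₁ : α < 1) (hr : 1 ≤ r) (hκ : 0 < κ) {β : ℝ}
    (hβ : α - 1 < β) (hβ0 : β < 0) : HasBarrier α T r κ 0 (fun _ s => s ^ (β - α)) β := by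
  have hr0 : 0 < r := by linarith
  have hJ := marchaudCoef_pos hα₀ hα₁ hβ hβ0
  set J := marchaudCoef α β
  set p := min ((1 + β) / 2) ((2 - α) / r) with hp
  have hp0 : 0 < p := lt_min (by linarith) (div_pos (by linarith) hr0)
  obtain ⟨C, hC, H⟩ := exists_deltaL1_cutPow_ge hα₀ hα₁ hr hκ hβ.le hβ0
    (p := p) ((min_le_left _ _).trans_lt (by linarith)) (min_le_right _ _)
  set N := max 1 ((2 * C / J) ^ (1 / p)) with hN
  have hN1 : 1 ≤ N := le_max_left _ _
  have hN0 : 0 < N := by linarith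
  have hNp : C * (1 / N) ^ p ≤ J / 2 := by
    have : 2 * C / J ≤ N ^ p := by
      calc 2 * C / J = ((2 * C / J) ^ (1 / p)) ^ p := by
            rw [← Real.rpow_mul (by positivity), one_div_mul_cancel hp0.ne', Real.rpow_one]
        _ ≤ N ^ p := Real.rpow_le_rpow (by positivity) (le_max_right _ _) hp0.le
    rw [Real.div_rpow zero_le_one hN0.le, Real.one_rpow, mul_one_div,
      div_le_iff₀ (Real.rpow_pos_of_pos hN0 _)]
    rw [div_le_iff₀ hJ] at this
    linarith
  set c := (Real.Gamma (1 - α))⁻¹ * min (J / 2) (N ^ (β - 1)) with hc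
  have hG := gammaInv_pos hα₁
  have hc0 : 0 < c := mul_pos hG (lt_min (by positivity) (by positivity))
  refine ⟨c⁻¹, by positivity, 0, fun M _ t ht hq =>
    ⟨fun j => c⁻¹ * cutPow (N * t 1) β (t j), by simp [ht.zero, cutPow_zero _ hβ0], fun m h1 hm => ?_⟩⟩
  have htm := ht.pos' h1 hm
  have ht1 := ht.pos' le_rfl (h1.trans hm)
  have hθ0 : 0 < N * t 1 := by positivity
  refine ⟨mul_nonneg (by positivity) (cutPow_nonneg hθ0 htm.le),
    mul_le_mul_of_nonneg_left (cutPow_le _ _ _) (by positivity), ?_⟩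
  rw [zero_mul, sub_zero, deltaL1_smul, inv_mul_eq_div, le_div_iff₀' hc0]
  have hpow : 0 ≤ (t m) ^ (β - α) := by positivity
  rcases le_total (t m) (N * t 1) with hle | hge
  · refine le_trans ?_ (deltaL1_cutPow_ge_of_le hα₀ hα₁ ht h1 hm hβ0 hN0 hle)
    rw [hc, mul_assoc]
    exact mul_le_mul_of_nonneg_left (mul_le_mul_of_nonneg_right (min_le_right _ _) hpow) hG.le
  · refine le_trans ?_ (H T M t ht hq m h1 hm _ (le_mul_of_one_le_left ht1.le hN1) hge)
    rw [hc, mul_assoc]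
    refine mul_le_mul_of_nonneg_left ?_ hG.le
    have h2 : 0 ≤ α * (1 / (β + 1) - 1 / 2) * ((N * t 1) ^ (β + 1) * (t m) ^ (-α - 1)) := by
      have : 1 / 2 ≤ 1 / (β + 1) := one_div_le_one_div_of_le (by linarith) (by linarith)
      have : 0 ≤ 1 / (β + 1) - 1 / 2 := by linarith
      positivity
    have h3 : C * (t 1 / t m) ^ p ≤ J / 2 := by
      refine le_trans ?_ hNp
      refine mul_le_mul_of_nonneg_left (Real.rpow_le_rpow (by positivity) ?_ hp0.le) hC
      rw [div_le_div_iff₀ htm hN0]; linarith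
    have h4 := mul_le_mul_of_nonneg_right h3 hpow
    have h5 := mul_le_mul_of_nonneg_right (min_le_left (J / 2) (N ^ (β - 1))) hpow
    linarith

/-- Barriers for all noncritical exponents. -/
theorem hasBarrier_rpow (hα₀ : 0 < α) (hα₁ : α < 1) (hr : 1 ≤ r) (hκ : 0 < κ) (hT : 0 < T)
    (hlam : 0 ≤ lam) {β : ℝ} (hβ : α - 1 < β) :
    HasBarrier α T r κ lam (fun _ s => s ^ (β - α)) β := by
  -- Induction on the number of steps of length `α` that lead from `β` to a nonnegative exponent.
  suffices H : ∀ (n : ℕ) (β : ℝ), α - 1 < β → -(n * α) ≤ β →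
      HasBarrier α T r κ lam (fun _ s => s ^ (β - α)) β by
    obtain ⟨n, hn⟩ := exists_nat_ge (-β / α)
    rw [div_le_iff₀ hα₀] at hn
    exact H n β hβ (by linarith)
  intro n
  induction n with
  | zero => exact fun β _ h => hasBarrier_of_nonneg hα₀ hα₁ hr hκ hlam (by simpa using h)
  | succ n ih =>
    intro β hβ h
    rcases le_or_gt 0 β with h0 | h0
    · exact hasBarrier_of_nonneg hα₀ hα₁ hr hκ hlam h0
    · push_cast at h
      exact (hasBarrier_zero_of_neg hα₀ hα₁ hr hκ hβ h0).add_reaction hT hlam hα₀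
        (ih (β + α) (by linarith) (by linarith))

/-- A barrier for the critical exponent `α - 1`. -/
theorem hasBarrier_critical (hα₀ : 0 < α) (hα₁ : α < 1) (hr : 1 ≤ r) (hκ : 0 < κ) (hT : 0 < T)
    (hlam : 0 ≤ lam) {g : ℝ} (hg0 : 0 < g) (hgα : g < α) (hgr : g < (2 - α) / r) :
    HasBarrier α T r κ lam (fun τ s => s⁻¹ * (τ / s) ^ g) (α - 1) := by
  refine HasBarrier.add_reaction hT hlam hα₀ ?_
    (hasBarrier_rpow hα₀ hα₁ hr hκ hT hlam (by linarith))
  obtain ⟨p, hgp, hp⟩ := exists_between (lt_min hgα hgr)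
  have hβ0 : α - 1 < 0 := by linarith
  obtain ⟨C, hC, H⟩ := exists_deltaL1_cutPow_ge hα₀ hα₁ hr hκ le_rfl hβ0
    (p := p) (by linarith [hp.trans_le (min_le_left _ _)]) (hp.le.trans (min_le_right _ _))
  have hG := gammaInv_pos hα₁
  -- The `k`-th cutoff is at `2^k N τ`, with the weight `x^k = 2^{-gk}`. As the Marchaud coefficient
  -- is zero, a single cutoff gains only `θ^α t_m^{-α-1}`, which is of the order `t_m^{-1}` when `θ`
  -- is comparable to `t_m`. The dyadic level just below `t_m` gains this with a weight of at least
  -- `(τ/t_m)^g`; the losses of all levels sum to at most `C S t_m^{-1} (τ/t_m)^p`, which is smaller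
  -- since `p > g` and `N` is large.
  set x : ℝ := 2 ^ (-g) with hx
  have hx0 : 0 < x := by positivity
  have hx1 : x < 1 := Real.rpow_lt_one_of_one_lt_of_neg one_lt_two (by linarith)
  set S := (1 - x)⁻¹ with hS
  have hS0 : 0 < S := inv_pos.mpr (by linarith)
  have hgeo : ∀ I : Finset ℕ, ∑ k ∈ I, x ^ k ≤ S := fun I => by
    rw [hS, ← tsum_geometric_of_lt_one hx0.le hx1]
    exact (summable_geometric_of_lt_one hx0.le hx1).sum_le_tsum I fun k _ => by positivity
  -- The gain of the level with `t_m/2 < θ ≤ t_m`.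
  set a := α * (1 / α - 1 / 2) * 2 ^ (-α) with ha
  have ha0 : 0 < a := by
    have : 1 < 1 / α := (one_lt_div hα₀).mpr hα₁
    have : 0 < 1 / α - 1 / 2 := by linarith
    positivity
  set N := max 1 ((2 * (C * S) / a) ^ (1 / (p - g))) with hN
  have hN1 : 1 ≤ N := le_max_left _ _
  have hN0 : 0 < N := by linarith
  have hpg : 0 < p - g := by linarith
  have hNp : C * S * (1 / N) ^ (p - g) ≤ a / 2 := by
    have : 2 * (C * S) / a ≤ N ^ (p - g) := by
      calc 2 * (C * S) / a = ((2 * (C * S) / a) ^ (1 / (p - g))) ^ (p - g) := by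
            rw [← Real.rpow_mul (by positivity), one_div_mul_cancel hpg.ne', Real.rpow_one]
        _ ≤ _ := Real.rpow_le_rpow (by positivity) (le_max_right _ _) hpg.le
    rw [Real.div_rpow zero_le_one hN0.le, Real.one_rpow, mul_one_div,
      div_le_iff₀ (Real.rpow_pos_of_pos hN0 _)]
    rw [div_le_iff₀ ha0] at this
    linarith
  set c := (Real.Gamma (1 - α))⁻¹ * min (a / 2) (N ^ (α - 1 - 1)) with hc
  have hc0 : 0 < c := mul_pos hG (lt_min (by positivity) (by positivity))
  refine ⟨c⁻¹ * S, by positivity, 0, fun M _ t ht hq => ?_⟩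
  have ht1 := ht.pos' le_rfl ht.pos
  -- Enough dyadic levels to pass `T`. Their number depends on the mesh, but only the geometric sum
  -- enters the constants.
  obtain ⟨L, hL⟩ := pow_unbounded_of_one_lt (T / (N * t 1)) (one_lt_two (α := ℝ))
  have hNt : 0 < N * t 1 := by positivity
  rw [div_lt_iff₀ hNt] at hL
  have hL0 : 0 < L + 1 := by omega
  refine ⟨fun j => c⁻¹ * ∑ k ∈ Finset.range (L + 1), x ^ k * cutPow (2 ^ k * N * t 1) (α - 1) (t j),
    by simp [ht.zero, cutPow_zero _ hβ0], fun m h1 hm => ?_⟩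
  have htm := ht.pos' h1 hm
  have hθ0 : ∀ k : ℕ, 0 < 2 ^ k * N * t 1 := fun k => by positivity
  refine ⟨mul_nonneg (by positivity) (Finset.sum_nonneg fun k _ => mul_nonneg (by positivity)
    (cutPow_nonneg (hθ0 k) htm.le)), ?_, ?_⟩
  · rw [mul_assoc]
    refine mul_le_mul_of_nonneg_left ?_ (by positivity)
    refine le_trans ?_ (mul_le_mul_of_nonneg_right (hgeo (Finset.range (L + 1)))
      (Real.rpow_nonneg htm.le _))
    rw [Finset.sum_mul]
    exact Finset.sum_le_sum fun k _ =>
      mul_le_mul_of_nonneg_left (cutPow_le _ _ _) (by positivity)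
  rw [zero_mul, sub_zero, deltaL1_smul, inv_mul_eq_div, le_div_iff₀' hc0, deltaL1_sum]
  simp only [deltaL1_smul]
  have hq0 : 0 < t 1 / t m := by positivity
  have hq1 : t 1 / t m ≤ 1 := (div_le_one htm).mpr (ht.le h1 hm)
  have hF0 : 0 ≤ (t m)⁻¹ * (t 1 / t m) ^ g := by positivity
  rcases le_total (t m) (N * t 1) with hle | hge
  · have hnn : ∀ k ∈ Finset.range (L + 1), 0 ≤ x ^ k *
        deltaL1 α t (fun j => cutPow (2 ^ k * N * t 1) (α - 1) (t j)) m := fun k _ => by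
      refine mul_nonneg (by positivity)
        (deltaL1_cutPow_nonneg hα₁ ht hm hβ0 (hθ0 k) (hle.trans ?_))
      rw [mul_assoc]
      exact le_mul_of_one_le_left hNt.le (one_le_pow₀ one_le_two)
    refine le_trans ?_ (Finset.single_le_sum hnn (Finset.mem_range.mpr hL0))
    simp only [pow_zero, one_mul]
    refine le_trans ?_ (deltaL1_cutPow_ge_of_le hα₀ hα₁ ht h1 hm hβ0 hN0 hle)
    rw [hc, mul_assoc]
    refine mul_le_mul_of_nonneg_left ?_ hG.le
    rw [show α - 1 - α = -1 by ring, Real.rpow_neg_one]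
    refine mul_le_mul (min_le_right _ _) ?_ hF0 (by positivity)
    exact mul_le_of_le_one_right (by positivity) (Real.rpow_le_one hq0.le hq1 hg0.le)
  -- The level `n` with `2^n N τ ≤ t_m < 2^{n+1} N τ`.
  · obtain ⟨n, hn1, hn2⟩ := exists_nat_pow_near ((one_le_div hNt).mpr hge) one_lt_two
    rw [le_div_iff₀ hNt, ← mul_assoc] at hn1
    rw [div_lt_iff₀ hNt, ← mul_assoc] at hn2
    have hnL : n < L + 1 := by
      have : (2 : ℝ) ^ n < 2 ^ L := by
        have h5 : (2 : ℝ) ^ n * N * t 1 < 2 ^ L * (N * t 1) :=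
          hn1.trans_lt ((ht.le_final hm).trans_lt hL)
        rw [mul_assoc] at h5
        exact lt_of_mul_lt_mul_right h5 hNt.le
      exact ((pow_lt_pow_iff_right₀ one_lt_two).mp this).trans (by omega)
    have hterm : ∀ k, (Real.Gamma (1 - α))⁻¹ * (x ^ k * ((if k = n then a * (t m)⁻¹ else 0) -
        C * ((t m)⁻¹ * (t 1 / t m) ^ p))) ≤
        x ^ k * deltaL1 α t (fun j => cutPow (2 ^ k * N * t 1) (α - 1) (t j)) m := by
      intro k
      rw [mul_left_comm]
      refine mul_le_mul_of_nonneg_left ?_ (by positivity)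
      have hE : 0 ≤ C * ((t m)⁻¹ * (t 1 / t m) ^ p) := by positivity
      rcases le_or_gt (2 ^ k * N * t 1) (t m) with hk | hk
      · refine le_trans ?_ (H T M t ht hq m h1 hm _ ?_ hk)
        · rw [marchaudCoef_critical hα₀ hα₁, zero_mul, zero_add, show α - 1 - α = -1 by ring,
            Real.rpow_neg_one, show α - 1 + 1 = α by ring]
          refine mul_le_mul_of_nonneg_left (sub_le_sub_right ?_ _) hG.le
          have h6 : 1 < 1 / α := (one_lt_div hα₀).mpr hα₁
          have h7 : 0 < 1 / α - 1 / 2 := by linarith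
          split_ifs with hkn
          · subst hkn
            rw [ha, mul_assoc]
            refine mul_le_mul_of_nonneg_left ?_ (by positivity)
            rw [show -α - 1 = -α + -1 by ring, Real.rpow_add htm, Real.rpow_neg_one, ← mul_assoc]
            refine mul_le_mul_of_nonneg_right ?_ (by positivity)
            rw [Real.rpow_neg htm.le, ← div_eq_mul_inv, ← Real.div_rpow (hθ0 k).le htm.le,
              Real.rpow_neg two_pos.le, ← Real.inv_rpow two_pos.le]
            refine Real.rpow_le_rpow (by positivity) ?_ hα₀.le
            rw [inv_eq_one_div, div_le_div_iff₀ two_pos htm]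
            rw [pow_succ] at hn2
            linarith
          · have := hθ0 k
            positivity
        · rw [mul_assoc]
          exact (le_mul_of_one_le_left ht1.le hN1).trans
            (le_mul_of_one_le_left hNt.le (one_le_pow₀ one_le_two))
      · refine le_trans ?_ (deltaL1_cutPow_nonneg hα₁ ht hm hβ0 (hθ0 k) hk.le)
        split_ifs with hkn
        · subst hkn
          exact absurd hk hn1.not_gt
        · exact mul_nonpos_of_nonneg_of_nonpos hG.le (by linarith)
    refine le_trans ?_ (Finset.sum_le_sum fun k _ => hterm k)
    rw [← Finset.mul_sum, hc, mul_assoc]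
    refine mul_le_mul_of_nonneg_left ?_ hG.le
    simp only [mul_sub, Finset.sum_sub_distrib]
    simp only [mul_ite, mul_zero, Finset.sum_ite_eq', Finset.mem_range, if_pos hnL]
    rw [← Finset.sum_mul]
    have hxn : (t 1 / t m) ^ g ≤ x ^ n := by
      rw [hx, ← Real.rpow_natCast, ← Real.rpow_mul two_pos.le, mul_comm, Real.rpow_mul two_pos.le,
        Real.rpow_natCast, Real.rpow_neg (by positivity), ← Real.inv_rpow (by positivity)]
      refine Real.rpow_le_rpow hq0.le ?_ hg0.le
      rw [inv_eq_one_div, div_le_div_iff₀ htm (by positivity), one_mul]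
      refine le_trans ?_ hn1
      rw [mul_comm, mul_assoc]
      exact mul_le_mul_of_nonneg_left (le_mul_of_one_le_left ht1.le hN1) (by positivity)
    have hqp : C * S * (t 1 / t m) ^ p ≤ a / 2 * (t 1 / t m) ^ g := by
      have h8 : (t 1 / t m) ^ p = (t 1 / t m) ^ (p - g) * (t 1 / t m) ^ g := by
        rw [← Real.rpow_add hq0]; ring_nf
      rw [h8, ← mul_assoc]
      refine mul_le_mul_of_nonneg_right (le_trans ?_ hNp) (by positivity)
      refine mul_le_mul_of_nonneg_left (Real.rpow_le_rpow hq0.le ?_ hpg.le) (by positivity)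
      rw [div_le_div_iff₀ htm hN0]; linarith
    have htinv : 0 ≤ (t m)⁻¹ := by positivity
    have h9 := mul_le_mul_of_nonneg_right (hgeo (Finset.range (L + 1)))
      (show 0 ≤ C * ((t m)⁻¹ * (t 1 / t m) ^ p) by positivity)
    have h10 := mul_le_mul_of_nonneg_right hqp htinv
    have h11 := mul_le_mul_of_nonneg_right hxn (mul_nonneg ha0.le htinv)
    have h12 := mul_le_mul_of_nonneg_right (min_le_left (a / 2) (N ^ (α - 1 - 1))) hF0
    nlinarith

end Barrier

/-! ### A Sobolev inequality for finite element functions -/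

namespace Triangulation

variable {Ω : Set (Sp d)} (𝒯 : Triangulation Ω)

theorem interp_sub_eq_inner {s : Finset (Sp d)} (hs : s ∈ 𝒯.cells) (v : Sp d → ℝ) {x y : Sp d}
    (hx : x ∈ convexHull ℝ (s : Set (Sp d))) (hy : y ∈ convexHull ℝ (s : Set (Sp d))) :
    𝒯.interp v x - 𝒯.interp v y = Inner.inner ℝ (𝒯.cellGrad s v) (x - y) := by
  simp only [interp, cellGrad, sum_inner, inner_smul_left, ← Finset.sum_sub_distrib,
    InnerProductSpace.toDual_symm_apply, LinearMap.coe_toContinuousLinearMap', ← mul_sub]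
  refine Finset.sum_congr rfl fun z _ => ?_
  rw [𝒯.hat_eq_hatAffine hs z hx, 𝒯.hat_eq_hatAffine hs z hy, ← vsub_eq_sub x y,
    AffineMap.linearMap_vsub]
  simp

/-- The size of the gradient of a finite element function, raised by `c`, on the cells in `A`. -/
def gradMajorant (A : Finset (Finset (Sp d))) (v : Sp d → ℝ) (c : ℝ) (x : Sp d) : ℝ≥0∞ :=
  ∑ s ∈ A, (convexHull ℝ (s : Set (Sp d))).indicator
    (fun _ => ENNReal.ofReal (‖𝒯.cellGrad s v‖ + c)) x

theorem measurable_gradMajorant (A : Finset (Finset (Sp d))) (v : Sp d → ℝ) (c : ℝ) :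
    Measurable (𝒯.gradMajorant A v c) :=
  Finset.measurable_fun_sum _ fun s _ =>
    measurable_const.indicator (isCompact_cell s).isClosed.measurableSet

theorem lintegral_gradMajorant (A : Finset (Finset (Sp d))) (v : Sp d → ℝ) (c : ℝ) :
    ∫⁻ x, 𝒯.gradMajorant A v c x = ∑ s ∈ A, ENNReal.ofReal (‖𝒯.cellGrad s v‖ + c) *
      volume (convexHull ℝ (s : Set (Sp d))) := by
  simp only [gradMajorant]
  rw [lintegral_finsetSum _ fun s _ =>
    measurable_const.indicator (isCompact_cell s).isClosed.measurableSet]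
  exact Finset.sum_congr rfl fun s _ =>
    lintegral_indicator_const (isCompact_cell s).isClosed.measurableSet _

theorem le_gradMajorant {A : Finset (Finset (Sp d))} (v : Sp d → ℝ) (c : ℝ)
    {s : Finset (Sp d)} (hs : s ∈ A) {x : Sp d} (hx : x ∈ convexHull ℝ (s : Set (Sp d))) :
    ENNReal.ofReal (‖𝒯.cellGrad s v‖ + c) ≤ 𝒯.gradMajorant A v c x := by
  refine le_trans ?_ (Finset.single_le_sum (fun _ _ => zero_le) hs)
  rw [indicator_of_mem hx]

theorem gradMajorant_lt_top (A : Finset (Finset (Sp d))) (v : Sp d → ℝ) (c : ℝ) :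
    ∃ B : ℝ, ∀ x, 𝒯.gradMajorant A v c x ≤ ENNReal.ofReal B := by
  refine ⟨∑ s ∈ A, |‖𝒯.cellGrad s v‖ + c|, fun x => ?_⟩
  rw [ENNReal.ofReal_sum_of_nonneg fun _ _ => abs_nonneg _]
  refine Finset.sum_le_sum fun s _ => ?_
  refine (indicator_le_self _ _ _).trans (ENNReal.ofReal_le_ofReal (le_abs_self _))

/-- A finite element function is bounded by the integral of its gradient along a coordinate
line. -/
theorem enorm_le_lintegral_line (hΩb : Bornology.IsBounded Ω) {v : Sp d → ℝ}
    (hv : v ∈ 𝒯.feSpace) {A : Finset (Finset (Sp d))}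
    (hA : ∀ s ∈ 𝒯.cells, s ∉ A → ∀ z ∈ s, v z = 0) {c : ℝ} (hc : 0 ≤ c) (x : Fin d → ℝ)
    (i : Fin d) : ‖v (WithLp.toLp 2 x)‖ₑ ≤
      ∫⁻ ξ, 𝒯.gradMajorant A v c (WithLp.toLp 2 (Function.update x i ξ)) := by
  set ℓ : ℝ → Sp d := fun ξ => WithLp.toLp 2 (Function.update x i ξ) with hℓ
  set e : Sp d := EuclideanSpace.single i 1 with he
  have he1 : ‖e‖ = 1 := by simp [he]
  have hsub : ∀ ξ ξ', ℓ ξ - ℓ ξ' = (ξ - ξ') • e := fun ξ ξ' => by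
    ext j
    by_cases hj : j = i
    · subst hj; simp [hℓ, he]
    · simp [hℓ, he, hj]
  have hcont : Continuous ℓ := by
    have : Continuous fun ξ => Function.update x i ξ := continuous_const.update i continuous_id
    fun_prop
  have hconv : ∀ s : Finset (Sp d), Convex ℝ (ℓ ⁻¹' convexHull ℝ (s : Set (Sp d))) := fun s => by
    have : ℓ = AffineMap.lineMap (ℓ 0) (ℓ 0 + e) := by
      funext ξ
      rw [AffineMap.lineMap_apply, vsub_eq_sub, vadd_eq_add, add_sub_cancel_left, ← sub_eq_iff_eq_add,
        hsub, sub_zero]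
    rw [this]
    exact (convex_convexHull ℝ _).affine_preimage _
  obtain ⟨R, hR⟩ := hΩb.subset_closedBall 0
  have hfar : ∀ ξ, R < |ξ| → ℓ ξ ∉ closure Ω := fun ξ hξ hmem => by
    have h1 := closure_minimal hR Metric.isClosed_closedBall hmem
    have h2 : ‖(ℓ ξ) i‖ ≤ ‖ℓ ξ‖ := PiLp.norm_apply_le _ i
    simp only [hℓ, Function.update_self, Real.norm_eq_abs] at h2
    exact absurd (h2.trans (mem_closedBall_zero_iff.mp h1)) (not_le.mpr hξ)
  -- The line meets each element in a compact interval, so it has only finitely many break points;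
  -- between them the function is affine.
  have hfin : ∀ s ∈ 𝒯.cells, (frontier (ℓ ⁻¹' convexHull ℝ (s : Set (Sp d)))).Countable := by
    intro s hs
    have hcl : IsClosed (ℓ ⁻¹' convexHull ℝ (s : Set (Sp d))) :=
      (isCompact_cell s).isClosed.preimage hcont
    have hcpt : IsCompact (ℓ ⁻¹' convexHull ℝ (s : Set (Sp d))) := by
      refine (isCompact_Icc (a := -R) (b := R)).of_isClosed_subset hcl fun ξ hξ => abs_le.mp ?_
      by_contra hcon
      exact hfar ξ (not_le.mp hcon) (𝒯.convexHull_subset_closure hs hξ)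
    rcases (ℓ ⁻¹' convexHull ℝ (s : Set (Sp d))).eq_empty_or_nonempty with hemp | hne
    · simp [hemp]
    · obtain ⟨a, b, hI⟩ : ∃ a b, ℓ ⁻¹' convexHull ℝ (s : Set (Sp d)) = Icc a b :=
        ⟨_, _, eq_Icc_of_connected_compact ⟨hne, (hconv s).isPreconnected⟩ hcpt⟩
      rw [hI, isClosed_Icc.frontier_eq, interior_Icc]
      refine (Set.toFinite {a, b}).countable.mono fun ξ hξ => ?_
      rcases hξ.1.1.eq_or_lt with h | h
      · exact Or.inl h.symm
      · rcases hξ.1.2.eq_or_lt with h' | h'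
        · exact Or.inr h'
        · exact absurd ⟨h, h'⟩ hξ.2
  set D : Set ℝ := ⋃ s ∈ 𝒯.cells, frontier (ℓ ⁻¹' convexHull ℝ (s : Set (Sp d))) with hD
  have hDc : D.Countable := 𝒯.cells.countable_toSet.biUnion fun s hs => hfin s hs
  have hder : ∀ ξ ∉ D, ∃ h', HasDerivAt (fun ξ => v (ℓ ξ)) h' ξ ∧
      ‖h'‖ₑ ≤ 𝒯.gradMajorant A v c (ℓ ξ) := by
    intro ξ hξ
    by_cases hmem : ℓ ξ ∈ closure Ω
    · obtain ⟨s, hs, hxs⟩ := 𝒯.exists_cell hmem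
      have hint : ξ ∈ interior (ℓ ⁻¹' convexHull ℝ (s : Set (Sp d))) := by
        by_contra hcon
        exact hξ (mem_biUnion hs ⟨subset_closure hxs, hcon⟩)
      have hnear := mem_interior_iff_mem_nhds.mp hint
      by_cases hsA : s ∈ A
      · refine ⟨Inner.inner ℝ (𝒯.cellGrad s v) e, ?_, ?_⟩
        · have h1 : HasDerivAt (fun η => v (ℓ ξ) + (η - ξ) * Inner.inner ℝ (𝒯.cellGrad s v) e)
              (Inner.inner ℝ (𝒯.cellGrad s v) e) ξ := by
            simpa using (((hasDerivAt_id ξ).sub_const ξ).mul_const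
              (Inner.inner ℝ (𝒯.cellGrad s v) e)).const_add (v (ℓ ξ))
          refine h1.congr_of_eventuallyEq ?_
          filter_upwards [hnear] with η hη
          have := 𝒯.interp_sub_eq_inner hs v hη hxs
          rw [𝒯.interp_eq_self hv, hsub, inner_smul_right] at this
          linarith
        · refine le_trans ?_ (𝒯.le_gradMajorant v c hsA hxs)
          rw [← ofReal_norm]
          refine ENNReal.ofReal_le_ofReal ?_
          have := norm_inner_le_norm (𝕜 := ℝ) (𝒯.cellGrad s v) e
          rw [he1, mul_one] at this
          linarith
      · refine ⟨0, ?_, by simp⟩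
        refine (hasDerivAt_const ξ (0 : ℝ)).congr_of_eventuallyEq ?_
        filter_upwards [hnear] with η hη
        rw [← 𝒯.interp_eq_self hv, 𝒯.interp_eq_sum_cell hs hη]
        exact Finset.sum_eq_zero fun z hz => by rw [hA s hs hsA z hz, zero_mul]
    · refine ⟨0, ?_, by simp⟩
      refine (hasDerivAt_const ξ (0 : ℝ)).congr_of_eventuallyEq ?_
      filter_upwards [(isClosed_closure.isOpen_compl.preimage hcont).mem_nhds hmem] with η hη
      exact hv.2.1 _ fun h => hη (subset_closure h)
  -- A starting point on the line outside of `closure Ω`, where the function vanishes.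
  set a := min (x i) (-|R|) - 1 with ha
  have hax : a ≤ x i := by linarith [min_le_left (x i) (-|R|)]
  have ha0 : v (ℓ a) = 0 := by
    refine hv.2.1 _ fun h => hfar a ?_ (subset_closure h)
    have : a ≤ -|R| - 1 := by linarith [min_le_right (x i) (-|R|)]
    have := neg_le_abs a
    linarith [le_abs_self R]
  have hae : ∀ᵐ ξ, ξ ∉ D := compl_mem_ae_iff.mpr (hDc.measure_zero volume)
  obtain ⟨B, hB⟩ := 𝒯.gradMajorant_lt_top A v c
  have hint : IntervalIntegrable (deriv fun ξ => v (ℓ ξ)) volume a (x i) := by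
    refine (intervalIntegrable_const (c := |B|)).mono_fun
      (measurable_deriv _).aestronglyMeasurable ?_
    filter_upwards [ae_restrict_of_ae hae] with ξ hξ
    obtain ⟨h', h1, h2⟩ := hder ξ hξ
    rw [h1.deriv, Real.norm_of_nonneg (abs_nonneg B)]
    have := h2.trans (hB _)
    rw [← ofReal_norm] at this
    exact (ENNReal.ofReal_le_ofReal_iff (abs_nonneg B)).mp
      (this.trans (ENNReal.ofReal_le_ofReal (le_abs_self B)))
  have hFTC := MeasureTheory.integral_eq_of_hasDerivAt_off_countable_of_le (fun ξ => v (ℓ ξ)) _ hax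
    hDc (hv.1.comp hcont).continuousOn (fun ξ hξ => by
      obtain ⟨h', h1, -⟩ := hder ξ hξ.2
      exact h1.differentiableAt.hasDerivAt) hint
  have hxi : ℓ (x i) = WithLp.toLp 2 x := by simp [hℓ]
  rw [ha0, sub_zero, hxi, intervalIntegral.integral_of_le hax] at hFTC
  rw [← hFTC]
  refine (enorm_integral_le_lintegral_enorm _).trans ?_
  refine (lintegral_mono_ae ?_).trans (setLIntegral_le_lintegral (Ioc a (x i)) _)
  filter_upwards [ae_restrict_of_ae hae] with ξ hξ
  obtain ⟨h', h1, h2⟩ := hder ξ hξ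
  rwa [h1.deriv]

/-- A Sobolev inequality with the measure of the support. -/
theorem rpow_mul_integral_le (hd : 1 ≤ d) (hΩb : Bornology.IsBounded Ω) {v : Sp d → ℝ}
    (hv : v ∈ 𝒯.feSpace) {A : Finset (Finset (Sp d))}
    (hA : ∀ s ∈ 𝒯.cells, s ∉ A → ∀ z ∈ s, v z = 0) {c : ℝ} (hc : 0 < c) :
    c ^ (1 / (d : ℝ)) * ∫ x, v x ≤
      (∑ s ∈ A, (‖𝒯.cellGrad s v‖ + c) * volume.real (convexHull ℝ (s : Set (Sp d)))) ^
        (1 + 1 / (d : ℝ)) := by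
  have hd0 : (0 : ℝ) < d := by exact_mod_cast hd
  set f : (Fin d → ℝ) → ℝ≥0∞ := fun x => 𝒯.gradMajorant A v c (WithLp.toLp 2 x) with hf
  have hmp := PiLp.volume_preserving_toLp (Fin d)
  have hfm : Measurable f := (𝒯.measurable_gradMajorant A v c).comp hmp.measurable
  have hp : ((Fintype.card (Fin d) : ℝ) - 1) * (1 / (d : ℝ)) ≤ 1 := by
    rw [Fintype.card_fin, mul_one_div, div_le_one hd0]; linarith
  -- The inequality behind the Gagliardo-Nirenberg-Sobolev theorem, with the exponent `1/d` on each
  -- of the `d` line integrals; the exponent left for `f` itself is also `1/d`. Each line integral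
  -- dominates `|v|`, and `f ≥ c` where `v ≠ 0`, which is why the gradient was raised by `c`.
  have hgrid := lintegral_mul_prod_lintegral_pow_le (fun _ : Fin d => (volume : Measure ℝ))
    (p := 1 / (d : ℝ)) (by positivity) hp hfm
  have hexp : 1 - ((Fintype.card (Fin d) : ℝ) - 1) * (1 / (d : ℝ)) = 1 / d := by
    rw [Fintype.card_fin]; field_simp; ring
  rw [hexp, ← volume_pi] at hgrid
  have hpt : ∀ x : Fin d → ℝ, ENNReal.ofReal c ^ (1 / (d : ℝ)) * ‖v (WithLp.toLp 2 x)‖ₑ ≤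
      f x ^ (1 / (d : ℝ)) * ∏ i, (∫⁻ ξ, f (Function.update x i ξ)) ^ (1 / (d : ℝ)) := by
    intro x
    by_cases hvx : v (WithLp.toLp 2 x) = 0
    · simp [hvx]
    · refine mul_le_mul' (ENNReal.rpow_le_rpow ?_ (by positivity)) ?_
      · have hmem : WithLp.toLp 2 x ∈ Ω := by
          by_contra h
          exact hvx (hv.2.1 _ h)
        obtain ⟨s, hs, hxs⟩ := 𝒯.exists_cell (subset_closure hmem)
        have hsA : s ∈ A := by
          by_contra hsA
          refine hvx ?_
          rw [← 𝒯.interp_eq_self hv, 𝒯.interp_eq_sum_cell hs hxs]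
          exact Finset.sum_eq_zero fun z hz => by rw [hA s hs hsA z hz, zero_mul]
        exact (ENNReal.ofReal_le_ofReal (by linarith [norm_nonneg (𝒯.cellGrad s v)])).trans
          (𝒯.le_gradMajorant v c hsA hxs)
      · calc ‖v (WithLp.toLp 2 x)‖ₑ = ∏ _i : Fin d, ‖v (WithLp.toLp 2 x)‖ₑ ^ (1 / (d : ℝ)) := by
              rw [Finset.prod_const, Finset.card_univ, Fintype.card_fin, ← ENNReal.rpow_natCast,
                ← ENNReal.rpow_mul, one_div_mul_cancel hd0.ne', ENNReal.rpow_one]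
          _ ≤ _ := Finset.prod_le_prod' fun i _ => ENNReal.rpow_le_rpow
              (𝒯.enorm_le_lintegral_line hΩb hv hA hc.le x i) (by positivity)
  have hle := (lintegral_mono hpt).trans hgrid
  have htot : ∫⁻ x, f x = ENNReal.ofReal
      (∑ s ∈ A, (‖𝒯.cellGrad s v‖ + c) * volume.real (convexHull ℝ (s : Set (Sp d)))) := by
    rw [hf, hmp.lintegral_comp (𝒯.measurable_gradMajorant A v c), lintegral_gradMajorant,
      ENNReal.ofReal_sum_of_nonneg fun s _ => by positivity]
    refine Finset.sum_congr rfl fun s _ => ?_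
    rw [ENNReal.ofReal_mul (by positivity), Measure.real,
      ENNReal.ofReal_toReal (volume_cell_ne_top s)]
  have hvm : Measurable fun x => ‖v x‖ₑ := hv.1.measurable.enorm
  have hvm' : Measurable fun x : Fin d → ℝ => ‖v (WithLp.toLp 2 x)‖ₑ := hvm.comp hmp.measurable
  rw [htot, lintegral_const_mul _ hvm', hmp.lintegral_comp hvm] at hle
  have hS : 0 ≤ ∑ s ∈ A, (‖𝒯.cellGrad s v‖ + c) *
      volume.real (convexHull ℝ (s : Set (Sp d))) := Finset.sum_nonneg fun s _ => by positivity
  rw [ENNReal.ofReal_rpow_of_nonneg hc.le (by positivity),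
    ENNReal.ofReal_rpow_of_nonneg hS (by positivity)] at hle
  have h1 := (mul_le_mul_right (enorm_integral_le_lintegral_enorm (μ := volume) v)
    (ENNReal.ofReal (c ^ (1 / (d : ℝ))))).trans hle
  rw [← ofReal_norm, ← ENNReal.ofReal_mul (by positivity),
    ENNReal.ofReal_le_ofReal_iff (by positivity)] at h1
  exact (mul_le_mul_of_nonneg_left (le_abs_self _) (by positivity)).trans h1

/-- A finite element function whose energy is at most its integral. -/
theorem integral_le_of_stiff_le (hd : 1 ≤ d) (hΩb : Bornology.IsBounded Ω) {v : Sp d → ℝ}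
    (hv : v ∈ 𝒯.feSpace) {A : Finset (Finset (Sp d))} (hAc : A ⊆ 𝒯.cells)
    (hA : ∀ s ∈ 𝒯.cells, s ∉ A → ∀ z ∈ s, v z = 0) (hE : 𝒯.stiff v v ≤ ∫ x, v x) :
    ∫ x, v x ≤ 9 ^ (1 + 1 / (d : ℝ)) *
      (∑ s ∈ A, volume.real (convexHull ℝ (s : Set (Sp d)))) ^ (1 + 2 / (d : ℝ)) := by
  have hd0 : (0 : ℝ) < d := by exact_mod_cast hd
  set I := ∫ x, v x with hI
  set N := ∑ s ∈ A, volume.real (convexHull ℝ (s : Set (Sp d))) with hN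
  have hN0 : 0 ≤ N := Finset.sum_nonneg fun s _ => measureReal_nonneg
  rcases le_or_gt I 0 with hI0 | hI0
  · exact hI0.trans (by positivity)
  have hsum : ∀ c : ℝ, 0 < c → ∑ s ∈ A, (‖𝒯.cellGrad s v‖ + c) *
      volume.real (convexHull ℝ (s : Set (Sp d))) ≤ I / c + 2 * c * N := by
    intro c hc
    have h1 : ∑ s ∈ A, volume.real (convexHull ℝ (s : Set (Sp d))) * ‖𝒯.cellGrad s v‖ ^ 2 ≤ I := by
      refine le_trans ?_ hE
      rw [stiff]
      simp only [real_inner_self_eq_norm_sq]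
      exact Finset.sum_le_sum_of_subset_of_nonneg hAc fun s _ _ => by positivity
    have h2 : I / c + 2 * c * N ≥ ∑ s ∈ A, (volume.real (convexHull ℝ (s : Set (Sp d))) *
        ‖𝒯.cellGrad s v‖ ^ 2 / c + 2 * c * volume.real (convexHull ℝ (s : Set (Sp d)))) := by
      rw [Finset.sum_add_distrib, ← Finset.sum_div, ← Finset.mul_sum]
      gcongr
    refine le_trans (Finset.sum_le_sum fun s _ => ?_) h2
    set g := ‖𝒯.cellGrad s v‖
    -- Young's inequality turns the `L_1` norm of the gradient into the energy, at the cost of the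
    -- volume of the cells in `A`.
    have h3 : g ≤ g ^ 2 / c + c := by
      rw [← sub_le_iff_le_add, le_div_iff₀ hc]
      nlinarith [sq_nonneg (g - c), norm_nonneg (𝒯.cellGrad s v), sq_nonneg g, sq_nonneg c,
        sq_nonneg (g - 2 * c)]
    calc (g + c) * volume.real (convexHull ℝ (s : Set (Sp d)))
        ≤ (g ^ 2 / c + c + c) * volume.real (convexHull ℝ (s : Set (Sp d))) := by gcongr
      _ = _ := by ring
  have hNpos : 0 < N := by
    refine hN0.lt_of_ne fun h0 => ?_
    have hAe : A = ∅ := by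
      by_contra hne
      obtain ⟨s, hs⟩ := Finset.nonempty_iff_ne_empty.mpr hne
      have h4 : volume.real (convexHull ℝ (s : Set (Sp d))) ≤ N :=
        Finset.single_le_sum (f := fun s : Finset (Sp d) => volume.real (convexHull ℝ (s : Set (Sp d))))
          (fun _ _ => measureReal_nonneg) hs
      have h5 : 0 < volume.real (convexHull ℝ (s : Set (Sp d))) :=
        ENNReal.toReal_pos (𝒯.volume_cell_pos (hAc hs)).ne' (volume_cell_ne_top s)
      linarith
    have := 𝒯.rpow_mul_integral_le hd hΩb hv hA one_pos
    rw [hAe, Finset.sum_empty, Real.zero_rpow (by positivity), Real.one_rpow, one_mul] at this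
    linarith
  -- This choice balances `I / c` and `c * N`.
  set c := (I / N) ^ (1 / 2 : ℝ) with hc
  have hc0 : 0 < c := by positivity
  have hc2 : c * c = I / N := by
    rw [hc, ← Real.rpow_add (by positivity)]; norm_num
  have hIc : I / c = c * N := by
    rw [div_eq_iff hc0.ne']
    have : I = c * c * N := by rw [hc2]; field_simp
    linarith
  have key := 𝒯.rpow_mul_integral_le hd hΩb hv hA hc0
  have h6 : c ^ (1 / (d : ℝ)) * I ≤ (3 * (c * N)) ^ (1 + 1 / (d : ℝ)) := by
    refine key.trans (Real.rpow_le_rpow (Finset.sum_nonneg fun s _ => by positivity) ?_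
      (by positivity))
    refine (hsum c hc0).trans ?_
    rw [hIc]; linarith
  rw [Real.mul_rpow (by norm_num) (by positivity), Real.mul_rpow hc0.le hN0, Real.rpow_add hc0,
    Real.rpow_one] at h6
  have h7 : I ≤ 3 ^ (1 + 1 / (d : ℝ)) * (c * N ^ (1 + 1 / (d : ℝ))) := by
    have hcd : 0 < c ^ (1 / (d : ℝ)) := by positivity
    refine le_of_mul_le_mul_left (h6.trans (le_of_eq ?_)) hcd
    ring
  have hIN : I = c * (c * N) := by rw [← mul_assoc, hc2]; field_simp
  have h8 : c * N ≤ 3 ^ (1 + 1 / (d : ℝ)) * N ^ (1 + 1 / (d : ℝ)) := by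
    refine le_of_mul_le_mul_left ?_ hc0
    rw [← hIN]
    linarith
  have h9 : c ≤ 3 ^ (1 + 1 / (d : ℝ)) * N ^ (1 / (d : ℝ)) := by
    refine le_of_mul_le_mul_right ?_ hNpos
    refine h8.trans (le_of_eq ?_)
    rw [Real.rpow_add hNpos, Real.rpow_one]; ring
  calc I = c * (c * N) := hIN
    _ ≤ (3 ^ (1 + 1 / (d : ℝ)) * N ^ (1 / (d : ℝ))) *
        (3 ^ (1 + 1 / (d : ℝ)) * N ^ (1 + 1 / (d : ℝ))) := by gcongr
    _ = _ := by
        rw [show (9 : ℝ) = 3 * 3 by norm_num, Real.mul_rpow (by norm_num) (by norm_num),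
          show 1 + 2 / (d : ℝ) = 1 / d + (1 + 1 / d) by ring,
          Real.rpow_add hNpos (1 / (d : ℝ)) (1 + 1 / d)]
        ring

/-- Integrals of finite element functions by the lumped masses. -/
theorem integral_eq_sum_mass (hΩr : interior (closure Ω) = Ω) {v : Sp d → ℝ}
    (hv : v ∈ 𝒯.feSpace) : ∫ x, v x = ∑ z ∈ 𝒯.nodes, v z * 𝒯.mass z := by
  have hint : ∀ s ∈ 𝒯.cells, IntegrableOn v (convexHull ℝ (s : Set (Sp d))) := fun s _ =>
    hv.1.continuousOn.integrableOn_compact (isCompact_cell s)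
  rw [← setIntegral_eq_integral_of_forall_compl_eq_zero (s := Ω) fun x hx => hv.2.1 x hx,
    setIntegral_congr_set (𝒯.ae_eq_iUnion_interior hΩr), integral_biUnion_finset]
  · simp only [mass, Finset.mul_sum]
    rw [Finset.sum_comm]
    refine Finset.sum_congr rfl fun s hs => ?_
    rw [setIntegral_congr_set (interior_ae_eq_of_null_frontier (volume_frontier_cell s))]
    conv_lhs => rw [← 𝒯.interp_eq_self hv]
    simp only [interp]
    rw [integral_finsetSum _ fun z _ => (𝒯.integrableOn_hat_cell hs z).const_mul _]
    exact Finset.sum_congr rfl fun z _ => integral_const_mul _ _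
  · exact fun s _ => isOpen_interior.measurableSet
  · intro s hs s' hs' hne
    exact 𝒯.disjoint_interior_cells hs hs' hne
  · exact fun s hs => (hint s hs).mono_set interior_subset

theorem sum_volume_cells (hΩr : interior (closure Ω) = Ω) :
    ∑ s ∈ 𝒯.cells, volume (convexHull ℝ (s : Set (Sp d))) = volume Ω := by
  rw [measure_congr (𝒯.ae_eq_iUnion_interior hΩr), measure_biUnion_finset]
  · exact Finset.sum_congr rfl fun s _ => (measure_congr
      (interior_ae_eq_of_null_frontier (volume_frontier_cell s))).symm
  · intro s hs s' hs' hne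
    exact 𝒯.disjoint_interior_cells hs hs' hne
  · exact fun s _ => isOpen_interior.measurableSet

end Triangulation

/-- The iteration lemma of Stampacchia. -/
theorem eq_zero_of_stampacchia {φ : ℝ → ℝ} {D δ V : ℝ} (hD : 0 < D) (hδ : 0 < δ) (hV : 0 < V)
    (hφ0 : ∀ k, 0 ≤ k → 0 ≤ φ k) (hφV : φ 0 ≤ V) (hanti : ∀ k k', 0 ≤ k → k ≤ k' → φ k' ≤ φ k)
    (hφ : ∀ k k', 0 ≤ k → k < k' → (k' - k) * φ k' ≤ D * φ k ^ (1 + δ)) :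
    φ (D * V ^ δ * 2 ^ (1 + 1 / δ)) = 0 := by
  set K := D * V ^ δ * 2 ^ (1 + 1 / δ) with hK
  have hK0 : 0 < K := by positivity
  -- On the levels `K(1 - 2^{-n})` the claim is `φ ≤ V x^n`. The identity `x^δ = 1/2` matches the
  -- halving of the gaps between the levels, and `K` is fixed by `K x = 2 D V^δ`.
  set x : ℝ := 2 ^ (-(1 / δ)) with hx
  have hx0 : 0 < x := by positivity
  have hx1 : x < 1 := Real.rpow_lt_one_of_one_lt_of_neg one_lt_two (by simpa using hδ)
  have hxδ : x ^ δ = 1 / 2 := by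
    rw [hx, ← Real.rpow_mul two_pos.le, neg_mul, one_div_mul_cancel hδ.ne', Real.rpow_neg_one,
      one_div]
  have hKx : K * x = 2 * (D * V ^ δ) := by
    rw [hK, hx, mul_assoc, ← Real.rpow_add two_pos]
    simp [mul_comm]
  set k : ℕ → ℝ := fun n => K * (1 - (1 / 2) ^ n) with hk
  have hpow : ∀ n : ℕ, (1 / 2 : ℝ) ^ n ≤ 1 := fun n => pow_le_one₀ (by norm_num) (by norm_num)
  have hk0 : ∀ n, 0 ≤ k n := fun n => mul_nonneg hK0.le (by linarith [hpow n])
  have hstep : ∀ n, φ (k n) ≤ V * x ^ n := by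
    intro n
    induction n with
    | zero => simpa [hk] using hφV
    | succ n ih =>
      have hdiff : k (n + 1) - k n = K * (1 / 2) ^ n / 2 := by simp only [hk, pow_succ]; ring
      have hpos : 0 < K * (1 / 2 : ℝ) ^ n / 2 := by positivity
      have h1 := hφ (k n) (k (n + 1)) (hk0 n) (by linarith)
      have h2 : φ (k n) ^ (1 + δ) ≤ V * x ^ n * (V ^ δ * (1 / 2) ^ n) := by
        refine (Real.rpow_le_rpow (hφ0 _ (hk0 n)) ih (by linarith)).trans (le_of_eq ?_)
        rw [Real.rpow_add (by positivity), Real.rpow_one, Real.mul_rpow hV.le (by positivity),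
          ← Real.rpow_natCast x n, ← Real.rpow_mul hx0.le, mul_comm (n : ℝ), Real.rpow_mul hx0.le,
          hxδ]
        simp only [Real.rpow_natCast]
      rw [hdiff] at h1
      refine le_of_mul_le_mul_left (h1.trans ?_) hpos
      calc D * φ (k n) ^ (1 + δ) ≤ D * (V * x ^ n * (V ^ δ * (1 / 2) ^ n)) := by gcongr
        _ = (2 * (D * V ^ δ)) * (V * x ^ n * (1 / 2) ^ n) / 2 := by ring
        _ = K * (1 / 2) ^ n / 2 * (V * x ^ (n + 1)) := by rw [← hKx]; ring
  refine le_antisymm ?_ (hφ0 K hK0.le)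
  have hlim : Tendsto (fun n : ℕ => V * x ^ n) atTop (𝓝 0) := by
    simpa using (tendsto_pow_atTop_nhds_zero_of_lt_one hx0.le hx1).const_mul V
  refine ge_of_tendsto' hlim fun n => (hanti (k n) K (hk0 n) ?_).trans (hstep n)
  have : 0 ≤ (1 / 2 : ℝ) ^ n := by positivity
  simp only [hk]
  nlinarith

/-! ### The discrete torsion function -/

namespace Triangulation

variable {Ω : Set (Sp d)} (𝒯 : Triangulation Ω)

theorem stiff_hat_eq {z : Sp d} (hz : z ∈ 𝒯.nodes) (v : Sp d → ℝ) :
    𝒯.stiff v (𝒯.hat z) = 𝒯.mass z * 𝒯.opL v z := by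
  rw [opL, mul_div_cancel₀ _ (𝒯.mass_pos hz).ne']

theorem stiff_eq_sum (v w : Sp d → ℝ) :
    𝒯.stiff v w = ∑ z ∈ 𝒯.nodes, w z * (𝒯.mass z * 𝒯.opL v z) := by
  rw [stiff_comm, stiff_expand]
  exact Finset.sum_congr rfl fun z hz => by rw [stiff_comm, 𝒯.stiff_hat_eq hz]

variable {𝒯} in
/-- Truncation decreases the energy. -/
theorem OffDiagNonpos.stiff_truncation_le (h : 𝒯.OffDiagNonpos) (ψ : Sp d → ℝ) (k : ℝ)
    (hb : ∀ z ∈ 𝒯.nodes, z ∉ Ω → ψ z ≤ k) :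
    𝒯.stiff (fun z => max (ψ z - k) 0) (fun z => max (ψ z - k) 0) ≤
      𝒯.stiff ψ (fun z => max (ψ z - k) 0) := by
  set v : Sp d → ℝ := fun z => max (ψ z - k) 0 with hv
  -- Split `ψ - k` into its negative part and `v`. At a node with `ψ > k` the negative part attains
  -- its maximum `0`, so `ℒ_h` of it is nonnegative there, while `v` vanishes at all other nodes.
  -- The mixed term is thus nonnegative.
  have h1 : 𝒯.stiff ψ v = 𝒯.stiff (fun z => min (ψ z - k) 0) v + 𝒯.stiff v v := by
    have h2 : ψ = (fun z => min (ψ z - k) 0) + v + fun _ => k := by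
      funext z
      simp only [Pi.add_apply, hv, min_add_max]
      ring
    conv_lhs => rw [h2]
    rw [stiff_add_left, stiff_const_left, add_zero, stiff_add_left]
  rw [h1]
  refine le_add_of_nonneg_left ?_
  rw [stiff_eq_sum]
  refine Finset.sum_nonneg fun z hz => ?_
  rcases le_or_gt (ψ z) k with hle | hlt
  · have : v z = 0 := max_eq_right (by linarith)
    rw [this, zero_mul]
  · have hzΩ : z ∈ 𝒯.inner := mem_inner.mpr ⟨hz, by_contra fun hn => absurd (hb z hz hn) hlt.not_ge⟩
    refine mul_nonneg (le_max_right _ _) (mul_nonneg (𝒯.mass_pos hz).le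
      (h.opL_nonneg hzΩ fun y _ => ?_))
    rw [min_eq_right (by linarith : 0 ≤ ψ z - k)]
    exact min_le_right _ _

/-- The discrete torsion function is bounded independently of the triangulation. -/
theorem exists_torsion_bound (hd : 1 ≤ d) (hΩ : IsOpen Ω) (hΩb : Bornology.IsBounded Ω)
    (hΩr : interior (closure Ω) = Ω) : ∃ C : ℝ, 0 < C ∧ ∀ 𝒯 : Triangulation Ω, HasMMatrix 𝒯 →
      ∃ ψ ∈ 𝒯.feSpace, (∀ z ∈ 𝒯.inner, 𝒯.opL ψ z = 1) ∧ ∀ z ∈ 𝒯.nodes, 0 ≤ ψ z ∧ ψ z ≤ C := by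
  classical
  have hd0 : (0 : ℝ) < d := by exact_mod_cast hd
  -- The summand `1` only makes `V` positive.
  set V := volume.real Ω + 1 with hV
  have hV0 : 0 < V := by positivity
  set D : ℝ := 2 ^ (d + 1) * 9 ^ (1 + 1 / (d : ℝ)) with hD
  have hD0 : 0 < D := by positivity
  have hδ : 0 < 2 / (d : ℝ) := by positivity
  refine ⟨D * V ^ (2 / (d : ℝ)) * 2 ^ (1 + 1 / (2 / (d : ℝ))), by positivity, fun 𝒯 hM => ?_⟩
  have hoff := 𝒯.offDiagNonpos hΩr hM
  obtain ⟨ψ, hψ, hψ1⟩ := 𝒯.exists_opL_eq hΩ hΩr hM fun _ => 1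
  have hbd : ∀ z ∈ 𝒯.nodes, z ∉ Ω → ψ z = 0 := fun z _ hz => hψ.2.1 z hz
  have hnn : ∀ z ∈ 𝒯.nodes, 0 ≤ ψ z := by
    have := hoff.le_of_inner (v := -ψ) (S := 0) (fun z hz hzΩ => by simp [hbd z hz hzΩ])
      fun z hz h0 => by
        rw [opL_neg, hψ1 z hz] at h0
        norm_num at h0
    exact fun z hz => by simpa using this z hz
  -- The elements with a vertex above the level `k`; their total volume `φ k` replaces the measure
  -- of the superlevel set in Stampacchia's argument.
  set A : ℝ → Finset (Finset (Sp d)) := fun k => 𝒯.cells.filter fun s => ∃ z ∈ s, k < ψ z with hA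
  set φ : ℝ → ℝ := fun k => ∑ s ∈ A k, volume.real (convexHull ℝ (s : Set (Sp d))) with hφ
  have hanti : ∀ k k', 0 ≤ k → k ≤ k' → φ k' ≤ φ k := fun k k' _ hkk' =>
    Finset.sum_le_sum_of_subset_of_nonneg (Finset.monotone_filter_right _
      fun s _ ⟨z, hz, hlt⟩ => ⟨z, hz, hkk'.trans_lt hlt⟩) fun _ _ _ => measureReal_nonneg
  have hφV : φ 0 ≤ V := by
    have h1 : φ 0 ≤ ∑ s ∈ 𝒯.cells, volume.real (convexHull ℝ (s : Set (Sp d))) :=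
      Finset.sum_le_sum_of_subset_of_nonneg (Finset.filter_subset _ _)
        fun _ _ _ => measureReal_nonneg
    have h2 : ∑ s ∈ 𝒯.cells, volume.real (convexHull ℝ (s : Set (Sp d))) = volume.real Ω := by
      rw [Measure.real, ← 𝒯.sum_volume_cells hΩr,
        ENNReal.toReal_sum fun s _ => volume_cell_ne_top s]
      rfl
    linarith
  have hkey : ∀ k k', 0 ≤ k → k < k' → (k' - k) * φ k' ≤ D * φ k ^ (1 + 2 / (d : ℝ)) := by
    intro k k' hk hkk'
    set v₀ : Sp d → ℝ := fun z => max (ψ z - k) 0 with hv₀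
    have hv₀b : ∀ z ∈ 𝒯.nodes, z ∉ Ω → v₀ z = 0 := fun z hz hzΩ => by
      simp [hv₀, hbd z hz hzΩ, hk]
    have hv := 𝒯.interp_mem_feSpace hΩ hΩr hv₀b
    set v := 𝒯.interp v₀ with hvdef
    have hvn : ∀ z ∈ 𝒯.nodes, v z = v₀ z := fun z hz => 𝒯.interp_node v₀ hz
    have hmass : ∫ x, v x = ∑ z ∈ 𝒯.nodes, v₀ z * 𝒯.mass z := by
      rw [𝒯.integral_eq_sum_mass hΩr hv]
      exact Finset.sum_congr rfl fun z hz => by rw [hvn z hz]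
    -- The truncated torsion function is its own test function: `ℒ_h ψ = 1` turns `⟨∇ψ, ∇v⟩` into
    -- the integral of `v`.
    have hE : 𝒯.stiff v v ≤ ∫ x, v x := by
      rw [𝒯.stiff_congr hvn hvn, hmass]
      refine (hoff.stiff_truncation_le ψ k fun z hz hzΩ => by rw [hbd z hz hzΩ]; exact hk).trans ?_
      rw [stiff_eq_sum]
      refine Finset.sum_le_sum fun z hz => ?_
      by_cases hzΩ : z ∈ Ω
      · rw [hψ1 z (mem_inner.mpr ⟨hz, hzΩ⟩), mul_one]
      · have := hv₀b z hz hzΩ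
        simp only [hv₀] at this ⊢
        rw [this]; simp
    have hup := 𝒯.integral_le_of_stiff_le hd hΩb hv (A := A k) (Finset.filter_subset _ _)
      (fun s hs hsA z hz => by
        rw [hvn z (𝒯.subset_nodes hs hz)]
        refine max_eq_right ?_
        by_contra hcon
        exact hsA (Finset.mem_filter.mpr ⟨hs, z, hz, by linarith⟩)) hE
    -- Each element of `A k'` has a vertex where `v₀ ≥ k' - k`, and the integral of the hat function
    -- there is at least `2^{-d-1}` times the volume of the element. No shape regularity is
    -- involved.
    have hlow : (k' - k) * ((1 / 2) ^ (d + 1) * φ k') ≤ ∫ x, v x := by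
      rw [hmass]
      simp only [mass, Finset.mul_sum]
      rw [Finset.sum_comm]
      have hterm : ∀ s ∈ 𝒯.cells, ∀ z ∈ 𝒯.nodes,
          0 ≤ v₀ z * ∫ x in convexHull ℝ (s : Set (Sp d)), 𝒯.hat z x := fun s _ z _ =>
        mul_nonneg (le_max_right _ _) (integral_nonneg fun x => 𝒯.hat_nonneg z x)
      refine le_trans ?_ (Finset.sum_le_sum_of_subset_of_nonneg (Finset.filter_subset
        (fun s => ∃ z ∈ s, k' < ψ z) 𝒯.cells) fun s hs _ => Finset.sum_nonneg (hterm s hs))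
      simp only [hφ, hA, Finset.mul_sum]
      refine Finset.sum_le_sum fun s hs => ?_
      obtain ⟨hs, z, hz, hlt⟩ := Finset.mem_filter.mp hs
      refine le_trans ?_ (Finset.single_le_sum (hterm s hs) (𝒯.subset_nodes hs hz))
      refine mul_le_mul ?_ (𝒯.le_integral_hat_cell hs hz) (by positivity) (le_max_right _ _)
      exact le_trans (by linarith) (le_max_left _ _)
    have h3 := hlow.trans hup
    rw [mul_left_comm, one_div, inv_pow, inv_mul_le_iff₀ (by positivity)] at h3
    rw [hD]
    linarith
  have hzero := eq_zero_of_stampacchia hD0 hδ hV0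
    (fun k _ => Finset.sum_nonneg fun _ _ => measureReal_nonneg) hφV hanti hkey
  refine ⟨ψ, hψ, hψ1, fun z hz => ⟨hnn z hz, ?_⟩⟩
  by_contra hcon
  obtain ⟨s, hs, hzs⟩ := mem_nodes.mp hz
  rw [Finset.sum_eq_zero_iff_of_nonneg fun _ _ => measureReal_nonneg] at hzero
  have h4 := hzero s (Finset.mem_filter.mpr ⟨hs, z, hzs, not_le.mp hcon⟩)
  exact (ENNReal.toReal_pos (𝒯.volume_cell_pos hs).ne' (volume_cell_ne_top s)).ne' h4

end Triangulation

/-! ### Stability of the discrete error equation -/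

section Stability

variable {α T lam : ℝ} {M : ℕ} {t : ℕ → ℝ} {Ω : Set (Sp d)} {𝒯 : Triangulation Ω}

open Triangulation

/-- The mesh functions `η` and `ρ` satisfy, where `η ≥ ρ`, the one-sided error inequality
`δ_t^α (η - ρ) + ℒ_h η - lam (η - ρ) ≤ b` up to the time level `n`. -/
structure IsErrorPair (𝒯 : Triangulation Ω) (α lam : ℝ) (t : ℕ → ℝ) (b : ℕ → ℝ) (n : ℕ)
    (η ρ : ℕ → Sp d → ℝ) : Prop where
  initial : ∀ z ∈ 𝒯.inner, η 0 z = ρ 0 z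
  boundary : ∀ m, 1 ≤ m → m ≤ n → ∀ z ∈ 𝒯.nodes, z ∉ Ω → η m z = 0
  le : ∀ m, 1 ≤ m → m ≤ n → ∀ z ∈ 𝒯.inner, ρ m z ≤ η m z →
    deltaL1 α t (fun j => η j z) m - deltaL1 α t (fun j => ρ j z) m + 𝒯.opL (η m) z ≤
      b m + lam * (η m z - ρ m z)

/-- If `η` exceeds `P + W` at a level `m` for the first time, then it does so at an interior node
with `ℒ_h η ≥ 0`. There `η ≥ ρ`, as `P ≥ |ρ|`, and the one-sided inequality applies. Moreover `δ_t^α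
ρ ≤ δ_t^α P`, since `P` dominates the increments of `ρ`, and the nonnegative history of `P + W - η`
bounds `δ_t^α(P + W - η)`. The term `2λP` arises from `η - ρ ≤ (η - P - W) + 2P + W`, and `l1diag >
λ` yields the contradiction. -/
theorem IsErrorPair.le_of_barrier (hα₀ : 0 < α) (hα₁ : α < 1) (ht : IsTimeMesh T M t)
    (hs : StepCondition α lam M t) (hlam : 0 ≤ lam) (hoff : 𝒯.OffDiagNonpos) {b : ℕ → ℝ} {n : ℕ}
    (hn : n ≤ M) {η ρ : ℕ → Sp d → ℝ} (h : IsErrorPair 𝒯 α lam t b n η ρ) {P W : ℕ → ℝ}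
    (hP0 : ∀ z ∈ 𝒯.inner, |ρ 0 z| ≤ P 0)
    (hP : ∀ j ∈ Finset.Icc 1 n, ∀ z ∈ 𝒯.inner, |ρ j z - ρ (j - 1) z| ≤ P j - P (j - 1))
    (hW0 : W 0 = 0) (hWn : ∀ m, 1 ≤ m → m ≤ n → 0 ≤ P m ∧ 0 ≤ W m)
    (hW : ∀ m, 1 ≤ m → m ≤ n → b m + 2 * lam * P m ≤ deltaL1 α t W m - lam * W m) :
    ∀ m, 1 ≤ m → m ≤ n → ∀ z ∈ 𝒯.nodes, η m z ≤ P m + W m := by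
  have hρ : ∀ j ≤ n, ∀ z ∈ 𝒯.inner, |ρ j z| ≤ P j := by
    intro j
    induction j with
    | zero => exact fun _ => hP0
    | succ j ih =>
      intro hj z hz
      have h1 := ih (by omega) z hz
      have h2 := hP (j + 1) (Finset.mem_Icc.mpr ⟨by omega, hj⟩) z hz
      have h3 := abs_add_le (ρ (j + 1) z - ρ j z) (ρ j z)
      rw [sub_add_cancel] at h3
      simp only [add_tsub_cancel_right] at h2
      linarith
  intro m
  induction m using Nat.strong_induction_on with
  | _ m ih =>
    intro h1 hm
    obtain ⟨hPm, hWm⟩ := hWn m h1 hm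
    refine hoff.le_of_inner (fun z hz hzΩ => by rw [h.boundary m h1 hm z hz hzΩ]; positivity)
      fun z hz hL => ?_
    by_contra hcon
    rw [not_le] at hcon
    have hρm := abs_le.mp (hρ m hm z hz)
    have hle := h.le m h1 hm z hz (by linarith)
    have hD := deltaL1_le_of_nonneg hα₀ hα₁ ht h1 (hm.trans hn)
      (D := fun j => P j + W j - η j z) fun j hj => by
        rcases Nat.eq_zero_or_pos j with rfl | hj0
        · rw [h.initial z hz, hW0, add_zero]
          linarith [hP0 z hz, le_abs_self (ρ 0 z)]
        · linarith [ih j hj hj0 (by omega) z (mem_inner.mp hz).1]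
    rw [deltaL1_sub, deltaL1_add] at hD
    have hδρ := (abs_le.mp (abs_deltaL1_le_deltaL1 hα₀ hα₁ ht (hm.trans hn)
      (D := fun j => ρ j z) (P := P) fun j hj => hP j (Finset.Icc_subset_Icc_right hm hj) z hz)).2
    have hdiag := hs.lt_l1diag hα₁ ht h1 (hm.trans hn)
    have hb := hW m h1 hm
    have h4 := mul_pos (sub_pos.mpr hdiag) (sub_pos.mpr hcon)
    have h5 := mul_le_mul_of_nonneg_left hρm.1 hlam
    nlinarith

/-- One time step with a bound that does not degenerate as the step condition becomes sharp. -/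
theorem IsErrorPair.le_of_previous (hα₀ : 0 < α) (hα₁ : α < 1) (ht : IsTimeMesh T M t)
    (hs : StepCondition α lam M t) (hlam : 0 ≤ lam) (hoff : 𝒯.OffDiagNonpos) {b : ℕ → ℝ} {n : ℕ}
    (hn : n ≤ M) {η ρ : ℕ → Sp d → ℝ} (h : IsErrorPair 𝒯 α lam t b n η ρ) {ψ : Sp d → ℝ} {Cψ : ℝ}
    (hψ : ψ ∈ 𝒯.feSpace) (hψ1 : ∀ z ∈ 𝒯.inner, 𝒯.opL ψ z = 1)
    (hψb : ∀ z ∈ 𝒯.nodes, 0 ≤ ψ z ∧ ψ z ≤ Cψ) {L₀ Y B : ℝ} (hL₀ : 0 < L₀) (hY : 0 ≤ Y) (hB : 0 ≤ B)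
    {m : ℕ} (h1 : 1 ≤ m) (hm : m ≤ n) (hL : L₀ ≤ l1diag α t m)
    (hρ : ∀ j ≤ m, ∀ z ∈ 𝒯.inner, |ρ j z| ≤ Y) (hb : b m ≤ Y)
    (hη : ∀ j < m, ∀ z ∈ 𝒯.inner, η j z ≤ B * Y) :
    ∀ z ∈ 𝒯.nodes, η m z ≤ (2 * B + 5 + 2 / L₀ + (2 * lam * B + 5 * lam + 1) * Cψ) * Y := by
  intro z₀ hz₀
  have hCψ : 0 ≤ Cψ := (hψb z₀ hz₀).1.trans (hψb z₀ hz₀).2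
  set X := (2 * lam * B + 5 * lam + 1) * Y with hX
  have hX0 : 0 ≤ X := by positivity
  have hdiag := hs.lt_l1diag hα₁ ht h1 (hm.trans hn)
  set q := l1diag α t m with hq
  have hkey : ∀ z ∈ 𝒯.inner, ρ m z ≤ η m z →
      (q - lam) * η m z + 𝒯.opL (η m) z ≤ (q * B + 2 * q + 1 + lam) * Y := by
    intro z hz hge
    have hle := h.le m h1 hm z hz hge
    have hD := deltaL1_le_of_nonneg hα₀ hα₁ ht h1 (hm.trans hn)
      (D := fun j => B * Y - η j z) fun j hj => sub_nonneg.mpr (hη j hj z hz)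
    rw [deltaL1_sub, deltaL1_const, zero_sub] at hD
    have hδρ := (abs_le.mp (abs_deltaL1_le_of_bound hα₀ hα₁ ht h1 (hm.trans hn)
      (D := fun j => ρ j z) fun j hj => hρ j hj z hz)).2
    have h5 := mul_le_mul_of_nonneg_left (abs_le.mp (hρ m le_rfl z hz)).1 hlam
    nlinarith
  -- For `q ≥ 2λ` the zero-order coefficient `q - λ` is at least `q/2`, and dividing by it is
  -- harmless.
  rcases le_or_gt (2 * lam) q with hcase | hcase
  · have hq0 : 0 < q := hL₀.trans_le hL
    have hbound : ∀ z ∈ 𝒯.nodes, η m z ≤ (2 * B + 5 + 2 / L₀) * Y := by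
      have hS : 0 ≤ (2 * B + 5 + 2 / L₀) * Y := by positivity
      refine hoff.le_of_inner (fun z hz hzΩ => by rw [h.boundary m h1 hm z hz hzΩ]; exact hS)
        fun z hz hLη => ?_
      rcases le_or_gt (η m z) Y with hle | hgt
      · refine hle.trans (le_mul_of_one_le_left hY ?_)
        have : 0 ≤ 2 / L₀ := by positivity
        linarith
      · have h6 := hkey z hz ((le_abs_self _).trans ((hρ m le_rfl z hz).trans hgt.le))
        have h7 : q / 2 * η m z ≤ (q - lam) * η m z :=
          mul_le_mul_of_nonneg_right (by linarith) (hY.trans hgt.le)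
        refine le_of_mul_le_mul_left ?_ (half_pos hq0)
        have h8 : 1 ≤ q * (1 / L₀) := by
          rw [mul_one_div, one_le_div hL₀]; exact hL
        calc q / 2 * η m z ≤ (q * B + 2 * q + 1 + lam) * Y := by linarith
          _ ≤ (q * B + 2 * q + q * (1 / L₀) + q / 2) * Y :=
            mul_le_mul_of_nonneg_right (by linarith) hY
          _ = q / 2 * ((2 * B + 5 + 2 / L₀) * Y) := by ring
    refine (hbound z₀ hz₀).trans (mul_le_mul_of_nonneg_right ?_ hY)
    exact le_add_of_nonneg_right (by positivity)
  -- Here `q - λ` is positive but may be arbitrarily small, so only its sign is used. Since `q <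
  -- 2λ`, the right-hand side is at most `X`, and the multiple `X ψ` of the torsion function, with
  -- `ℒ_h(X ψ) = X`, serves as the barrier.
  · have hv : ∀ z ∈ 𝒯.nodes, (η m - X • ψ) z ≤ Y := by
      refine hoff.le_of_inner (fun z hz hzΩ => ?_) fun z hz hLv => ?_
      · simp [h.boundary m h1 hm z hz hzΩ, hψ.2.1 z hzΩ, hY]
      · rw [opL_sub, opL_smul, hψ1 z hz, mul_one] at hLv
        have hψz : 0 ≤ X * ψ z := mul_nonneg hX0 (hψb z (mem_inner.mp hz).1).1
        have hval : (η m - X • ψ) z = η m z - X * ψ z := rfl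
        rw [hval]
        rcases le_or_gt (η m z) Y with hle | hgt
        · linarith
        · have h6 := hkey z hz ((le_abs_self _).trans ((hρ m le_rfl z hz).trans hgt.le))
          have h7 : (q * B + 2 * q + 1 + lam) * Y ≤ X :=
            mul_le_mul_of_nonneg_right (by nlinarith) hY
          have h8 := mul_pos (sub_pos.mpr hdiag) (hY.trans_lt hgt)
          linarith
    have h9 : η m z₀ - X * ψ z₀ ≤ Y := hv z₀ hz₀
    have h10 := mul_le_mul_of_nonneg_left (hψb z₀ hz₀).2 hX0
    have h11 : 0 ≤ (2 * B + 4 + 2 / L₀) * Y := by positivity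
    rw [hX] at h9 h10
    linarith

/-- A stability bound whose constant may depend on the number of time steps. -/
theorem exists_stability_bound (hα₀ : 0 < α) (hα₁ : α < 1) (hlam : 0 ≤ lam) (Cψ : ℝ) (hCψ : 0 < Cψ)
    {L₀ : ℝ} (hL₀ : 0 < L₀) (N : ℕ) : ∃ A : ℝ, 0 ≤ A ∧ ∀ (T : ℝ) (M : ℕ) (t : ℕ → ℝ)
      (𝒯 : Triangulation Ω), M ≤ N → IsTimeMesh T M t → StepCondition α lam M t →
      𝒯.OffDiagNonpos → (∀ m, 1 ≤ m → m ≤ M → L₀ ≤ l1diag α t m) →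
      (∃ ψ ∈ 𝒯.feSpace, (∀ z ∈ 𝒯.inner, 𝒯.opL ψ z = 1) ∧ ∀ z ∈ 𝒯.nodes, 0 ≤ ψ z ∧ ψ z ≤ Cψ) →
      ∀ (b : ℕ → ℝ) (n : ℕ), n ≤ M → ∀ η ρ : ℕ → Sp d → ℝ, IsErrorPair 𝒯 α lam t b n η ρ →
      ∀ Y, 0 ≤ Y → (∀ j ≤ n, ∀ z ∈ 𝒯.inner, |ρ j z| ≤ Y) → (∀ m, 1 ≤ m → m ≤ n → b m ≤ Y) →
      ∀ m, 1 ≤ m → m ≤ n → ∀ z ∈ 𝒯.nodes, η m z ≤ A * Y := by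
  set G : ℝ → ℝ := fun B => 2 * B + 5 + 2 / L₀ + (2 * lam * B + 5 * lam + 1) * Cψ with hG
  have hGB : ∀ B, 0 ≤ B → B ≤ G B := fun B hB => by
    have : 0 ≤ 2 / L₀ + (2 * lam * B + 5 * lam + 1) * Cψ := by positivity
    simp only [hG]; linarith
  -- The amplification after `n` steps, obtained by iterating the one-step bound.
  set A : ℕ → ℝ := fun n => G^[n] 1 with hA
  have hAs : ∀ n, A (n + 1) = G (A n) := fun n => Function.iterate_succ_apply' G n 1
  have hA1 : ∀ n, 1 ≤ A n := by
    intro n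
    induction n with
    | zero => exact le_rfl
    | succ n ih => rw [hAs]; exact ih.trans (hGB _ (zero_le_one.trans ih))
  have hAm : Monotone A := monotone_nat_of_le_succ fun n => by
    rw [hAs]; exact hGB _ (zero_le_one.trans (hA1 n))
  refine ⟨A N, zero_le_one.trans (hA1 N), fun T M t 𝒯 hMN ht hs hoff hL ⟨ψ, hψ, hψ1, hψb⟩ b n hn
    η ρ h Y hY hρ hb => ?_⟩
  have key : ∀ m, m ≤ n → ∀ z ∈ 𝒯.inner, η m z ≤ A m * Y := by
    intro m
    induction m using Nat.strong_induction_on with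
    | _ m ih =>
      intro hm z hz
      rcases Nat.eq_zero_or_pos m with rfl | h1
      · rw [h.initial z hz]
        exact (le_abs_self _).trans ((hρ 0 hm z hz).trans (le_mul_of_one_le_left hY (hA1 0)))
      · obtain ⟨k, rfl⟩ : ∃ k, m = k + 1 := ⟨m - 1, by omega⟩
        rw [hAs]
        exact h.le_of_previous hα₀ hα₁ ht hs hlam hoff hn hψ hψ1 hψb hL₀ hY
          (zero_le_one.trans (hA1 k)) h1 hm (hL _ h1 (hm.trans hn))
          (fun j hj => hρ j (hj.trans hm)) (hb _ h1 hm)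
          (fun j hj y hy => (ih j hj (by omega) y hy).trans
            (mul_le_mul_of_nonneg_right (hAm (by omega)) hY)) z (mem_inner.mp hz).1
  intro m h1 hm z hz
  by_cases hzΩ : z ∈ Ω
  · exact (key m hm z (mem_inner.mpr ⟨hz, hzΩ⟩)).trans
      (mul_le_mul_of_nonneg_right (hAm (hm.trans (hn.trans hMN))) hY)
  · rw [h.boundary m h1 hm z hz hzΩ]
    exact mul_nonneg (zero_le_one.trans (hA1 N)) hY

end Stability

/-! ### The temporal error -/

section Temporal

variable {α T lam r κ K : ℝ}

/-- On fine quasi-graded meshes the truncation errors of all functions with the given weak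
singularity have a common barrier of the size of the temporal error. -/
theorem exists_temporal_barrier_of_exponent (hα₀ : 0 < α) (hα₁ : α < 1) (hr : 1 ≤ r) (hκ : 0 < κ)
    (hK : 0 ≤ K) {p g β A : ℝ} {E : ℕ → ℝ → ℝ} (hp0 : 0 ≤ p) (hp1 : p < 1 + α)
    (hpr : p ≤ (2 - α) / r) (hA : 0 ≤ A)
    (hbar : HasBarrier α T r κ lam (fun τ s => τ ^ (-g) * (τ / s) ^ p) β)
    (hE : ∀ (M : ℕ) (τ s : ℝ), 1 ≤ M → κ⁻¹ * (M : ℝ) ^ (-r) ≤ τ → τ ≤ κ * (M : ℝ) ^ (-r) →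
      τ ≤ s → s ≤ T → τ ^ g * s ^ β ≤ A * E M s) :
    ∃ C : ℝ, 0 ≤ C ∧ ∃ M₀ : ℕ, ∀ M, M₀ ≤ M → ∀ t : ℕ → ℝ, IsTimeMesh T M t →
      IsQuasiGraded r κ M t → ∃ W : ℕ → ℝ, W 0 = 0 ∧ ∀ m, 1 ≤ m → m ≤ M →
        0 ≤ W m ∧ W m ≤ C * E M (t m) ∧ ∀ y, HasWeakSingularity α T K y →
          |deltaL1 α t (fun j => y (t j)) m - caputo α y (t m)| ≤ deltaL1 α t W m - lam * W m := by
  obtain ⟨C₁, hC₁, htr⟩ := exists_truncation_bound hα₀ hα₁ hr hκ hK hp0 hp1 hpr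
  obtain ⟨C₂, hC₂, M₀, hW⟩ := hbar
  refine ⟨C₁ * C₂ * A, by positivity, M₀, fun M hM t ht hq => ?_⟩
  obtain ⟨W, hW0, hW⟩ := hW M hM t ht hq
  have hτ := ht.pos' le_rfl ht.pos
  refine ⟨fun j => C₁ * t 1 ^ g * W j, by simp [hW0], fun m h1 hm => ?_⟩
  obtain ⟨w1, w2, w3⟩ := hW m h1 hm
  have htm := ht.pos' h1 hm
  refine ⟨by positivity, ?_, fun y hy => ?_⟩
  · have h := hE M (t 1) (t m) ht.pos hq.first_ge hq.first_le (ht.le h1 hm) (ht.le_final hm)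
    calc C₁ * t 1 ^ g * W m ≤ C₁ * t 1 ^ g * (C₂ * t m ^ β) := by gcongr
      _ = C₁ * C₂ * (t 1 ^ g * t m ^ β) := by ring
      _ ≤ C₁ * C₂ * (A * E M (t m)) := by gcongr
      _ = _ := by ring
  · refine (htr T M t ht hq y hy m h1 hm).trans ?_
    rw [deltaL1_smul]
    have h := mul_le_mul_of_nonneg_left w3 (show 0 ≤ C₁ * t 1 ^ g by positivity)
    have h2 : C₁ * t 1 ^ g * (t 1 ^ (-g) * (t 1 / t m) ^ p) = C₁ * (t 1 / t m) ^ p := by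
      have : t 1 ^ g * t 1 ^ (-g) = 1 := by rw [← Real.rpow_add hτ]; simp
      linear_combination C₁ * (t 1 / t m) ^ p * this
    rw [h2] at h
    linarith

theorem HasBarrier.congr {F F' : ℝ → ℝ → ℝ} {β : ℝ} (h : HasBarrier α T r κ lam F β)
    (hF : ∀ τ s, 0 < τ → 0 < s → F' τ s = F τ s) : HasBarrier α T r κ lam F' β := by
  obtain ⟨C, hC, M₀, H⟩ := h
  refine ⟨C, hC, M₀, fun M hM t ht hq => ?_⟩
  obtain ⟨W, hW0, hW⟩ := H M hM t ht hq
  refine ⟨W, hW0, fun m h1 hm => ?_⟩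
  rw [hF _ _ (ht.pos' le_rfl ht.pos) (ht.pos' h1 hm)]
  exact hW m h1 hm

/-- The right-hand side equals `s^{-p}` and no longer depends on `τ`; since `p < 1`, the exponent `α
- p` is above the critical one. -/
theorem hasBarrier_quotient (hα₀ : 0 < α) (hα₁ : α < 1) (hr : 1 ≤ r) (hκ : 0 < κ) (hT : 0 < T)
    (hlam : 0 ≤ lam) {p : ℝ} (hp : p < 1) :
    HasBarrier α T r κ lam (fun τ s => τ ^ (-p) * (τ / s) ^ p) (α - p) := by
  refine (hasBarrier_rpow hα₀ hα₁ hr hκ hT hlam (by linarith)).congr fun τ s hτ hs => ?_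
  rw [Real.div_rpow hτ.le hs.le, Real.rpow_neg hτ.le, show α - p - α = -p by ring,
    Real.rpow_neg hs.le]
  field_simp

/-- The three regimes differ in the admissible truncation exponent `p ≤ (2 - α)/r`. For `r < 2 - α`
some `p = 1 + g > 1` is allowed, and the critical barrier gives `τ t_m^{α-1}`. For `r = 2 - α` an
exponent just below the limit `1` is used, which costs `ε`. For `r > 2 - α` the exponent `p = (2 -
α)/r < 1` is taken, and `τ^p` is of the order `M^{α-2}`. -/
theorem exists_temporal_barrier (hα₀ : 0 < α) (hα₁ : α < 1) (hr : 1 ≤ r) (hκ : 0 < κ) (hT : 0 < T)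
    (hlam : 0 ≤ lam) (hK : 0 ≤ K) {ε : ℝ} (hε : 0 < ε) :
    ∃ C : ℝ, 0 ≤ C ∧ ∃ M₀ : ℕ, ∀ M, M₀ ≤ M → ∀ t : ℕ → ℝ, IsTimeMesh T M t →
      IsQuasiGraded r κ M t → ∃ W : ℕ → ℝ, W 0 = 0 ∧ ∀ m, 1 ≤ m → m ≤ M →
        0 ≤ W m ∧ W m ≤ C * errorE α r ε M (t m) ∧ ∀ y, HasWeakSingularity α T K y →
          |deltaL1 α t (fun j => y (t j)) m - caputo α y (t m)| ≤ deltaL1 α t W m - lam * W m := by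
  have hr0 : 0 < r := by linarith
  rcases lt_trichotomy r (2 - α) with hlt | heq | hgt
  · have hq1 : 1 < (2 - α) / r := (one_lt_div hr0).mpr hlt
    set g := min α ((2 - α) / r - 1) / 2 with hg
    have hg0 : 0 < g := half_pos (lt_min hα₀ (by linarith))
    have hgα : g < α := by linarith [min_le_left α ((2 - α) / r - 1)]
    have hgr : g < (2 - α) / r - 1 := by linarith [min_le_right α ((2 - α) / r - 1)]
    refine exists_temporal_barrier_of_exponent (p := 1 + g) (g := 1) (β := α - 1) (A := κ) hα₀ hα₁
      hr hκ hK (by linarith) (by linarith) (by linarith) hκ.le ?_ ?_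
    · refine (hasBarrier_critical hα₀ hα₁ hr hκ hT hlam hg0 hgα (by linarith)).congr
        fun τ s hτ hs => ?_
      rw [Real.rpow_add (by positivity), Real.rpow_one, Real.rpow_neg_one]
      field_simp
    · intro M τ s hM _ hτ hτs _
      have : 0 ≤ κ⁻¹ * (M : ℝ) ^ (-r) := by positivity
      rw [errorE, if_pos hlt, Real.rpow_one, ← mul_assoc]
      exact mul_le_mul_of_nonneg_right hτ (Real.rpow_nonneg (by linarith) _)
  -- For `ε > 1` this is negative. Then `p = 0` is used, and `κ⁻¹ M^{-r} ≤ τ ≤ s` shows that the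
  -- factor `(M^{-r})^q s^{-q}` of the error term is bounded below.
  · set q := 1 - ε with hq
    have hp1 : max q 0 < 1 := max_lt (by linarith) one_pos
    have hrα : (2 - α) / r = 1 := by rw [heq, div_self (by linarith)]
    refine exists_temporal_barrier_of_exponent (p := max q 0) (g := max q 0) (β := α - max q 0)
      (A := κ ^ |q|) hα₀ hα₁ hr hκ hK (le_max_right _ _) (by linarith) (by rw [hrα]; exact hp1.le)
      (by positivity) (hasBarrier_quotient hα₀ hα₁ hr hκ hT hlam hp1) ?_
    intro M τ s hM hτ1 hτ2 hτs _
    have hM0 : (0 : ℝ) < M := by exact_mod_cast hM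
    have hτ0 : 0 < τ := lt_of_lt_of_le (by positivity) hτ1
    have hs0 : 0 < s := hτ0.trans_le hτs
    rw [errorE, if_neg heq.not_lt, if_pos heq, ← hq, Real.rpow_mul hM0.le]
    rcases le_total 0 q with h0 | h0
    · rw [max_eq_left h0, abs_of_nonneg h0, ← mul_assoc, ← Real.mul_rpow hκ.le (by positivity)]
      gcongr
    · rw [max_eq_right h0, abs_of_nonpos h0, Real.rpow_zero, one_mul, sub_zero, ← mul_assoc,
        Real.rpow_sub hs0, mul_div_assoc', mul_comm, mul_div_assoc]
      refine le_mul_of_one_le_right (by positivity) ?_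
      rw [one_le_div (by positivity), Real.rpow_neg hκ.le, ← Real.inv_rpow hκ.le,
        ← Real.mul_rpow (by positivity) (by positivity)]
      exact Real.rpow_le_rpow_of_nonpos (by positivity) (hτ1.trans hτs) h0
  · have hp0 : 0 < (2 - α) / r := div_pos (by linarith) hr0
    have hp1 : (2 - α) / r < 1 := (div_lt_one hr0).mpr hgt
    refine exists_temporal_barrier_of_exponent (p := (2 - α) / r) (g := (2 - α) / r)
      (β := α - (2 - α) / r) (A := κ ^ ((2 - α) / r)) hα₀ hα₁ hr hκ hK hp0.le (by linarith) le_rfl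
      (by positivity) (hasBarrier_quotient hα₀ hα₁ hr hκ hT hlam hp1) ?_
    intro M τ s hM hτ1 hτ2 hτs _
    have hM0 : (0 : ℝ) < M := by exact_mod_cast hM
    have hτ0 : 0 < τ := lt_of_lt_of_le (by positivity) hτ1
    have hs0 : 0 < s := hτ0.trans_le hτs
    rw [errorE, if_neg hgt.not_gt, if_neg hgt.ne', ← mul_assoc]
    refine mul_le_mul_of_nonneg_right ?_ (by positivity)
    refine (Real.rpow_le_rpow hτ0.le hτ2 hp0.le).trans (le_of_eq ?_)
    rw [Real.mul_rpow hκ.le (by positivity), ← Real.rpow_mul hM0.le]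
    congr 2
    field_simp
    ring

theorem errorE_nonneg {ε : ℝ} (M : ℕ) {s : ℝ} (hs : 0 ≤ s) : 0 ≤ errorE α r ε M s := by
  unfold errorE
  split_ifs <;> positivity

theorem min_rpow_le {a b x : ℝ} (ha : 0 < a) (hx : x ∈ Icc a b) (q : ℝ) :
    min (a ^ q) (b ^ q) ≤ x ^ q := by
  rcases le_total 0 q with h | h
  · exact (min_le_left _ _).trans (Real.rpow_le_rpow ha.le hx.1 h)
  · exact (min_le_right _ _).trans (Real.rpow_le_rpow_of_nonpos (ha.trans_le hx.1) hx.2 h)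

/-- For a bounded number of steps, the temporal error is bounded below. -/
theorem exists_errorE_ge (hκ : 0 < κ) (hT : 0 < T) (ε : ℝ) (N : ℕ) :
    ∃ c : ℝ, 0 < c ∧ ∀ M ≤ N, ∀ t : ℕ → ℝ, IsTimeMesh T M t → IsQuasiGraded r κ M t →
      ∀ m, 1 ≤ m → m ≤ M → c ≤ errorE α r ε M (t m) := by
  have hN : (0 : ℝ) < N + 1 := by positivity
  set lo := κ⁻¹ * min ((1 : ℝ) ^ (-r)) ((N + 1 : ℝ) ^ (-r)) with hlo
  have hlo0 : 0 < lo := mul_pos (inv_pos.mpr hκ) (lt_min (by positivity) (by positivity))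
  have key : ∀ p q : ℝ, ∃ c : ℝ, 0 < c ∧ ∀ M ≤ N, ∀ t : ℕ → ℝ, IsTimeMesh T M t →
      IsQuasiGraded r κ M t → ∀ m, 1 ≤ m → m ≤ M → c ≤ (M : ℝ) ^ p * (t m) ^ q := by
    intro p q
    refine ⟨min ((1 : ℝ) ^ p) ((N + 1 : ℝ) ^ p) * min (lo ^ q) (T ^ q),
      mul_pos (lt_min (by positivity) (by positivity)) (lt_min (by positivity) (by positivity)),
      fun M hM t ht hq m h1 hm => ?_⟩
    have hMI : (M : ℝ) ∈ Icc (1 : ℝ) (N + 1) :=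
      ⟨by exact_mod_cast ht.pos, by exact_mod_cast hM.trans (Nat.le_succ N)⟩
    have htI : t m ∈ Icc lo T := by
      refine ⟨?_, ht.le_final hm⟩
      refine le_trans ?_ (hq.first_ge.trans (ht.le h1 hm))
      exact mul_le_mul_of_nonneg_left (min_rpow_le one_pos hMI _) (inv_pos.mpr hκ).le
    exact mul_le_mul (min_rpow_le one_pos hMI _) (min_rpow_le hlo0 htI _)
      (le_min (by positivity) (by positivity)) (by positivity)
  unfold errorE
  split_ifs
  · exact key _ _
  · exact key _ _
  · exact key _ _

/-- On the bounded interval `(0, T)` the summand `1` is at most `T^{l-α} s^{α-l}`. The sign of `K`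
is not prescribed, hence `max K 0`. -/
theorem TimeRegular.hasWeakSingularity {Ω : Set (Sp d)} {u : Sp d → ℝ → ℝ} (hα₁ : α < 1)
    (hT : 0 < T) (hK : TimeRegular α T K Ω u) {x : Sp d} (hx : x ∈ Ω)
    (hc : ContinuousOn (u x) (Icc 0 T)) :
    HasWeakSingularity α T (max K 0 * (1 + T ^ (1 - α) + T ^ (2 - α))) (u x) := by
  have key : ∀ l ∈ ({1, 2} : Set ℕ), ∀ s ∈ Ioo 0 T, |iteratedDeriv l (u x) s| ≤
      max K 0 * (1 + T ^ (1 - α) + T ^ (2 - α)) * s ^ (α - (l : ℝ)) := by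
    intro l hl s hs
    have h1 : ‖iteratedDeriv l (u x) s‖ₑ ≤ ENNReal.ofReal (K * (1 + s ^ (α - (l : ℝ)))) :=
      (le_iSup₂ (f := fun y (_ : y ∈ Ω) => ‖iteratedDeriv l (u y) s‖ₑ) x hx).trans
        (hK.bound l hl s hs)
    have hsp : 0 < s ^ (α - (l : ℝ)) := Real.rpow_pos_of_pos hs.1 _
    have h2 : |iteratedDeriv l (u x) s| ≤ max K 0 * (1 + s ^ (α - (l : ℝ))) := by
      rw [← ofReal_norm] at h1
      refine (ENNReal.ofReal_le_ofReal_iff (by positivity)).mp (h1.trans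
        (ENNReal.ofReal_le_ofReal ?_))
      exact mul_le_mul_of_nonneg_right (le_max_left _ _) (by positivity)
    refine h2.trans ?_
    rw [mul_assoc]
    refine mul_le_mul_of_nonneg_left ?_ (le_max_right _ _)
    have h3 : 1 ≤ T ^ ((l : ℝ) - α) * s ^ (α - (l : ℝ)) := by
      have hl1 : (1 : ℝ) ≤ l := by
        rcases hl with rfl | rfl <;> norm_num
      calc (1 : ℝ) = s ^ ((l : ℝ) - α) * s ^ (α - (l : ℝ)) := by
            rw [← Real.rpow_add hs.1]; simp
        _ ≤ _ := mul_le_mul_of_nonneg_right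
            (Real.rpow_le_rpow hs.1.le hs.2.le (by linarith)) hsp.le
    have h4 : T ^ ((l : ℝ) - α) ≤ T ^ (1 - α) + T ^ (2 - α) := by
      have e1 : 0 ≤ T ^ (1 - α) := by positivity
      have e2 : 0 ≤ T ^ (2 - α) := by positivity
      rcases hl with rfl | rfl
      · simpa using e2
      · simpa using e1
    nlinarith [mul_le_mul_of_nonneg_right h4 hsp.le]
  refine ⟨hc, hK.differentiable x hx, fun s hs => ?_, fun s hs => ?_⟩
  · simpa [iteratedDeriv_one] using key 1 (by simp) s hs
  · have := key 2 (by simp) s hs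
    rw [iteratedDeriv_succ, iteratedDeriv_one] at this
    exact_mod_cast this

end Temporal

/-! ### The error bound -/

section ErrorBound

variable {α T lam r κ K : ℝ} {Ω : Set (Sp d)} {f : Sp d → ℝ → ℝ → ℝ} {u w : Sp d → ℝ → ℝ}

open Triangulation

/-- The Ritz projection satisfies `ℒ_h R_h u(z) = -Δu(z)`, so subtracting the scheme from the
differential equation at a node leaves the truncation error and `f(u) - f(U)`. As `η - ρ = u - U`,
the condition `η ≥ ρ` says `u ≥ U`, which is what the one-sided condition on `f` needs. The second
pair is the same argument for `U - u`. -/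
theorem isErrorPair (hΩ : IsOpen Ω) (hΩr : interior (closure Ω) = Ω) (hf : AssumptionA1 Ω T lam f)
    (hu : IsSolution α T Ω f u w) {𝒯 : Triangulation Ω} (hM : HasMMatrix 𝒯) {M : ℕ} {t : ℕ → ℝ}
    (ht : IsTimeMesh T M t) {U : ℕ → Sp d → ℝ}
    (hU : IsDiscreteSolution 𝒯 α f (fun x => u x 0) M t U) {b : ℕ → ℝ} {n : ℕ} (hn : n ≤ M)
    (hb : ∀ m, 1 ≤ m → m ≤ n → ∀ z ∈ Ω,
      |deltaL1 α t (fun j => u z (t j)) m - caputo α (u z) (t m)| ≤ b m) :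
    IsErrorPair 𝒯 α lam t b n (fun j => ritz 𝒯 (fun y => w y (t j)) - U j)
      (fun j z => ritzError 𝒯 u w z (t j)) ∧
    IsErrorPair 𝒯 α lam t b n (fun j => -(ritz 𝒯 (fun y => w y (t j)) - U j))
      (fun j z => -ritzError 𝒯 u w z (t j)) := by
  rw [isDiscreteSolution_iff hΩ hΩr] at hU
  obtain ⟨hU0, hU⟩ := hU
  have hini : ∀ z, (ritz 𝒯 (fun y => w y (t 0)) - U 0) z = ritzError 𝒯 u w z (t 0) := fun z => by
    rw [Pi.sub_apply, hU0, ht.zero, ritzError]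
  have hbd : ∀ m, 1 ≤ m → m ≤ n → ∀ z ∈ 𝒯.nodes, z ∉ Ω →
      (ritz 𝒯 (fun y => w y (t m)) - U m) z = 0 := fun m h1 hm z _ hz => by
    rw [Pi.sub_apply, (𝒯.ritz_spec hΩ hΩr hM _).1.2.1 z hz,
      (hU m (Finset.mem_Icc.mpr ⟨h1, hm.trans hn⟩)).1.2.1 z hz, sub_zero]
  have hmain : ∀ m, 1 ≤ m → m ≤ n → ∀ z ∈ 𝒯.inner,
      deltaL1 α t (fun j => (ritz 𝒯 (fun y => w y (t j)) - U j) z) m -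
        deltaL1 α t (fun j => ritzError 𝒯 u w z (t j)) m +
        𝒯.opL (ritz 𝒯 (fun y => w y (t m)) - U m) z =
      (deltaL1 α t (fun j => u z (t j)) m - caputo α (u z) (t m)) -
        (f z (t m) (u z (t m)) - f z (t m) (U m z)) := fun m h1 hm z hz => by
    have e1 := (hU m (Finset.mem_Icc.mpr ⟨h1, hm.trans hn⟩)).2 z hz
    have e2 := hu.equation z (mem_inner.mp hz).2 (t m)
      ⟨ht.pos' h1 (hm.trans hn), ht.le_final (hm.trans hn)⟩
    rw [opL_sub, (𝒯.ritz_spec hΩ hΩr hM _).2 z hz, ← deltaL1_sub]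
    have e3 : deltaL1 α t (fun j => (ritz 𝒯 (fun y => w y (t j)) - U j) z -
        ritzError 𝒯 u w z (t j)) m =
        deltaL1 α t (fun j => u z (t j)) m - deltaL1 α t (fun j => U j z) m := by
      rw [← deltaL1_sub]
      congr 1
      funext j
      simp only [Pi.sub_apply, ritzError]
      ring
    rw [e3]
    linarith
  have hdiff : ∀ m z, (ritz 𝒯 (fun y => w y (t m)) - U m) z - ritzError 𝒯 u w z (t m) =
      u z (t m) - U m z := fun m z => by
    simp only [Pi.sub_apply, ritzError]; ring
  have htI : ∀ m, 1 ≤ m → m ≤ n → t m ∈ Ioc 0 T := fun m h1 hm =>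
    ⟨ht.pos' h1 (hm.trans hn), ht.le_final (hm.trans hn)⟩
  refine ⟨⟨fun z _ => hini z, hbd, fun m h1 hm z hz hge => ?_⟩,
    ⟨fun z _ => congrArg Neg.neg (hini z), fun m h1 hm z hz hzΩ => ?_,
      fun m h1 hm z hz hge => ?_⟩⟩
  · have hzΩ := (mem_inner.mp hz).2
    have h2 := hdiff m z
    have h3 := hf.one_sided z hzΩ (t m) (htI m h1 hm) (u z (t m)) (U m z) (by linarith)
    have h4 := (abs_le.mp (hb m h1 hm z hzΩ)).2
    rw [hmain m h1 hm z hz, h2]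
    linarith
  · rw [Pi.neg_apply, hbd m h1 hm z hz hzΩ, neg_zero]
  · have hzΩ := (mem_inner.mp hz).2
    have h2 := hdiff m z
    simp only [Pi.neg_apply] at hge ⊢
    have h3 := hf.one_sided z hzΩ (t m) (htI m h1 hm) (U m z) (u z (t m)) (by linarith)
    have h4 := (abs_le.mp (hb m h1 hm z hzΩ)).1
    have h5 := hmain m h1 hm z hz
    have h6 : -(ritz 𝒯 (fun y => w y (t m)) - U m) z - -ritzError 𝒯 u w z (t m) =
        U m z - u z (t m) := by linarith
    rw [deltaL1_neg, deltaL1_neg, opL_neg, h6]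
    linarith

/-- The bound for the difference between the Ritz projection and the discrete solution, in terms of
a majorant `P` of the Ritz error. -/
theorem exists_ritz_sub_le (hd : 1 ≤ d) (hΩ : IsOpen Ω) (hΩb : Bornology.IsBounded Ω)
    (hΩr : interior (closure Ω) = Ω) (hα₀ : 0 < α) (hα₁ : α < 1) (hT : 0 < T) (hlam : 0 ≤ lam)
    (hf : AssumptionA1 Ω T lam f) (hu : IsSolution α T Ω f u w) (hK : TimeRegular α T K Ω u)
    (hr : 1 ≤ r) (hκ : 0 < κ) {ε : ℝ} (hε : 0 < ε) :
    ∃ C : ℝ, 0 ≤ C ∧ ∀ (M : ℕ) (t : ℕ → ℝ) (𝒯 : Triangulation Ω), IsTimeMesh T M t →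
      IsQuasiGraded r κ M t → StepCondition α lam M t → HasMMatrix 𝒯 →
      ∀ U, IsDiscreteSolution 𝒯 α f (fun x => u x 0) M t U → ∀ n, 1 ≤ n → n ≤ M →
      ∀ P : ℕ → ℝ, (∀ z ∈ Ω, |ritzError 𝒯 u w z (t 0)| ≤ P 0) → 0 ≤ P 0 →
      (∀ j ∈ Finset.Icc 1 n, 0 ≤ P j - P (j - 1) ∧ ∀ z ∈ Ω,
        |ritzError 𝒯 u w z (t j) - ritzError 𝒯 u w z (t (j - 1))| ≤ P j - P (j - 1)) →
      ∀ z ∈ 𝒯.nodes, |(ritz 𝒯 (fun y => w y (t n)) - U n) z| ≤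
        C * (errorE α r ε M (t n) + P n) := by
  obtain ⟨Cψ, hCψ, htors⟩ := exists_torsion_bound hd hΩ hΩb hΩr
  set K₁ := max K 0 * (1 + T ^ (1 - α) + T ^ (2 - α)) with hK₁
  have hK₁0 : 0 ≤ K₁ := mul_nonneg (le_max_right _ _) (by positivity)
  have hr0 : 0 < r := by linarith
  have hsing : ∀ z ∈ Ω, HasWeakSingularity α T K₁ (u z) := fun z hz =>
    hK.hasWeakSingularity hα₁ hT hz (hu.continuousOn_time z hz)
  -- With `p = 0` the truncation error is merely bounded; this is used for coarse meshes only.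
  obtain ⟨C₁, hC₁, htr⟩ := exists_truncation_bound (p := 0) hα₀ hα₁ hr hκ hK₁0 le_rfl
    (by linarith) (div_nonneg (by linarith) hr0.le)
  obtain ⟨C₂, hC₂, M₂, hbar⟩ := exists_temporal_barrier hα₀ hα₁ hr hκ hT hlam hK₁0 hε
  -- With `β = α` the right-hand side of this barrier is the constant `1`. Multiplied by `2λ P n` it
  -- pays for the term `2λ P m`.
  obtain ⟨C₃, hC₃, M₃, hone⟩ := hasBarrier_of_nonneg (T := T) hα₀ hα₁ hr hκ hlam hα₀.le
  set N := max M₂ M₃ with hN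
  have hL₀ : 0 < (Real.Gamma (2 - α))⁻¹ * T ^ (-α) :=
    mul_pos (inv_pos.mpr (Real.Gamma_pos_of_pos (by linarith))) (by positivity)
  obtain ⟨A, hA, hstab⟩ := exists_stability_bound (d := d) (Ω := Ω) hα₀ hα₁ hlam Cψ hCψ hL₀ N
  obtain ⟨c, hc, hEge⟩ := exists_errorE_ge (α := α) (r := r) hκ hT ε N
  refine ⟨C₂ + 1 + 2 * lam * C₃ * T ^ α + A * (C₁ / c + 1), by positivity,
    fun M t 𝒯 ht hq hs hM U hU n h1 hn P hP0 hP00 hP => ?_⟩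
  have hoff := 𝒯.offDiagNonpos hΩr hM
  have hPn : ∀ j ≤ n, 0 ≤ P j ∧ P j ≤ P n ∧ ∀ z ∈ Ω, |ritzError 𝒯 u w z (t j)| ≤ P j := by
    have hmono : ∀ j ≤ n, ∀ i ≤ j, P i ≤ P j := by
      intro j
      induction j with
      | zero => intro _ i hi; rw [Nat.le_zero.mp hi]
      | succ j ih =>
        intro hj i hi
        rcases hi.eq_or_lt with rfl | hlt
        · exact le_rfl
        · have h2 := (hP (j + 1) (Finset.mem_Icc.mpr ⟨by omega, hj⟩)).1
          simp only [add_tsub_cancel_right] at h2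
          linarith [ih (by omega) i (by omega)]
    intro j hj
    refine ⟨hP00.trans (hmono j hj 0 (Nat.zero_le j)), hmono n le_rfl j hj, ?_⟩
    induction j with
    | zero => exact hP0
    | succ j ih =>
      intro z hz
      have h2 := (hP (j + 1) (Finset.mem_Icc.mpr ⟨by omega, hj⟩)).2 z hz
      have h3 := abs_add_le (ritzError 𝒯 u w z (t (j + 1)) - ritzError 𝒯 u w z (t j))
        (ritzError 𝒯 u w z (t j))
      rw [sub_add_cancel] at h3
      simp only [add_tsub_cancel_right] at h2
      linarith [ih (by omega) z hz]
  have hE0 := errorE_nonneg (α := α) (r := r) (ε := ε) M (ht.nonneg hn)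
  set E := errorE α r ε M (t n) with hE
  have hPn0 := (hPn n le_rfl).1
  suffices H : ∀ z ∈ 𝒯.nodes,
      (ritz 𝒯 (fun y => w y (t n)) - U n) z ≤ (C₂ + 1 + 2 * lam * C₃ * T ^ α) * (E + P n) +
        A * (C₁ / c + 1) * (E + P n) ∧
      (-(ritz 𝒯 (fun y => w y (t n)) - U n)) z ≤
        (C₂ + 1 + 2 * lam * C₃ * T ^ α) * (E + P n) + A * (C₁ / c + 1) * (E + P n) by
    intro z hz
    rw [add_mul]
    exact abs_le'.mpr (H z hz)
  -- For `M ≥ N` all barriers are available. For `M < N` the number of steps is bounded, and the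
  -- constant truncation bound is turned into a multiple of the temporal error, which is then at
  -- least `c`.
  rcases le_or_gt N M with hNM | hNM
  · obtain ⟨W, hW0, hW⟩ := hbar M ((le_max_left _ _).trans hNM) t ht hq
    obtain ⟨V, hV0, hV⟩ := hone M ((le_max_right _ _).trans hNM) t ht hq
    obtain ⟨p1, p2⟩ := isErrorPair hΩ hΩr hf hu hM ht hU hn
      (b := fun m => deltaL1 α t W m - lam * W m)
      fun m h1 hm z hz => (hW m h1 (hm.trans hn)).2.2 _ (hsing z hz)
    have hVb : V n ≤ C₃ * T ^ α := (hV n h1 hn).2.1.trans (mul_le_mul_of_nonneg_left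
      (Real.rpow_le_rpow (ht.nonneg hn) (ht.le_final hn) hα₀.le) hC₃)
    have hfin : P n + (W n + 2 * lam * P n * V n) ≤
        (C₂ + 1 + 2 * lam * C₃ * T ^ α) * (E + P n) + A * (C₁ / c + 1) * (E + P n) := by
      have e1 := (hW n h1 hn).2.1
      have e2 := mul_le_mul_of_nonneg_left hVb (show 0 ≤ 2 * lam * P n by positivity)
      have e3 : 0 ≤ A * (C₁ / c + 1) * (E + P n) := by positivity
      have e4 : 0 ≤ C₂ * P n + E + 2 * lam * C₃ * T ^ α * E := by positivity
      linarith
    have hWn : ∀ m, 1 ≤ m → m ≤ n → 0 ≤ P m ∧ 0 ≤ W m + 2 * lam * P n * V m := fun m h1 hm => by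
      have := (hW m h1 (hm.trans hn)).1
      have := (hV m h1 (hm.trans hn)).1
      exact ⟨(hPn m hm).1, by positivity⟩
    have hWb : ∀ m, 1 ≤ m → m ≤ n → deltaL1 α t W m - lam * W m + 2 * lam * P m ≤
        deltaL1 α t (fun j => W j + 2 * lam * P n * V j) m -
          lam * (W m + 2 * lam * P n * V m) := fun m h1 hm => by
      have e1 := (hV m h1 (hm.trans hn)).2.2
      simp only [sub_self, Real.rpow_zero] at e1
      have e2 := mul_le_mul_of_nonneg_left e1 (show 0 ≤ 2 * lam * P n by positivity)
      have e3 := mul_le_mul_of_nonneg_left (hPn m hm).2.1 (show 0 ≤ 2 * lam by positivity)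
      rw [deltaL1_add, deltaL1_smul]
      linarith
    have hW0' : W 0 + 2 * lam * P n * V 0 = 0 := by simp [hW0, hV0]
    intro z hz
    refine ⟨le_trans ?_ hfin, le_trans ?_ hfin⟩
    · exact p1.le_of_barrier hα₀ hα₁ ht hs hlam hoff hn (fun z hz => hP0 z (mem_inner.mp hz).2)
        (fun j hj z hz => (hP j hj).2 z (mem_inner.mp hz).2) hW0' hWn hWb n h1 le_rfl z hz
    · refine p2.le_of_barrier hα₀ hα₁ ht hs hlam hoff hn (fun z hz => ?_)
        (fun j hj z hz => ?_) hW0' hWn hWb n h1 le_rfl z hz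
      · rw [abs_neg]; exact hP0 z (mem_inner.mp hz).2
      · rw [← neg_sub', abs_neg]; exact (hP j hj).2 z (mem_inner.mp hz).2
  · obtain ⟨p1, p2⟩ := isErrorPair hΩ hΩr hf hu hM ht hU hn (b := fun _ => C₁)
      fun m h1 hm z hz => by
        simpa using htr T M t ht hq (u z) (hsing z hz) m h1 (hm.trans hn)
    have hY : 0 ≤ C₁ + P n := by positivity
    have hfin : A * (C₁ + P n) ≤
        (C₂ + 1 + 2 * lam * C₃ * T ^ α) * (E + P n) + A * (C₁ / c + 1) * (E + P n) := by
      have e1 : C₁ ≤ C₁ / c * E := by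
        rw [div_mul_eq_mul_div, le_div_iff₀ hc]
        exact mul_le_mul_of_nonneg_left (hEge M hNM.le t ht hq n h1 hn) hC₁
      have e2 : C₁ + P n ≤ (C₁ / c + 1) * (E + P n) := by
        have : 0 ≤ C₁ / c * P n := by positivity
        linarith
      have e3 := mul_le_mul_of_nonneg_left e2 hA
      have e4 : 0 ≤ (C₂ + 1 + 2 * lam * C₃ * T ^ α) * (E + P n) := by positivity
      linarith
    have hst := hstab T M t 𝒯 hNM.le ht hs hoff
      (fun m h1 hm => l1diag_ge hα₀ hα₁ ht h1 hm) (htors 𝒯 hM) (fun _ => C₁) n hn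
    have hρ : ∀ j ≤ n, ∀ z ∈ 𝒯.inner, |ritzError 𝒯 u w z (t j)| ≤ C₁ + P n := fun j hj z hz =>
      ((hPn j hj).2.2 z (mem_inner.mp hz).2).trans (by linarith [(hPn j hj).2.1])
    intro z hz
    refine ⟨(hst _ _ p1 _ hY hρ (fun m _ _ => by linarith) n h1 le_rfl z hz).trans hfin,
      (hst _ _ p2 _ hY (fun j hj z hz => ?_) (fun m _ _ => by linarith) n h1 le_rfl z hz).trans
        hfin⟩
    rw [abs_neg]
    exact hρ j hj z hz

/-- The fundamental theorem of calculus for absolutely continuous functions. With the lower Lebesgue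
integral no measurability in time of the supremum is needed. -/
theorem enorm_sub_le_lintegral {ρ : Sp d → ℝ → ℝ} {x : Sp d} (hx : x ∈ Ω)
    (h : AbsolutelyContinuousOnInterval (ρ x) 0 T) {a b : ℝ} (ha : 0 ≤ a) (hab : a ≤ b)
    (hb : b ≤ T) : ‖ρ x b - ρ x a‖ₑ ≤
      ∫⁻ s in Ioc a b, supNorm Ω (fun x => deriv (ρ x) s) := by
  have hab' : AbsolutelyContinuousOnInterval (ρ x) a b := by
    refine h.mono ?_
    rw [uIcc_of_le hab, uIcc_of_le (ha.trans (hab.trans hb))]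
    exact Icc_subset_Icc ha hb
  rw [← hab'.integral_deriv_eq_sub, intervalIntegral.integral_of_le hab]
  refine (enorm_integral_le_lintegral_enorm _).trans (lintegral_mono fun s => ?_)
  exact le_iSup₂ (f := fun y (_ : y ∈ Ω) => ‖deriv (ρ y) s‖ₑ) x hx

/-- The error bound of the lumped-mass L1 scheme. -/
theorem exists_error_bound (hd : 1 ≤ d) (hΩ : IsOpen Ω) (hΩb : Bornology.IsBounded Ω)
    (hΩr : interior (closure Ω) = Ω) (hα₀ : 0 < α) (hα₁ : α < 1) (hT : 0 < T) (hlam : 0 ≤ lam)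
    (hf : AssumptionA1 Ω T lam f) (hu : IsSolution α T Ω f u w) (hK : TimeRegular α T K Ω u)
    (hr : 1 ≤ r) (hκ : 0 < κ) {ε : ℝ} (hε : 0 < ε) : ∃ C : ℝ,
      ∀ (M : ℕ) (t : ℕ → ℝ) (𝒯 : Triangulation Ω), IsTimeMesh T M t → IsQuasiGraded r κ M t →
      StepCondition α lam M t → HasMMatrix 𝒯 →
      (∀ x ∈ Ω, AbsolutelyContinuousOnInterval (ritzError 𝒯 u w x) 0 T) →
      ∀ U, IsDiscreteSolution 𝒯 α f (fun x => u x 0) M t U → ∀ m ∈ Finset.Icc 1 M,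
        supNorm Ω (fun x => u x (t m) - U m x) ≤
          ENNReal.ofReal C * (ENNReal.ofReal (errorE α r ε M (t m)) +
            max (supNorm Ω (fun x => ritzError 𝒯 u w x 0))
              (supNorm Ω (fun x => ritzError 𝒯 u w x (t m))) +
            ∫⁻ s in Set.Ioc 0 (t m), supNorm Ω (fun x => deriv (ritzError 𝒯 u w x) s)) := by
  obtain ⟨C, hC, H⟩ := exists_ritz_sub_le hd hΩ hΩb hΩr hα₀ hα₁ hT hlam hf hu hK hr hκ hε
  refine ⟨C + 1, fun M t 𝒯 ht hq hs hM hAC U hU n hn => ?_⟩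
  obtain ⟨h1, hn⟩ := Finset.mem_Icc.mp hn
  set S := supNorm Ω (fun x => ritzError 𝒯 u w x 0) with hS
  set I : ℝ → ℝ≥0∞ := fun b =>
    ∫⁻ s in Ioc 0 b, supNorm Ω (fun x => deriv (ritzError 𝒯 u w x) s) with hI
  set E := errorE α r ε M (t n) with hE
  have hE0 : 0 ≤ E := errorE_nonneg M (ht.nonneg hn)
  -- Of the maximum only the value at `t = 0` is used: the error at `t_n` is controlled by it and
  -- the time integral.
  have hSI : S + I (t n) ≤ max S (supNorm Ω (fun x => ritzError 𝒯 u w x (t n))) + I (t n) :=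
    add_le_add_left (le_max_left _ _) _
  rw [add_assoc]
  refine le_trans ?_ (mul_le_mul_right (add_le_add_right hSI _) _)
  -- An infinite right-hand side stays infinite after multiplication, since `C + 1 > 0`.
  by_cases htop : S + I (t n) = ⊤
  · rw [htop, add_top, ENNReal.mul_top (by simp; linarith)]
    exact le_top
  obtain ⟨hStop, hItop⟩ := ENNReal.add_ne_top.mp htop
  have hsplit : ∀ j ∈ Finset.Icc 1 n, I (t j) = I (t (j - 1)) +
      ∫⁻ s in Ioc (t (j - 1)) (t j), supNorm Ω (fun x => deriv (ritzError 𝒯 u w x) s) := by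
    intro j hj
    obtain ⟨j1, j2⟩ := Finset.mem_Icc.mp hj
    simp only [hI]
    rw [← lintegral_union measurableSet_Ioc (Ioc_disjoint_Ioc_of_le le_rfl),
      Ioc_union_Ioc_eq_Ioc (ht.nonneg (by omega)) (ht.le (by omega) (j2.trans hn))]
  have hfin : ∀ j ≤ n, I (t j) ≠ ⊤ := fun j hj => ne_top_of_le_ne_top hItop
    (lintegral_mono_set (Ioc_subset_Ioc_right (ht.le hj hn)))
  -- The increments of this majorant are the integrals of `‖∂_t ρ‖` over the time steps, so it
  -- dominates the increments of `ρ` at every point.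
  set P : ℕ → ℝ := fun j => S.toReal + (I (t j)).toReal with hP
  have hS0 : ∀ x ∈ Ω, |ritzError 𝒯 u w x 0| ≤ S.toReal := fun x hx => by
    have h2 : ‖ritzError 𝒯 u w x 0‖ₑ ≤ S :=
      le_iSup₂ (f := fun y (_ : y ∈ Ω) => ‖ritzError 𝒯 u w y 0‖ₑ) x hx
    have h3 := ENNReal.toReal_mono hStop h2
    rwa [toReal_enorm] at h3
  have hP0 : P 0 = S.toReal := by simp [hP, hI, ht.zero]
  have hnodes := H M t 𝒯 ht hq hs hM U hU n h1 hn P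
    (fun z hz => by rw [ht.zero, hP0]; exact hS0 z hz) (by rw [hP0]; exact ENNReal.toReal_nonneg)
    fun j hj => by
      obtain ⟨j1, j2⟩ := Finset.mem_Icc.mp hj
      have hfj := hfin j j2
      rw [hsplit j hj] at hfj
      obtain ⟨-, hf2⟩ := ENNReal.add_ne_top.mp hfj
      have hPj : P j - P (j - 1) = (∫⁻ s in Ioc (t (j - 1)) (t j),
          supNorm Ω (fun x => deriv (ritzError 𝒯 u w x) s)).toReal := by
        simp only [hP]
        rw [hsplit j hj, ENNReal.toReal_add (hfin _ (by omega)) hf2]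
        ring
      rw [hPj]
      refine ⟨ENNReal.toReal_nonneg, fun z hz => ?_⟩
      have h2 := ENNReal.toReal_mono hf2 (enorm_sub_le_lintegral hz (hAC z hz)
        (ht.nonneg (j := j - 1) (by omega)) (ht.le (by omega) (j2.trans hn))
        (ht.le_final (j2.trans hn)))
      rwa [toReal_enorm] at h2
  have hPn0 : 0 ≤ P n := add_nonneg ENNReal.toReal_nonneg ENNReal.toReal_nonneg
  have hUn := ((isDiscreteSolution_iff hΩ hΩr).mp hU).2 n (Finset.mem_Icc.mpr ⟨h1, hn⟩)
  have hη : ritz 𝒯 (fun y => w y (t n)) - U n ∈ 𝒯.feSpace :=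
    𝒯.feSpace.sub_mem (𝒯.ritz_spec hΩ hΩr hM _).1 hUn.1
  refine iSup₂_le fun x hx => ?_
  have hηx : |(ritz 𝒯 (fun y => w y (t n)) - U n) x| ≤ C * (E + P n) :=
    abs_le'.mpr ⟨𝒯.le_of_nodes hη (fun z hz => (abs_le'.mp (hnodes z hz)).1) (subset_closure hx),
      𝒯.le_of_nodes (𝒯.feSpace.neg_mem hη) (fun z hz => (abs_le'.mp (hnodes z hz)).2)
        (subset_closure hx)⟩
  have hρx : |ritzError 𝒯 u w x (t n)| ≤ P n := by
    have h2 := ENNReal.toReal_mono hItop (enorm_sub_le_lintegral hx (hAC x hx) le_rfl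
      (ht.nonneg hn) (ht.le_final hn))
    rw [toReal_enorm] at h2
    have h3 := abs_add_le (ritzError 𝒯 u w x (t n) - ritzError 𝒯 u w x 0) (ritzError 𝒯 u w x 0)
    rw [sub_add_cancel] at h3
    have h4 := hS0 x hx
    rw [Real.norm_eq_abs] at h2
    simp only [hP]
    linarith
  -- The extra `1` in the constant is the contribution of `ρ` in `u - U = η - ρ`.
  have hreal : |u x (t n) - U n x| ≤ (C + 1) * (E + P n) := by
    have h2 : u x (t n) - U n x =
        (ritz 𝒯 (fun y => w y (t n)) - U n) x - ritzError 𝒯 u w x (t n) := by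
      simp only [Pi.sub_apply, ritzError]; ring
    rw [h2]
    have h3 := abs_sub ((ritz 𝒯 (fun y => w y (t n)) - U n) x) (ritzError 𝒯 u w x (t n))
    linarith
  rw [← ofReal_norm, Real.norm_eq_abs]
  refine (ENNReal.ofReal_le_ofReal hreal).trans (le_of_eq ?_)
  rw [ENNReal.ofReal_mul (by linarith), ENNReal.ofReal_add hE0 hPn0,
    ENNReal.ofReal_add ENNReal.toReal_nonneg ENNReal.toReal_nonneg, ENNReal.ofReal_toReal hStop,
    ENNReal.ofReal_toReal hItop]

end ErrorBound

end LumpedFE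

end

theorem theorem7p1 {d : ℕ} (hd₁ : 1 ≤ d) (hd₃ : d ≤ 3)
    (Ω : Set (Sp d)) (hΩ : IsOpen Ω) (hΩb : Bornology.IsBounded Ω)
    (hΩr : interior (closure Ω) = Ω)
    (α T lam : ℝ) (hα₀ : 0 < α) (hα₁ : α < 1) (hT : 0 < T) (hlam : 0 ≤ lam)
    (f : Sp d → ℝ → ℝ → ℝ) (hf : AssumptionA1 Ω T lam f)
    (u w : Sp d → ℝ → ℝ) (hu : IsSolution α T Ω f u w)
    (hu₀ : MeasureTheory.MemLp (fun x => u x 0) ⊤ (MeasureTheory.volume.restrict Ω))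
    (K : ℝ) (hK : TimeRegular α T K Ω u) :
    -- existence and uniqueness of the discrete solution
    (∀ (M : ℕ) (t : ℕ → ℝ) (𝒯 : Triangulation Ω), IsTimeMesh T M t → StepCondition α lam M t →
      HasMMatrix 𝒯 →
      ∃ U, IsDiscreteSolution 𝒯 α f (fun x => u x 0) M t U ∧
        ∀ V, IsDiscreteSolution 𝒯 α f (fun x => u x 0) M t V → ∀ m ≤ M, V m = U m) ∧
    -- the error bound
    (∀ r κ ε : ℝ, 1 ≤ r → 0 < κ → 0 < ε → ∃ C : ℝ,
      ∀ (M : ℕ) (t : ℕ → ℝ) (𝒯 : Triangulation Ω), IsTimeMesh T M t → IsQuasiGraded r κ M t →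
      StepCondition α lam M t → HasMMatrix 𝒯 →
      (∀ x ∈ Ω, AbsolutelyContinuousOnInterval (ritzError 𝒯 u w x) 0 T) →
      ∀ U, IsDiscreteSolution 𝒯 α f (fun x => u x 0) M t U → ∀ m ∈ Finset.Icc 1 M,
        supNorm Ω (fun x => u x (t m) - U m x) ≤
          ENNReal.ofReal C * (ENNReal.ofReal (errorE α r ε M (t m)) +
            max (supNorm Ω (fun x => ritzError 𝒯 u w x 0))
              (supNorm Ω (fun x => ritzError 𝒯 u w x (t m))) +
            ∫⁻ s in Set.Ioc 0 (t m), supNorm Ω (fun x => deriv (ritzError 𝒯 u w x) s))) ∧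
    -- bounds for the discrete solution
    (∀ σ₁ σ₂ : ℝ, AssumptionA2 Ω T σ₁ σ₂ f → (∀ x ∈ Ω, σ₁ ≤ u x 0 ∧ u x 0 ≤ σ₂) →
      ∀ (M : ℕ) (t : ℕ → ℝ) (𝒯 : Triangulation Ω), IsTimeMesh T M t → StepCondition α lam M t →
      HasMMatrix 𝒯 →
      ∀ U, IsDiscreteSolution 𝒯 α f (fun x => u x 0) M t U →
        ∀ m ≤ M, ∀ x ∈ Ω, σ₁ ≤ U m x ∧ U m x ≤ σ₂) :=
  ⟨fun _ _ 𝒯 ht hs hM =>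
      have hoff := 𝒯.offDiagNonpos hΩr hM
      have ⟨U, hU⟩ := exists_discreteSolution hΩ hΩr hoff hα₁ ht hs hf _
      ⟨U, hU, fun _ hV => discreteSolution_unique hΩ hΩr hoff hα₁ ht hs hf hU hV⟩,
    fun _ _ _ hr hκ hε => exists_error_bound hd₁ hΩ hΩb hΩr hα₀ hα₁ hT hlam hf hu hK hr hκ hε,
    fun _ _ h2 h0 _ _ 𝒯 ht hs hM _ hU =>
      discreteSolution_bounds hΩ hΩr (𝒯.offDiagNonpos hΩr hM) hα₀ hα₁ ht hs hf h2 h0 hU⟩
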